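/- **Conventions.** A flat Gauss diagram on one circle is an oriented circle with $n$ arrows whose $2n$ endpoints are distinct points of the circle; a flat knot is an equivalence class of such diagrams under flat Reidemeister moves, and its crossing number is the minimal number of arrows of a diagram. (The arrow at a crossing points from the strand $x$ to the strand $y$ where the directions of $(x,y)$ form a positive frame.) For an arrow $e$ let $e^+$ be the open interval of the circle from its tail to its head. A flat knot is *almost classical* if it has a diagram in which, for each arrow $e$, the interval $e^+$ contains as many arrow tails as arrow heads. The *based matrix* of a diagram $D$ with an ordering $e_1,\dots,e_n$ of its arrows is the $(n+1)\times(n+1)$ integer matrix of the intersection numbers $b$ of the classes $s,[e_1^+],\dots,[e_n^+]$ in the first homology of the Carter surface of $D$, where $s$ is the class of the whole curve. A *filling* is a partition of $\{e_1,\dots,e_n\}$ into blocks of one or two elements; its matrix is the matrix of $b$, extended by linearity, on $s$ and the sums of $[e^+]$ over the blocks. The *genus* of a based matrix is half the minimal rank of the matrix of a filling. The *algebraic genus* $g_a(\alpha)$ of a flat knot $\alpha$ is the genus of the based matrix of any diagram of $\alpha$ (it is the same for all of them), and $\alpha$ is *algebraically slice* if $g_a(\alpha)=0$. A flat knot is *slice*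 if a diagram of it can be transformed into the trivial diagram by a finite sequence of flat Reidemeister moves, births, deaths and saddle moves such that the number of saddles equals the number of births and deaths and the resulting cobordism surface is connected. **Statement.** Let ac11.7183 be the flat knot with Gauss code (O for a tail, U for a head) $$\mathtt{O1\,O2\,U3\,O4\,U5\,O3\,U6\,U7\,O8\,O9\,U4\,O10\,U11\,O6\,U10\,U1\,O7\,O5\,U2\,O11\,U9\,U8}.$$ The based matrix of this diagram, with the arrows ordered $1,\dots,11$, is $$M=\begin{bmatrix} 0&0&0&0&0&0&0&0&0&0&0&0\\ 0&0&-1&1&0&1&0&0&0&-1&-1&1\\ 0&1&0&0&2&0&-1&0&-1&-2&-1&2\\ 0&-1&0&0&0&0&1&1&0&0&0&-1\\ 0&0&-2&0&0&2&0&1&-1&-2&-1&3\\ 0&-1&0&0&-2&0&0&-1&2&3&1&-2\\ 0&0&1&-1&0&0&0&0&0&1&0&-1\\ 0&0&0&-1&-1&1&0&0&0&1&0&0\\ 0&0&1&0&1&-2&0&0&0&0&1&-1\\ 0&1&2&0&2&-3&-1&-1&0&0&1&-1\\ 0&1&1&0&1&-1&0&0&-1&-1&0&0\\ 0&-1&-2&1&-3&2&1&0&1&1&0&0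 \end{bmatrix}.$$ The flat knot ac11.7183 has crossing number $11$, is almost classical, and has algebraic genus $g_a(\mathrm{ac}11.7183)=1$. Hence it is not algebraically slice and not slice. The same holds for every flat knot that has a diagram with based matrix $M$ for some ordering of its arrows, and the minimal rank of the matrix of a filling of $M$ is $2$. Consequently, it is not true that every almost classical flat knot is algebraically slice, nor that every almost classical flat knot is slice. -/

import Mathlib

namespace FlatKnots

/-! ### Gauss diagrams -/

/-- An endpoint of an arrow: the label of the arrow, and `true` for its tail (the letter `O` of a
Gauss code), `false` for its head (the letter `U`). -/
abbrev Endpoint := ℕ × Bool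

/-- An oriented circle of a Gauss diagram, given by the endpoints on it in the order in which they
are met; it is to be read cyclically. The empty list is a circle without endpoints. -/
abbrev Circle := List Endpoint

/-- A list of circles is a Gauss diagram if every arrow that occurs has exactly one tail and exactly
one head. -/
def IsGauss (C : List Circle) : Prop :=
  C.flatten.Nodup ∧ ∀ p ∈ C.flatten, (p.1, !p.2) ∈ C.flatten

instance (C : List Circle) : Decidable (IsGauss C) :=
  inferInstanceAs (Decidable (_ ∧ _))

/-- The endpoint `q` comes immediately after the endpoint `p` on one of the circles. -/
def Follows (C : List Circle) (p q : Endpoint) : Prop :=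
  ∃ c ∈ C, ∃ u : List Endpoint, c.IsRotated (p :: q :: u)

/-- Remove from a circle all endpoints of the arrows in `S`. -/
def eraseArrows (S : Finset ℕ) (c : Circle) : Circle :=
  c.filter fun p => p.1 ∉ S

/-- Exchange `p₁` with `q₁`, `p₂` with `q₂`, and `p₃` with `q₃` on a circle. -/
def exchange (p₁ q₁ p₂ q₂ p₃ q₃ : Endpoint) (c : Circle) : Circle :=
  c.map fun x => Equiv.swap p₁ q₁ (Equiv.swap p₂ q₂ (Equiv.swap p₃ q₃ x))

/-- `FlatMove C g`: the map `g`, applied to every circle of the Gauss diagram `C`, is a renaming of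
the arrows, a crossing-reducing first or second flat Reidemeister move, or a third flat Reidemeister
move. An arrow points from the strand `x` to the strand `y` of a crossing when the directions of
`(x, y)` form a positive frame. Hence the two arrows of a bigon have opposite directions between its
two strands, which may run in parallel or in opposite directions; and the three arrows of a
triangle are directed, between its three strands, transitively or cyclically. -/
inductive FlatMove (C : List Circle) : (Circle → Circle) → Prop
  | rename (f : Equiv.Perm ℕ) :
      FlatMove C (List.map fun p => (f p.1, p.2))
  | fr1 (a : ℕ) (t : Bool) (h : Follows C (a, t) (a, !t)) :
      FlatMove C (eraseArrows {a})
  | fr2_parallel (a b : ℕ) (t : Bool) (hab : a ≠ b)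
      (h₁ : Follows C (a, t) (b, !t)) (h₂ : Follows C (a, !t) (b, t)) :
      FlatMove C (eraseArrows {a, b})
  | fr2_opposite (a b : ℕ) (t : Bool) (hab : a ≠ b)
      (h₁ : Follows C (a, t) (b, !t)) (h₂ : Follows C (b, t) (a, !t)) :
      FlatMove C (eraseArrows {a, b})
  | fr3_transitive (a b c : ℕ) (hab : a ≠ b) (hac : a ≠ c) (hbc : b ≠ c)
      (h₁ : Follows C (a, true) (b, true)) (h₂ : Follows C (a, false) (c, true))
      (h₃ : Follows C (b, false) (c, false)) :
      FlatMove C (exchange (a, true) (b, true) (a, false) (c, true) (b, false) (c, false))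
  | fr3_cyclic (a b c : ℕ) (hab : a ≠ b) (hac : a ≠ c) (hbc : b ≠ c)
      (h₁ : Follows C (b, false) (a, true)) (h₂ : Follows C (a, false) (c, true))
      (h₃ : Follows C (c, false) (b, true)) :
      FlatMove C (exchange (b, false) (a, true) (a, false) (c, true) (c, false) (b, true))

/-! ### Flat knots -/

/-- A Gauss diagram of a flat knot: a Gauss diagram on one circle. -/
structure KnotDiagram where
  word : Circle
  isGauss : IsGauss [word]

namespace KnotDiagram

/-- The arrows of the diagram, that is, its flat crossings. -/
def arrows (D : KnotDiagram) : Finset ℕ := (D.word.map Prod.fst).toFinset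

/-- The set of arrows as a type. -/
abbrev Arrow (D : KnotDiagram) : Type := {a : ℕ // a ∈ D.arrows}

/-- Two diagrams differ by the choice of the base point on the circle or by one move. -/
def Step (D E : KnotDiagram) : Prop :=
  D.word.IsRotated E.word ∨ ∃ g, FlatMove [D.word] g ∧ E.word = g D.word

/-- The endpoints in the open interval `a⁺` that leads from the tail to the head of the arrow `a`
in the direction of the circle. -/
def arc (D : KnotDiagram) (a : ℕ) : List Endpoint :=
  ((D.word.rotate (D.word.idxOf (a, true))).drop 1).takeWhile fun p => p ≠ (a, false)

/-- The index of an arrow `a`: the number of tails minus the number of heads in `a⁺`. -/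
def index (D : KnotDiagram) (a : ℕ) : ℤ :=
  ((D.arc a).countP fun p => p.2 = true) - ((D.arc a).countP fun p => p.2 = false)

/-- The diagram is almost classical: all its arrows have index zero. -/
def IsAlmostClassical (D : KnotDiagram) : Prop := ∀ a ∈ D.arrows, D.index a = 0

/-! The generators are the classes, in the first homology of the Carter surface, of the whole curve,
`s`, which is written `none`, and of the loops `[a⁺]` for the arrows `a`, written `some a`. Each of
them is a cycle in the 4-valent graph on the surface whose vertices are the crossings and whose
edges are the pieces of the circle between consecutive endpoints. -/

/-- How often a generator runs along the edge that leaves the endpoint `p`. -/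
def outgoing (D : KnotDiagram) : Option D.Arrow → Endpoint → ℤ
  | none, _ => 1
  | some a, p => if p = (a.1, true) ∨ p ∈ D.arc a.1 then 1 else 0

/-- How often a generator runs along the edge that arrives at the endpoint `p`. -/
def incoming (D : KnotDiagram) : Option D.Arrow → Endpoint → ℤ
  | none, _ => 1
  | some a, p => if p = (a.1, false) ∨ p ∈ D.arc a.1 then 1 else 0

/-- The based matrix of the diagram: the intersection numbers `b(x, y)` of the generators. To count
them, the cycle `y` is pushed off the graph to its right. Near a crossing, draw the tail strand from
west to east and the head strand from south to north. The pushed-off `y` crosses the outgoing edge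
of the tail strand from right to left as often as `y` leaves along the head strand, and the
incoming edge of the head strand from left to right as often as `y` arrives along the tail strand;
it meets neither of the other two edges. -/
def basedMatrix (D : KnotDiagram) : Matrix (Option D.Arrow) (Option D.Arrow) ℤ :=
  fun x y => ∑ c ∈ D.arrows,
    (D.outgoing x (c, true) * D.outgoing y (c, false)
      - D.incoming x (c, false) * D.incoming y (c, true))

/-- `M` is the based matrix of `D` with respect to some ordering of the arrows, with `s` first. -/
def HasBasedMatrix (D : KnotDiagram) {n : ℕ} (M : Matrix (Fin (n + 1)) (Fin (n + 1)) ℤ) : Prop :=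
  ∃ σ : D.Arrow ≃ Fin n,
    ∀ x y, D.basedMatrix x y = M (x.elim 0 fun a => (σ a).succ) (y.elim 0 fun a => (σ a).succ)

end KnotDiagram

/-- Flat knots: Gauss diagrams on one circle up to the equivalence relation generated by the flat
Reidemeister moves, change of base point and renaming of arrows. -/
def FlatKnot : Type := Quot KnotDiagram.Step

/-- The flat knot with a given Gauss diagram. -/
def KnotDiagram.toFlatKnot (D : KnotDiagram) : FlatKnot := Quot.mk _ D

/-- The minimal number of crossings of a diagram of the flat knot. -/
noncomputable def FlatKnot.crossingNumber (α : FlatKnot) : ℕ :=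
  sInf {n | ∃ D : KnotDiagram, D.toFlatKnot = α ∧ D.arrows.card = n}

/-- A flat knot is almost classical if it has an almost classical diagram. -/
def FlatKnot.IsAlmostClassical (α : FlatKnot) : Prop :=
  ∃ D : KnotDiagram, D.toFlatKnot = α ∧ D.IsAlmostClassical

/-! ### Fillings and the algebraic genus -/

section Filling

variable {G : Type} [Fintype G] [DecidableEq G]

/-- A filling of a based matrix on `{s} ⊔ G`: a partition of `G` into blocks of one or two
elements. -/
def IsFilling (P : Finpartition (Finset.univ : Finset G)) : Prop :=
  ∀ X ∈ P.parts, X.card = 1 ∨ X.card = 2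

/-- The generators whose sum is the given generator of the filling: `s` alone, or the elements of a
block. -/
def fillingBlock (P : Finpartition (Finset.univ : Finset G)) :
    Option {X // X ∈ P.parts} → Finset (Option G)
  | none => {none}
  | some X => X.1.map Function.Embedding.some

/-- The matrix of a filling: the form `b`, extended by linearity, on `s` and on the sums over the
blocks. -/
def fillingMatrix (T : Matrix (Option G) (Option G) ℤ)
    (P : Finpartition (Finset.univ : Finset G)) :
    Matrix (Option {X // X ∈ P.parts}) (Option {X // X ∈ P.parts}) ℤ :=
  fun u v => ∑ x ∈ fillingBlock P u, ∑ y ∈ fillingBlock P v, T x y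

/-- The ranks of the matrices of all fillings of a based matrix. -/
def fillingRanks (T : Matrix (Option G) (Option G) ℤ) : Set ℕ :=
  {r | ∃ P : Finpartition (Finset.univ : Finset G), IsFilling P ∧ (fillingMatrix T P).rank = r}

/-- The genus of a based matrix: half the minimal rank of the matrix of a filling. -/
noncomputable def matrixGenus (T : Matrix (Option G) (Option G) ℤ) : ℚ :=
  ((sInf (fillingRanks T) : ℕ) : ℚ) / 2

end Filling

/-- The algebraic genus of the flat knot `α` is `g`: the based matrix of each diagram of `α` has
genus `g`. -/
def FlatKnot.HasAlgebraicGenus (α : FlatKnot) (g : ℚ) : Prop :=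
  ∀ D : KnotDiagram, D.toFlatKnot = α → matrixGenus D.basedMatrix = g

/-- A flat knot is algebraically slice if its algebraic genus is zero. -/
def FlatKnot.IsAlgebraicallySlice (α : FlatKnot) : Prop := α.HasAlgebraicGenus 0

/-! ### Slice movies -/

/-- A frame of a movie of Gauss diagrams: the circles that are present, each with a tag that tells to
which connected component of the cobordism surface swept out so far it belongs; and the number of
saddles so far, the number of births and deaths so far, and the number of connected components of
the surface swept out so far. -/
structure Frame where
  circles : List (ℕ × Circle)
  saddles : ℕ
  extrema : ℕ
  components : ℕ

/-- One step of a movie. The flat Reidemeister moves and the renaming of arrows may be applied in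
both directions. A saddle cuts a circle in two, or joins two circles; if these come from different
components of the surface, the two components become one. -/
inductive Frame.Step : Frame → Frame → Prop
  | reorder {L L' : List (ℕ × Circle)} {s e k : ℕ} (h : L.Perm L') :
      Frame.Step ⟨L, s, e, k⟩ ⟨L', s, e, k⟩
  | rotate {L : List (ℕ × Circle)} {s e k t : ℕ} {c c' : Circle} (h : c.IsRotated c') :
      Frame.Step ⟨(t, c) :: L, s, e, k⟩ ⟨(t, c') :: L, s, e, k⟩
  | move {L : List (ℕ × Circle)} {s e k : ℕ} {g : Circle → Circle}
      (h : FlatMove (L.map Prod.snd) g) :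
      Frame.Step ⟨L, s, e, k⟩ ⟨L.map fun c => (c.1, g c.2), s, e, k⟩
  | move_back {L : List (ℕ × Circle)} {s e k : ℕ} {g : Circle → Circle}
      (hL : IsGauss (L.map Prod.snd)) (h : FlatMove (L.map Prod.snd) g) :
      Frame.Step ⟨L.map fun c => (c.1, g c.2), s, e, k⟩ ⟨L, s, e, k⟩
  | birth {L : List (ℕ × Circle)} {s e k t : ℕ} (ht : ∀ c ∈ L, c.1 ≠ t) :
      Frame.Step ⟨L, s, e, k⟩ ⟨(t, []) :: L, s, e + 1, k + 1⟩
  | death {L : List (ℕ × Circle)} {s e k t : ℕ} :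
      Frame.Step ⟨(t, []) :: L, s, e, k⟩ ⟨L, s, e + 1, k⟩
  | split {L : List (ℕ × Circle)} {s e k t : ℕ} {u v : List Endpoint} :
      Frame.Step ⟨(t, u ++ v) :: L, s, e, k⟩ ⟨(t, u) :: (t, v) :: L, s + 1, e, k⟩
  | join_same {L : List (ℕ × Circle)} {s e k t : ℕ} {u v : List Endpoint} :
      Frame.Step ⟨(t, u) :: (t, v) :: L, s, e, k⟩ ⟨(t, u ++ v) :: L, s + 1, e, k⟩
  | join_different {L : List (ℕ × Circle)} {s e k t t' : ℕ} {u v : List Endpoint} (h : t ≠ t') :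
      Frame.Step ⟨(t, u) :: (t', v) :: L, s, e, k + 1⟩
        ⟨(t, u ++ v) :: L.map fun c => (if c.1 = t' then t else c.1, c.2), s + 1, e, k⟩

/-- A flat knot is slice if a diagram of it has a slice movie: a movie that ends with the trivial
diagram, such that the number of saddles is the number of births and deaths and the cobordism
surface is connected. -/
def FlatKnot.IsSlice (α : FlatKnot) : Prop :=
  ∃ D : KnotDiagram, D.toFlatKnot = α ∧ ∃ t n : ℕ,
    Relation.ReflTransGen Frame.Step ⟨[(0, D.word)], 0, 0, 1⟩ ⟨[(t, [])], n, n, 1⟩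

/-! ### The example -/

/-- The Gauss diagram of ac11.7183, with Gauss code
`O1 O2 U3 O4 U5 O3 U6 U7 O8 O9 U4 O10 U11 O6 U10 U1 O7 O5 U2 O11 U9 U8`. -/
def ac11_7183_diagram : KnotDiagram where
  word :=
    [(1, true), (2, true), (3, false), (4, true), (5, false), (3, true), (6, false), (7, false),
      (8, true), (9, true), (4, false), (10, true), (11, false), (6, true), (10, false),
      (1, false), (7, true), (5, true), (2, false), (11, true), (9, false), (8, false)]
  isGauss := by decide

/-- The flat knot ac11.7183. -/
def ac11_7183 : FlatKnot := ac11_7183_diagram.toFlatKnot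

/-- The based matrix of ac11.7183. -/
def ac11_7183_matrix : Matrix (Fin 12) (Fin 12) ℤ :=
  !![0,  0,  0,  0,  0,  0,  0,  0,  0,  0,  0,  0;
     0,  0, -1,  1,  0,  1,  0,  0,  0, -1, -1,  1;
     0,  1,  0,  0,  2,  0, -1,  0, -1, -2, -1,  2;
     0, -1,  0,  0,  0,  0,  1,  1,  0,  0,  0, -1;
     0,  0, -2,  0,  0,  2,  0,  1, -1, -2, -1,  3;
     0, -1,  0,  0, -2,  0,  0, -1,  2,  3,  1, -2;
     0,  0,  1, -1,  0,  0,  0,  0,  0,  1,  0, -1;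
     0,  0,  0, -1, -1,  1,  0,  0,  0,  1,  0,  0;
     0,  0,  1,  0,  1, -2,  0,  0,  0,  0,  1, -1;
     0,  1,  2,  0,  2, -3, -1, -1,  0,  0,  1, -1;
     0,  1,  1,  0,  1, -1,  0,  0, -1, -1,  0,  0;
     0, -1, -2,  1, -3,  2,  1,  0,  1,  1,  0,  0]

end FlatKnots

/-! The homology of the Carter surface is replaced by integral flows. A flow that closes up around
every circle is a 1-cycle of the 4-valent graph of the diagram. On one circle it is determined, up
to multiples of the whole curve, by its growth at the arrows. The intersection numbers become the
explicit bilinear expression `form`, which is antisymmetric on the closed flows of a knot diagram.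

A filling amounts to an involution f of the arrows, and its block flows generate the closed flows
with f-invariant growth. The filling has rank 0 exactly when `form` vanishes on these flows, and
rank at most 2 when the Pfaffian of any four of them vanishes. An alternating matrix has no rank 1.
So genus 1 means that no involution is isotropic but some involution has vanishing Pfaffians. Both
conditions are instances of one statement `HasDiscFilling q`, where q is a property of a 4×4 array
of intersection numbers. It is invariant under the flat moves (`hasDiscFilling_congr`): a new bigon
has its two arrows paired with each other, and when a bigon disappears the former partners of its
arrows are paired. Hence one diagram decides the genus of all diagrams.

For slice movies the same data, `SurfaceKernel`, is kept for several circles, labelled by the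
components of a planar surface still to be swept out, and the movie is read backward from the
trivial diagram. The equality of saddles and extrema, with connectedness, forces genus zero:
`genusCount` never decreases and agrees at both ends, so no saddle joins two circles of the same
component. The incidence graph between past and future components stays a forest, so a reversed
split always glues two different planar components (`Frame.Step.hasFilling`). At the start of the
movie this leaves an isotropic disc filling of the knot diagram.

The crossing number comes from reductions of based matrices. A first move deletes an element whose
row is zero or the row of s, a second move deletes two elements whose rows add up to the row of s,
and a third move changes nothing. By the confluence statement `ReducesTo.sdiff`, reducing to a fixed
primitive matrix M is an invariant of the flat knot. As reductions only delete elements, every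
diagram has at least as many arrows as M has generators besides s.

For the example, a short case distinction excludes all isotropic involutions, an explicit involution
makes the form a wedge of two linear functionals, and the zero column of s gives index zero for all
arrows. -/

namespace FlatKnots

/-! ### Flows on the edges of a Gauss diagram -/

/-- An integral flow on the edges of a Gauss diagram: `x.1 p` is the flow along the edge that
arrives at `p`, and `x.2 a` is the amount by which the flow grows at the tail of the arrow `a` and
drops at its head. -/
abbrev EdgeChain := (Endpoint → ℤ) × (ℕ → ℤ)

/-- The sign of an endpoint: positive for a tail, negative for a head. -/
def sgn (p : Endpoint) : ℤ := if p.2 then 1 else -1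

@[simp] theorem sgn_true (a : ℕ) : sgn (a, true) = 1 := rfl
@[simp] theorem sgn_false (a : ℕ) : sgn (a, false) = -1 := rfl

theorem sgn_mk (a b : ℕ) (t : Bool) : sgn (a, t) = sgn (b, t) := rfl

theorem sgn_not (a : ℕ) (t : Bool) : sgn (a, !t) = -sgn (a, t) := by cases t <;> rfl

/-- The flow along the edge that leaves `p`. -/
def EdgeChain.out (x : EdgeChain) (p : Endpoint) : ℤ := x.1 p + sgn p * x.2 p.1

/-- The flow `x` is consistent along the piece `c` of a circle, which it enters with the value `α`
and leaves with the value `β`. -/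
def Flow (x : EdgeChain) : ℤ → Circle → ℤ → Prop
  | α, [], β => α = β
  | α, p :: c, β => x.1 p = α ∧ Flow x (x.out p) c β

/-- The flow `x` is consistent all around the circle `c`. -/
def Closed (x : EdgeChain) (c : Circle) : Prop := ∃ α, Flow x α c α

/-- The total growth of a flow along a piece of a circle. -/
def charge (n : ℕ → ℤ) (c : Circle) : ℤ := (c.map fun p => sgn p * n p.1).sum

@[simp] theorem charge_nil (n : ℕ → ℤ) : charge n [] = 0 := rfl

theorem charge_cons (n : ℕ → ℤ) (p : Endpoint) (c : Circle) :
    charge n (p :: c) = sgn p * n p.1 + charge n c := by simp [charge]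

theorem charge_append (n : ℕ → ℤ) (u v : Circle) :
    charge n (u ++ v) = charge n u + charge n v := by simp [charge]

theorem charge_perm (n : ℕ → ℤ) {u v : Circle} (h : u.Perm v) : charge n u = charge n v :=
  (h.map _).sum_eq

theorem charge_congr {n m : ℕ → ℤ} {c : Circle} (h : ∀ p ∈ c, n p.1 = m p.1) :
    charge n c = charge m c := by
  unfold charge
  congr 1
  exact List.map_congr_left fun p hp => by rw [h p hp]

theorem flow_append {x : EdgeChain} {u v : Circle} {α β : ℤ} :
    Flow x α (u ++ v) β ↔ ∃ γ, Flow x α u γ ∧ Flow x γ v β := by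
  induction u generalizing α with
  | nil => simp [Flow]
  | cons p u ih => simp [Flow, ih, and_assoc]

theorem Flow.charge_eq {x : EdgeChain} {c : Circle} {α β : ℤ} (h : Flow x α c β) :
    β = α + charge x.2 c := by
  induction c generalizing α with
  | nil => simpa [Flow, eq_comm] using h
  | cons p c ih =>
    obtain ⟨h₁, h₂⟩ := h
    rw [ih h₂, charge_cons, EdgeChain.out, h₁]; ring

theorem flow_congr {x y : EdgeChain} {c : Circle} {α β : ℤ} (h₁ : ∀ p ∈ c, x.1 p = y.1 p)
    (h₂ : ∀ p ∈ c, x.2 p.1 = y.2 p.1) : Flow x α c β ↔ Flow y α c β := by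
  induction c generalizing α with
  | nil => rfl
  | cons p c ih =>
    simp only [List.forall_mem_cons] at h₁ h₂
    simp only [Flow, EdgeChain.out, h₁.1, h₂.1, ih h₁.2 h₂.2]

theorem closed_congr {x y : EdgeChain} {c : Circle} (h₁ : ∀ p ∈ c, x.1 p = y.1 p)
    (h₂ : ∀ p ∈ c, x.2 p.1 = y.2 p.1) : Closed x c ↔ Closed y c :=
  exists_congr fun _ => flow_congr h₁ h₂

theorem Flow.add {x y : EdgeChain} {c : Circle} {α β α' β' : ℤ} (hx : Flow x α c β)
    (hy : Flow y α' c β') : Flow (x + y) (α + α') c (β + β') := by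
  induction c generalizing α α' with
  | nil => simp_all [Flow]
  | cons p c ih =>
    refine ⟨by simp [hx.1, hy.1], ?_⟩
    have := ih hx.2 hy.2
    convert this using 1
    simp [EdgeChain.out]; ring

theorem Flow.neg {x : EdgeChain} {c : Circle} {α β : ℤ} (hx : Flow x α c β) :
    Flow (-x) (-α) c (-β) := by
  induction c generalizing α with
  | nil => simp_all [Flow]
  | cons p c ih =>
    refine ⟨by simp [hx.1], ?_⟩
    have := ih hx.2
    convert this using 1
    simp [EdgeChain.out]; ring

theorem flow_zero (c : Circle) : Flow 0 0 c 0 := by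
  induction c with
  | nil => rfl
  | cons p c ih => exact ⟨rfl, by simpa [EdgeChain.out] using ih⟩

theorem Closed.add {x y : EdgeChain} {c : Circle} (hx : Closed x c) (hy : Closed y c) :
    Closed (x + y) c := by
  obtain ⟨α, hα⟩ := hx
  obtain ⟨β, hβ⟩ := hy
  exact ⟨_, hα.add hβ⟩

theorem Closed.neg {x : EdgeChain} {c : Circle} (hx : Closed x c) : Closed (-x) c := by
  obtain ⟨α, hα⟩ := hx
  exact ⟨_, hα.neg⟩

theorem closed_zero (c : Circle) : Closed 0 c := ⟨0, flow_zero c⟩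

/-- The flows that are consistent around `c`. -/
def closedOn (c : Circle) : AddSubgroup EdgeChain where
  carrier := {x | Closed x c}
  add_mem' := Closed.add
  zero_mem' := closed_zero c
  neg_mem' := Closed.neg

theorem flow_of_forall_eq {x : EdgeChain} {c : Circle} {α : ℤ} (h₁ : ∀ p ∈ c, x.1 p = α)
    (h₂ : ∀ p ∈ c, x.2 p.1 = 0) : Flow x α c α := by
  induction c with
  | nil => rfl
  | cons p c ih =>
    simp only [List.forall_mem_cons] at h₁ h₂
    exact ⟨h₁.1, by simpa [EdgeChain.out, h₁.1, h₂.1] using ih h₁.2 h₂.2⟩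

theorem flow_const {x : EdgeChain} {c : Circle} {α : ℤ} (h₁ : ∀ p ∈ c, x.1 p = α)
    (h₂ : x.2 = 0) : Flow x α c α :=
  flow_of_forall_eq h₁ fun p _ => by rw [h₂]; rfl

theorem Flow.eq_const {x : EdgeChain} {c : Circle} {α β : ℤ} (h : Flow x α c β)
    (h₂ : ∀ p ∈ c, x.2 p.1 = 0) : ∀ p ∈ c, x.1 p = α := by
  induction c generalizing α with
  | nil => simp
  | cons p c ih =>
    simp only [List.forall_mem_cons] at h₂ ⊢
    refine ⟨h.1, ih ?_ h₂.2⟩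
    simpa [EdgeChain.out, h.1, h₂.1] using h.2

theorem isRotated_iff_append {c d : Circle} :
    c.IsRotated d ↔ ∃ u v, c = u ++ v ∧ d = v ++ u := by
  constructor
  · rintro ⟨n, rfl⟩
    refine ⟨c.take (n % c.length), c.drop (n % c.length), by simp, ?_⟩
    exact List.rotate_eq_drop_append_take_mod
  · rintro ⟨u, v, rfl, rfl⟩
    exact List.isRotated_append

theorem Closed.append_comm {x : EdgeChain} {u v : Circle} (h : Closed x (u ++ v)) :
    Closed x (v ++ u) := by
  obtain ⟨α, hα⟩ := h
  obtain ⟨γ, h₁, h₂⟩ := flow_append.1 hα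
  exact ⟨γ, flow_append.2 ⟨α, h₂, h₁⟩⟩

theorem Closed.rotate {x : EdgeChain} {c d : Circle} (h : Closed x c) (hr : c.IsRotated d) :
    Closed x d := by
  obtain ⟨u, v, rfl, rfl⟩ := isRotated_iff_append.1 hr
  exact h.append_comm

theorem closed_rotate_iff {x : EdgeChain} {c d : Circle} (hr : c.IsRotated d) :
    Closed x c ↔ Closed x d := ⟨fun h => h.rotate hr, fun h => h.rotate hr.symm⟩

theorem isRotated_filter {c d : Circle} (P : Endpoint → Bool) (h : c.IsRotated d) :
    (c.filter P).IsRotated (d.filter P) := by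
  obtain ⟨u, v, rfl, rfl⟩ := isRotated_iff_append.1 h
  simp only [List.filter_append]
  exact List.isRotated_append

/-! ### Pairs of consecutive endpoints -/

/-- On the circle `c`, the endpoints `p` and `q` either are consecutive or do not occur. -/
def Pair (p q : Endpoint) (c : Circle) : Prop :=
  c.Nodup ∧ ((∃ u, c.IsRotated (p :: q :: u)) ∨ p ∉ c ∧ q ∉ c)

/-- Remove the two endpoints `p` and `q`. -/
def erasePair (p q : Endpoint) (c : Circle) : Circle := c.filter fun r => r ≠ p ∧ r ≠ q

theorem mem_erasePair {p q r : Endpoint} {c : Circle} :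
    r ∈ erasePair p q c ↔ r ∈ c ∧ r ≠ p ∧ r ≠ q := by simp [erasePair]

theorem erasePair_of_notMem {p q : Endpoint} {c : Circle} (hp : p ∉ c) (hq : q ∉ c) :
    erasePair p q c = c := by
  refine List.filter_eq_self.2 fun r hr => ?_
  simp only [ne_eq, decide_eq_true_eq]
  exact ⟨fun h => hp (h ▸ hr), fun h => hq (h ▸ hr)⟩

theorem erasePair_cons {p q : Endpoint} {u : Circle} (h : (p :: q :: u).Nodup) :
    erasePair p q (p :: q :: u) = u := by
  simp only [List.nodup_cons, List.mem_cons, not_or] at h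
  have : erasePair p q u = u := erasePair_of_notMem h.1.2 h.2.1
  simpa [erasePair] using this

theorem Pair.erasePair {p q r s : Endpoint} {c : Circle} (h : Pair r s c) (h₁ : r ≠ p ∧ r ≠ q)
    (h₂ : s ≠ p ∧ s ≠ q) : Pair r s (erasePair p q c) := by
  refine ⟨h.1.filter _, ?_⟩
  rcases h.2 with ⟨u, hu⟩ | h'
  · refine Or.inl ⟨FlatKnots.erasePair p q u, ?_⟩
    have := isRotated_filter (fun r => r ≠ p ∧ r ≠ q) hu
    simpa [FlatKnots.erasePair, List.filter_cons, h₁, h₂] using this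
  · exact Or.inr ⟨fun h => h'.1 (mem_erasePair.1 h).1, fun h => h'.2 (mem_erasePair.1 h).1⟩

/-- The changes at `p` and `q` cancel, so the flow leaves `q` with the value with which it entered
`p`, and the rest of the circle still closes up. -/
theorem closed_erasePair {p q : Endpoint} {c : Circle} {x : EdgeChain} (h : Pair p q c)
    (hn : sgn p * x.2 p.1 + sgn q * x.2 q.1 = 0) (hx : Closed x c) :
    Closed x (erasePair p q c) := by
  rcases h.2 with ⟨u, hu⟩ | h'
  · have hu' := isRotated_filter (fun r => r ≠ p ∧ r ≠ q) hu
    change (erasePair p q c).IsRotated (erasePair p q _) at hu'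
    rw [erasePair_cons (hu.nodup_iff.1 h.1)] at hu'
    refine Closed.rotate ?_ hu'.symm
    obtain ⟨α, h₁, h₂, h₃⟩ := hx.rotate hu
    refine ⟨α, ?_⟩
    convert h₃ using 1
    simp only [EdgeChain.out] at h₂ ⊢
    linarith
  · rwa [erasePair_of_notMem h'.1 h'.2]

theorem charge_erasePair {p q : Endpoint} {c : Circle} {n : ℕ → ℤ} (h : Pair p q c)
    (hn : sgn p * n p.1 + sgn q * n q.1 = 0) : charge n (erasePair p q c) = charge n c := by
  rcases h.2 with ⟨u, hu⟩ | h'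
  · have hu' := isRotated_filter (fun r => r ≠ p ∧ r ≠ q) hu
    change (erasePair p q c).IsRotated (erasePair p q _) at hu'
    rw [erasePair_cons (hu.nodup_iff.1 h.1)] at hu'
    rw [charge_perm n hu.perm, charge_perm n hu'.perm, charge_cons, charge_cons]
    linarith
  · rw [erasePair_of_notMem h'.1 h'.2]

/-- A flow on the diagram without `p` and `q` extends to `p` and `q`. -/
theorem exists_closed_of_erasePair {p q : Endpoint} {S : Set Circle} {x : EdgeChain}
    (h : ∀ c ∈ S, Pair p q c) (hS : ∀ c ∈ S, ∀ d ∈ S, p ∈ c → p ∈ d → c = d)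
    (hn : sgn p * x.2 p.1 + sgn q * x.2 q.1 = 0) (hx : ∀ c ∈ S, Closed x (erasePair p q c)) :
    ∃ i : Endpoint → ℤ, (∀ r, r ≠ p → r ≠ q → i r = x.1 r) ∧ ∀ c ∈ S, Closed (i, x.2) c := by
  have key : ∀ i : Endpoint → ℤ, (∀ r, r ≠ p → r ≠ q → i r = x.1 r) → ∀ c ∈ S, p ∉ c → q ∉ c →
      Closed (i, x.2) c := by
    intro i hi c hc hp hq
    have := hx c hc
    rw [erasePair_of_notMem hp hq] at this
    refine (closed_congr (x := x) (y := (i, x.2)) (fun r hr => ?_) fun _ _ => rfl).1 this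
    exact (hi r (fun h => hp (h ▸ hr)) fun h => hq (h ▸ hr)).symm
  by_cases hc : ∃ c ∈ S, p ∈ c
  · obtain ⟨c, hc, hpc⟩ := hc
    obtain ⟨u, hu⟩ := (h c hc).2.resolve_right fun h => h.1 hpc
    have hnd := hu.nodup_iff.1 (h c hc).1
    have hu' := isRotated_filter (fun r => r ≠ p ∧ r ≠ q) hu
    change (erasePair p q c).IsRotated (erasePair p q _) at hu'
    rw [erasePair_cons hnd] at hu'
    obtain ⟨α, hα⟩ := (hx c hc).rotate hu'
    simp only [List.nodup_cons, List.mem_cons, not_or] at hnd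
    -- These values are forced: the flow enters `p` with the value `α` at which the remaining circle
    -- closes up, and enters `q` after the growth at `p`.
    let i : Endpoint → ℤ := fun r => if r = p then α else if r = q then α + sgn p * x.2 p.1
      else x.1 r
    have hi : ∀ r, r ≠ p → r ≠ q → i r = x.1 r := fun r h₁ h₂ => by simp [i, h₁, h₂]
    refine ⟨i, hi, fun d hd => ?_⟩
    by_cases hpd : p ∈ d
    · obtain rfl := hS c hc d hd hpc hpd
      refine Closed.rotate ?_ hu.symm
      have hip : i p = α := by simp [i]
      have hiq : i q = α + sgn p * x.2 p.1 := by simp [i, Ne.symm hnd.1.1]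
      refine ⟨α, hip, by simp [EdgeChain.out, hip, hiq], ?_⟩
      have : EdgeChain.out (i, x.2) q = α := by
        simp only [EdgeChain.out, hiq]; linarith
      rw [this]
      refine (flow_congr (x := x) (y := (i, x.2)) (fun r hr => ?_) fun _ _ => rfl).1 hα
      exact (hi r (fun h => hnd.1.2 (h ▸ hr)) fun h => hnd.2.1 (h ▸ hr)).symm
    · refine key i hi d hd hpd fun hq => hpd ?_
      obtain ⟨v, hv⟩ := (h d hd).2.resolve_right fun h => h.2 hq
      rw [hv.mem_iff]; simp
  · refine ⟨x.1, fun _ _ _ => rfl, fun c hc' => ?_⟩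
    have hp : p ∉ c := fun h => hc ⟨c, hc', h⟩
    refine key x.1 (fun _ _ _ => rfl) c hc' hp fun hq => hp ?_
    obtain ⟨v, hv⟩ := (h c hc').2.resolve_right fun h => h.2 hq
    rw [hv.mem_iff]; simp

/-! ### Exchanging two consecutive endpoints -/

/-- The flow that corresponds to `x` after the consecutive endpoints `p` and `q` have been
exchanged. -/
def swapChain (p q : Endpoint) : EdgeChain →+ EdgeChain where
  -- After the exchange `q` comes first. So `p` is entered after the growth at `q`, while `q` is
  -- entered with the old value in front of `p`, which on a closed flow is the old value at `q`
  -- minus the growth at `p`.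
  toFun x := (fun r => if r = p then x.1 p + sgn q * x.2 q.1
    else if r = q then x.1 q - sgn p * x.2 p.1 else x.1 r, x.2)
  map_zero' := by ext r <;> simp
  map_add' x y := by
    ext r
    · simp only [Prod.fst_add, Prod.snd_add, Pi.add_apply]; split_ifs <;> ring
    · rfl

@[simp] theorem swapChain_snd (p q : Endpoint) (x : EdgeChain) : (swapChain p q x).2 = x.2 := rfl

theorem swapChain_fst (p q : Endpoint) (x : EdgeChain) (r : Endpoint) :
    (swapChain p q x).1 r = if r = p then x.1 p + sgn q * x.2 q.1
    else if r = q then x.1 q - sgn p * x.2 p.1 else x.1 r := rfl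

theorem map_swap_of_notMem {p q : Endpoint} {c : Circle} (hp : p ∉ c) (hq : q ∉ c) :
    c.map (Equiv.swap p q) = c := by
  conv_rhs => rw [← List.map_id c]
  exact List.map_congr_left fun r hr =>
    Equiv.swap_apply_of_ne_of_ne (fun h => hp (h ▸ hr)) fun h => hq (h ▸ hr)

theorem closed_swapChain {p q : Endpoint} {c : Circle} {x : EdgeChain} (h : Pair p q c)
    (hx : Closed x c) : Closed (swapChain p q x) (c.map (Equiv.swap p q)) := by
  rcases h.2 with ⟨u, hu⟩ | h'
  · refine Closed.rotate ?_ (hu.map _).symm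
    have hnd := hu.nodup_iff.1 h.1
    simp only [List.nodup_cons, List.mem_cons, not_or] at hnd
    simp only [List.map_cons, Equiv.swap_apply_left, Equiv.swap_apply_right,
      map_swap_of_notMem hnd.1.2 hnd.2.1]
    obtain ⟨α, h₁, h₂, h₃⟩ := hx.rotate hu
    have hqp := Ne.symm hnd.1.1
    simp only [EdgeChain.out] at h₂
    refine ⟨α, ?_, ?_, ?_⟩
    · simp [swapChain_fst, hqp, h₂, h₁]
    · simp [swapChain_fst, hqp, h₂, h₁, EdgeChain.out]
    · have : (swapChain p q x).out p = x.out q := by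
        simp [swapChain_fst, h₂, EdgeChain.out]; ring
      rw [this]
      refine (flow_congr (x := x) (y := swapChain p q x) (fun r hr => ?_) fun _ _ => rfl).1 h₃
      have h₁ : r ≠ p := fun h => hnd.1.2 (h ▸ hr)
      have h₂ : r ≠ q := fun h => hnd.2.1 (h ▸ hr)
      simp [swapChain_fst, h₁, h₂]
  · rw [map_swap_of_notMem h'.1 h'.2]
    refine (closed_congr (x := x) (y := swapChain p q x) (fun r hr => ?_) fun _ _ => rfl).1 hx
    have h₁ : r ≠ p := fun h => h'.1 (h ▸ hr)
    have h₂ : r ≠ q := fun h => h'.2 (h ▸ hr)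
    simp [swapChain_fst, h₁, h₂]

theorem Pair.swap {p q : Endpoint} {c : Circle} (h : Pair p q c) :
    Pair q p (c.map (Equiv.swap p q)) := by
  refine ⟨h.1.map (Equiv.injective _), ?_⟩
  rcases h.2 with ⟨u, hu⟩ | h'
  · exact Or.inl ⟨_, by simpa using hu.map (Equiv.swap p q)⟩
  · rw [map_swap_of_notMem h'.1 h'.2]
    exact Or.inr h'.symm

theorem Pair.swap_of_ne {p q r s : Endpoint} {c : Circle} (h : Pair r s c) (h₁ : r ≠ p ∧ r ≠ q)
    (h₂ : s ≠ p ∧ s ≠ q) : Pair r s (c.map (Equiv.swap p q)) := by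
  refine ⟨h.1.map (Equiv.injective _), ?_⟩
  have hr := Equiv.swap_apply_of_ne_of_ne h₁.1 h₁.2
  have hs := Equiv.swap_apply_of_ne_of_ne h₂.1 h₂.2
  rcases h.2 with ⟨u, hu⟩ | h'
  · exact Or.inl ⟨_, by simpa [hr, hs] using hu.map (Equiv.swap p q)⟩
  · refine Or.inr ⟨fun h => h'.1 ?_, fun h => h'.2 ?_⟩
    · obtain ⟨w, hw, hw'⟩ := List.mem_map.1 h
      rw [← hr] at hw'
      rwa [← (Equiv.injective _ hw')]
    · obtain ⟨w, hw, hw'⟩ := List.mem_map.1 h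
      rw [← hs] at hw'
      rwa [← (Equiv.injective _ hw')]

theorem mem_map_swap {p q r : Endpoint} {c : Circle} (h : Pair p q c) :
    r ∈ c.map (Equiv.swap p q) ↔ r ∈ c := by
  rcases h.2 with ⟨u, hu⟩ | h'
  · have hnd := hu.nodup_iff.1 h.1
    simp only [List.nodup_cons, List.mem_cons, not_or] at hnd
    rw [(hu.map _).mem_iff, hu.mem_iff]
    simp only [List.map_cons, Equiv.swap_apply_left, Equiv.swap_apply_right,
      map_swap_of_notMem hnd.1.2 hnd.2.1, List.mem_cons]
    tauto
  · rw [map_swap_of_notMem h'.1 h'.2]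

end FlatKnots

namespace FlatKnots

/-! ### Labelled circles, and the intersection form on flows -/

/-- The labels by future components are not part of a frame. This lemma pulls them back along a step
of a movie that acts on the circles by a map `g`. -/
theorem exists_map_eq_of_map_snd_eq {α β γ : Type*} (m : Multiset (α × β)) (S : Multiset γ)
    (g : γ → β) (h : m.map Prod.snd = S.map g) :
    ∃ m' : Multiset (α × γ), m'.map Prod.snd = S ∧ m'.map (fun z => (z.1, g z.2)) = m := by
  classical
  induction S using Multiset.induction generalizing m with
  | empty => exact ⟨0, rfl, by simpa [eq_comm] using h⟩
  | cons s S ih =>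
    rw [Multiset.map_cons, ← Multiset.map_eq_cons] at h
    obtain ⟨a, ha, has, h⟩ := h
    obtain ⟨m', h₁, h₂⟩ := ih _ h
    refine ⟨(a.1, s) ::ₘ m', by simp [h₁], ?_⟩
    rw [Multiset.map_cons, h₂]
    conv_rhs => rw [← Multiset.cons_erase ha]
    simp [← has]

theorem exists_cons_of_map_snd_eq {α β : Type*} {m : Multiset (α × β)} {S : Multiset β} {b : β}
    (h : m.map Prod.snd = b ::ₘ S) : ∃ a m', m = (a, b) ::ₘ m' ∧ m'.map Prod.snd = S := by
  classical
  rw [← Multiset.map_eq_cons] at h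
  obtain ⟨a, ha, rfl, h⟩ := h
  exact ⟨a.1, m.erase a, (Multiset.cons_erase ha).symm, h⟩

/-- A circle with a label. -/
abbrev LabelledCircle := ℕ × Circle

/-- The arrows that occur on the circles. -/
def arrowsOf (K : Multiset LabelledCircle) : Finset ℕ :=
  (K.bind fun k => (k.2.map Prod.fst : Multiset ℕ)).toFinset

theorem mem_arrowsOf {K : Multiset LabelledCircle} {a : ℕ} :
    a ∈ arrowsOf K ↔ ∃ k ∈ K, ∃ t, (a, t) ∈ k.2 := by
  simp [arrowsOf]

/-- The intersection form, at the crossings in `A`. -/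
def form (A : Finset ℕ) (x y : EdgeChain) : ℤ :=
  ∑ c ∈ A, (x.out (c, true) * y.out (c, false) - x.1 (c, false) * y.1 (c, true))

theorem form_congr {A : Finset ℕ} {x x' y y' : EdgeChain}
    (hx : ∀ a ∈ A, ∀ t, x.1 (a, t) = x'.1 (a, t)) (hx' : ∀ a ∈ A, x.2 a = x'.2 a)
    (hy : ∀ a ∈ A, ∀ t, y.1 (a, t) = y'.1 (a, t)) (hy' : ∀ a ∈ A, y.2 a = y'.2 a) :
    form A x y = form A x' y' :=
  Finset.sum_congr rfl fun a ha => by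
    simp only [EdgeChain.out, hx a ha, hx' a ha, hy a ha, hy' a ha]

theorem form_add_left (A : Finset ℕ) (x x' y : EdgeChain) :
    form A (x + x') y = form A x y + form A x' y := by
  simp only [form, ← Finset.sum_add_distrib]
  exact Finset.sum_congr rfl fun a _ => by
    simp only [EdgeChain.out, Prod.fst_add, Prod.snd_add, Pi.add_apply]; ring

theorem form_add_right (A : Finset ℕ) (x y y' : EdgeChain) :
    form A x (y + y') = form A x y + form A x y' := by
  simp only [form, ← Finset.sum_add_distrib]
  exact Finset.sum_congr rfl fun a _ => by
    simp only [EdgeChain.out, Prod.fst_add, Prod.snd_add, Pi.add_apply]; ring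

/-- The intersection form as a biadditive map. -/
def formHom (A : Finset ℕ) : EdgeChain →+ EdgeChain →+ ℤ :=
  AddMonoidHom.mk' (fun x => AddMonoidHom.mk' (form A x) (form_add_right A x)) fun x x' => by
    ext1 y; exact form_add_left A x x' y

@[simp] theorem formHom_apply (A : Finset ℕ) (x y : EdgeChain) : formHom A x y = form A x y := rfl

/-- The Gauss diagram condition for a family of labelled circles. -/
structure GaussFamily (K : Multiset LabelledCircle) : Prop where
  nodup : ∀ k ∈ K, k.2.Nodup
  disj : ∀ k ∈ K, ∀ k' ∈ K, ∀ p ∈ k.2, p ∈ k'.2 → k = k'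
  partner : ∀ k ∈ K, ∀ p ∈ k.2, ∃ k' ∈ K, (p.1, !p.2) ∈ k'.2

theorem GaussFamily.exists_mem {K : Multiset LabelledCircle} (hK : GaussFamily K) {a : ℕ}
    (ha : a ∈ arrowsOf K) (t : Bool) : ∃ k ∈ K, (a, t) ∈ k.2 := by
  obtain ⟨k, hk, s, hs⟩ := mem_arrowsOf.1 ha
  by_cases h : s = t
  · exact ⟨k, hk, h ▸ hs⟩
  · obtain ⟨k', hk', h'⟩ := hK.partner k hk _ hs
    refine ⟨k', hk', ?_⟩
    have : (!s) = t := by cases s <;> cases t <;> simp_all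
    simpa [this] using h'

theorem GaussFamily.exists_label {K : Multiset LabelledCircle} (hK : GaussFamily K) :
    ∃ l : Endpoint → ℕ, ∀ k ∈ K, ∀ p ∈ k.2, l p = k.1 := by
  classical
  refine ⟨fun p => if h : ∃ k ∈ K, p ∈ k.2 then h.choose.1 else 0, fun k hk p hp => ?_⟩
  have h : ∃ k ∈ K, p ∈ k.2 := ⟨k, hk, hp⟩
  simp only [h, dite_true]
  rw [hK.disj _ h.choose_spec.1 k hk p h.choose_spec.2 hp]

theorem gaussFamily_of_isGauss {β : Type*} {K : Multiset (ℕ × β × Circle)} {C : List Circle}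
    (h : IsGauss C) (hK : K.map (fun k => k.2.2) = C) :
    GaussFamily (K.map fun k => (k.1, k.2.2)) := by
  obtain ⟨l, rfl⟩ := Quotient.exists_rep K
  have hp : (l.map fun k => k.2.2).Perm C := Multiset.coe_eq_coe.1 hK
  have hf := hp.flatten
  have hn := (hf.nodup_iff.2 h.1)
  rw [List.nodup_flatten, List.pairwise_map] at hn
  have hmem : ∀ k ∈ Multiset.map (fun k : ℕ × β × Circle => (k.1, k.2.2))
      (l : Multiset (ℕ × β × Circle)), ∃ k' ∈ l, (k'.1, k'.2.2) = k :=
    fun k hk => by simpa only [Multiset.mem_map, Multiset.mem_coe] using hk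
  refine ⟨?_, ?_, ?_⟩
  · intro k hk
    obtain ⟨k, hkl, rfl⟩ := hmem k hk
    exact hn.1 _ (List.mem_map_of_mem hkl)
  · intro k hk k' hk' p hp hp'
    obtain ⟨k, hkl, rfl⟩ := hmem k hk
    obtain ⟨k', hkl', rfl⟩ := hmem k' hk'
    by_contra hne
    have hkk : k ≠ k' := fun h => hne (by rw [h])
    have : Std.Symm fun x y : ℕ × β × Circle => List.Disjoint x.2.2 y.2.2 :=
      ⟨fun _ _ h => List.Disjoint.symm h⟩
    exact List.Pairwise.forall hn.2 hkl hkl' hkk hp hp'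
  · intro k hk p hpk
    obtain ⟨k, hkl, rfl⟩ := hmem k hk
    have : p ∈ C.flatten := hf.mem_iff.1 (List.mem_flatten.2 ⟨_, List.mem_map_of_mem hkl, hpk⟩)
    have := hf.mem_iff.2 (h.2 p this)
    obtain ⟨c, hc, hpc⟩ := List.mem_flatten.1 this
    obtain ⟨k', hk', rfl⟩ := List.mem_map.1 hc
    exact ⟨(k'.1, k'.2.2), Multiset.mem_map.2 ⟨k', hk', rfl⟩, hpc⟩

/-! ### Kernels of fillings by planar surfaces

A planar surface whose boundary components are the circles, and whose double arcs pair the arrows,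
determines a group of flows: those that bound in the ambient three-manifold. -/

/-- The involution `f` of the arrows and the group `L` of flows come from a filling of the circles
by planar surfaces, one for each label, such that the intersection numbers of flows in `L` have
the property `q`. -/
structure SurfaceKernel (q : (Fin 4 → Fin 4 → ℤ) → Prop) (K : Multiset LabelledCircle)
    (f : ℕ → ℕ) (L : AddSubgroup EdgeChain) : Prop where
  invol : ∀ a, f (f a) = a
  fixed : ∀ a, a ∉ arrowsOf K → f a = a
  closed : ∀ x ∈ L, ∀ k ∈ K, Closed x k.2
  inv : ∀ x ∈ L, ∀ a, x.2 (f a) = x.2 a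
  good : ∀ v : Fin 4 → EdgeChain, (∀ i, v i ∈ L) → q fun i j => form (arrowsOf K) (v i) (v j)
  -- The last three conditions encode planarity. The boundary of each component bounds; a growth
  -- constant along the double arcs has total charge zero on the boundary of each component; and if
  -- it has zero charge on every single circle, it comes from a bounding flow.
  boundary : ∀ s, ∃ x ∈ L, x.2 = 0 ∧ ∀ k ∈ K, ∀ p ∈ k.2, x.1 p = if k.1 = s then 1 else 0
  balance : ∀ n : ℕ → ℤ, (∀ a, n (f a) = n a) →
    ∀ s, (K.map fun k => if k.1 = s then charge n k.2 else 0).sum = 0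
  lift : ∀ n : ℕ → ℤ, (∀ a, n (f a) = n a) → (∀ k ∈ K, charge n k.2 = 0) → ∃ x ∈ L, x.2 = n

variable {q : (Fin 4 → Fin 4 → ℤ) → Prop} {K : Multiset LabelledCircle} {f : ℕ → ℕ}
  {L : AddSubgroup EdgeChain}

/-- A split saddle read backward: a band glues two different planar components along `u` and `v`,
and the result is planar again. The bounding flows are the old ones that also close up around `u ++
v`. The hypothesis `s ≠ s'` is essential, since a band within one component would merge two of its
boundary circles and add genus. -/
theorem SurfaceKernel.split {R : Multiset LabelledCircle} {s s' : ℕ} {u v : Circle}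
    (hs : s ≠ s') (h : SurfaceKernel q ((s, u) ::ₘ (s', v) ::ₘ R) f L) :
    SurfaceKernel q ((s, u ++ v) ::ₘ R.map fun k => (if k.1 = s' then s else k.1, k.2)) f
      (L ⊓ closedOn (u ++ v)) := by
  have hA : arrowsOf ((s, u ++ v) ::ₘ R.map fun k => (if k.1 = s' then s else k.1, k.2)) =
      arrowsOf ((s, u) ::ₘ (s', v) ::ₘ R) := by
    simp [arrowsOf, Multiset.bind_map, ← Multiset.coe_add, add_assoc]
  refine ⟨h.invol, by rw [hA]; exact h.fixed, ?_, fun x hx => h.inv x hx.1,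
    by rw [hA]; exact fun v hv => h.good v fun i => (hv i).1, ?_, ?_, ?_⟩
  · rintro x ⟨hx, hx'⟩ k hk
    simp only [Multiset.mem_cons, Multiset.mem_map] at hk
    rcases hk with rfl | ⟨k, hk, rfl⟩
    · exact hx'
    · exact h.closed x hx k (by simp [hk])
  · intro r
    obtain ⟨x, hx, hx2, hx1⟩ := h.boundary r
    simp only [Multiset.mem_cons, forall_eq_or_imp] at hx1
    obtain ⟨hxu, hxv, hxR⟩ := hx1
    have hcl : ∀ (y : EdgeChain) (z : ℤ), y.2 = 0 → (∀ p ∈ u, y.1 p = z) → (∀ p ∈ v, y.1 p = z) →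
        Closed y (u ++ v) := fun y z h₂ hu hv => ⟨z, flow_const (by
          intro p hp; rcases List.mem_append.1 hp with hp | hp
          exacts [hu p hp, hv p hp]) h₂⟩
    by_cases hr : r = s
    · subst hr
      obtain ⟨y, hy, hy2, hy1⟩ := h.boundary s'
      simp only [Multiset.mem_cons, forall_eq_or_imp] at hy1
      obtain ⟨hyu, hyv, hyR⟩ := hy1
      have e1 : ∀ p ∈ u, (x + y).1 p = 1 := fun p hp => by simp [hxu p hp, hyu p hp, hs]
      have e2 : ∀ p ∈ v, (x + y).1 p = 1 := fun p hp => by simp [hxv p hp, hyv p hp, hs.symm]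
      refine ⟨x + y, ⟨L.add_mem hx hy, hcl _ 1 (by simp [hx2, hy2]) e1 e2⟩, by simp [hx2, hy2], ?_⟩
      intro k hk p hp
      simp only [Multiset.mem_cons, Multiset.mem_map] at hk
      rcases hk with rfl | ⟨k, hk, rfl⟩
      · rcases List.mem_append.1 hp with hp | hp
        · simp [e1 p hp]
        · simp [e2 p hp]
      · have e3 := hxR k hk p hp
        have e4 := hyR k hk p hp
        by_cases hk' : k.1 = s'
        · simp [e3, e4, hk', Ne.symm hs]
        · simp [e3, e4, hk']
    · by_cases hr' : r = s'
      · subst hr'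
        -- The label `s'` has been absorbed by `s` and no longer occurs, so its boundary is the zero
        -- flow.
        refine ⟨0, ⟨L.zero_mem, closed_zero _⟩, rfl, ?_⟩
        intro k hk p hp
        simp only [Multiset.mem_cons, Multiset.mem_map] at hk
        rcases hk with rfl | ⟨k, hk, rfl⟩
        · simp [hs]
        · by_cases hk' : k.1 = r <;> simp [hk', hs]
      · refine ⟨x, ⟨hx, hcl x 0 hx2 ?_ ?_⟩, hx2, ?_⟩
        · intro p hp; simp [hxu p hp, Ne.symm hr]
        · intro p hp; simp [hxv p hp, Ne.symm hr']
        intro k hk p hp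
        simp only [Multiset.mem_cons, Multiset.mem_map] at hk
        rcases hk with rfl | ⟨k, hk, rfl⟩
        · rcases List.mem_append.1 hp with hp | hp
          · simp [hxu p hp]
          · simp [hxv p hp, Ne.symm hr, Ne.symm hr']
        · have := hxR k hk p hp
          by_cases hk' : k.1 = s'
          · simp [this, hk', Ne.symm hr, Ne.symm hr']
          · simp [this, hk']
  · intro n hn r
    have h₁ := h.balance n hn r
    have h₂ := h.balance n hn s'
    simp only [Multiset.map_cons, Multiset.sum_cons, Multiset.map_map, Function.comp_def,
      charge_append] at h₁ h₂ ⊢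
    by_cases hr : s = r
    · subst hr
      have : (R.map fun k => if (if k.1 = s' then s else k.1) = s then charge n k.2 else 0).sum =
          (R.map fun k => if k.1 = s then charge n k.2 else 0).sum +
          (R.map fun k => if k.1 = s' then charge n k.2 else 0).sum := by
        rw [← Multiset.sum_map_add]
        congr 1
        refine Multiset.map_congr rfl fun k _ => ?_
        by_cases hk : k.1 = s'
        · simp [hk, hs.symm]
        · simp [hk]
      simp only [this, if_true, hs, hs.symm, if_false] at h₁ h₂ ⊢
      linarith
    · by_cases hr' : s' = r
      · subst hr'
        have : (R.map fun k => if (if k.1 = s' then s else k.1) = s' then charge n k.2 else 0) =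
            R.map fun k => 0 := by
          refine Multiset.map_congr rfl fun k _ => ?_
          by_cases hk : k.1 = s' <;> simp [hk, hr]
        simp [this, hr]
      · have : (R.map fun k => if (if k.1 = s' then s else k.1) = r then charge n k.2 else 0) =
            R.map fun k => if k.1 = r then charge n k.2 else 0 := by
          refine Multiset.map_congr rfl fun k _ => ?_
          by_cases hk : k.1 = s'
          · simp [hk, hr, hr']
          · simp [hk]
        simp only [this, hr, hr', if_false] at h₁ ⊢
        linarith
  · intro n hn hz
    simp only [Multiset.mem_cons, forall_eq_or_imp, charge_append, Multiset.mem_map,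
      forall_exists_index, and_imp, forall_apply_eq_imp_iff₂] at hz
    obtain ⟨hz, hzR⟩ := hz
    -- All other circles labelled `s` have charge zero, so the balance of the component `s` isolates
    -- `u`. Here the two labels must differ, for otherwise `v` would enter the same sum.
    have hu : charge n u = 0 := by
      have h₁ := h.balance n hn s
      have h₂ : (R.map fun k => if k.1 = s then charge n k.2 else 0) = R.map fun k => 0 :=
        Multiset.map_congr rfl fun k hk => by simp [hzR k hk]
      simpa [h₂, hs.symm] using h₁
    have hv : charge n v = 0 := by linarith
    obtain ⟨x, hx, rfl⟩ := h.lift n hn (by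
      simp only [Multiset.mem_cons, forall_eq_or_imp]
      exact ⟨hu, hv, hzR⟩)
    obtain ⟨α, hα⟩ := h.closed x hx (s, u) (by simp)
    obtain ⟨β, hβ⟩ := h.closed x hx (s', v) (by simp)
    obtain ⟨y, hy, hy2, hy1⟩ := h.boundary s'
    simp only [Multiset.mem_cons, forall_eq_or_imp] at hy1
    obtain ⟨hyu, hyv, -⟩ := hy1
    -- The flow `x` enters `u` with `α` but `v` with `β`. Adding `α - β` times the boundary of the
    -- component `s'` corrects the value on `v` without changing that on `u`.
    have f1 : Flow ((α - β) • y) 0 u 0 :=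
      flow_const (fun p hp => by simp [hyu p hp, hs]) (by simp [hy2])
    have f2 : Flow ((α - β) • y) (α - β) v (α - β) :=
      flow_const (fun p hp => by simp [hyv p hp]) (by simp [hy2])
    refine ⟨x + (α - β) • y, ⟨L.add_mem hx (L.zsmul_mem hy _), α, ?_⟩, by simp [hy2]⟩
    refine flow_append.2 ⟨α, by simpa using hα.add f1, by simpa using hβ.add f2⟩

/-- A saddle that joins two circles, read backward: a boundary circle of one planar component is cut
in two. A flow closed around `u ++ v` with zero charge on `u` has the same value at both cut points,
so it closes up around both pieces. -/
theorem SurfaceKernel.join {R : Multiset LabelledCircle} {s : ℕ} {u v : Circle}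
    (h : SurfaceKernel q ((s, u ++ v) ::ₘ R) f L) :
    SurfaceKernel q ((s, u) ::ₘ (s, v) ::ₘ R) f (L ⊓ (closedOn u ⊓ closedOn v)) := by
  have hA : arrowsOf ((s, u ++ v) ::ₘ R) = arrowsOf ((s, u) ::ₘ (s, v) ::ₘ R) := by
    simp [arrowsOf, ← Multiset.coe_add, add_assoc]
  refine ⟨h.invol, by rw [← hA]; exact h.fixed, ?_, fun x hx => h.inv x hx.1,
    by rw [← hA]; exact fun v hv => h.good v fun i => (hv i).1, ?_, ?_, ?_⟩
  · rintro x ⟨hx, hxu, hxv⟩ k hk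
    simp only [Multiset.mem_cons] at hk
    rcases hk with rfl | rfl | hk
    · exact hxu
    · exact hxv
    · exact h.closed x hx k (by simp [hk])
  · intro r
    obtain ⟨x, hx, hx2, hx1⟩ := h.boundary r
    simp only [Multiset.mem_cons, forall_eq_or_imp, List.mem_append] at hx1
    obtain ⟨hxuv, hxR⟩ := hx1
    have hxu := fun p hp => hxuv p (Or.inl hp)
    have hxv := fun p hp => hxuv p (Or.inr hp)
    refine ⟨x, ⟨hx, ⟨_, flow_const hxu hx2⟩, ⟨_, flow_const hxv hx2⟩⟩, hx2, ?_⟩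
    simp only [Multiset.mem_cons, forall_eq_or_imp]
    exact ⟨hxu, hxv, hxR⟩
  · intro n hn r
    have := h.balance n hn r
    simp only [Multiset.map_cons, Multiset.sum_cons, charge_append] at this ⊢
    by_cases hs : s = r <;> simp only [hs, if_true, if_false] at this ⊢ <;> linarith
  · intro n hn hz
    simp only [Multiset.mem_cons, forall_eq_or_imp] at hz
    obtain ⟨hu, hv, hR⟩ := hz
    obtain ⟨x, hx, rfl⟩ := h.lift n hn (by
      simp only [Multiset.mem_cons, forall_eq_or_imp, charge_append]
      exact ⟨by rw [hu, hv]; rfl, hR⟩)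
    obtain ⟨α, hα⟩ := h.closed x hx (s, u ++ v) (by simp)
    obtain ⟨γ, h₁, h₂⟩ := flow_append.1 hα
    obtain rfl : γ = α := by rw [h₁.charge_eq, hu, add_zero]
    exact ⟨x, ⟨hx, ⟨_, h₁⟩, ⟨_, h₂⟩⟩, rfl⟩

/-- Births and deaths: a circle without endpoints imposes no condition on flows and contributes no
charge. -/
theorem surfaceKernel_cons_nil {s : ℕ} :
    SurfaceKernel q ((s, []) ::ₘ K) f L ↔ SurfaceKernel q K f L := by
  have hA : arrowsOf ((s, []) ::ₘ K) = arrowsOf K := by simp [arrowsOf]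
  have hc : ∀ x, Closed x [] := fun x => ⟨0, rfl⟩
  constructor
  all_goals
    intro h
    refine ⟨h.invol, by simpa only [hA] using h.fixed, ?_, h.inv, by simpa only [hA] using h.good,
      ?_, ?_, ?_⟩
  · simpa [hc] using h.closed
  · simpa using h.boundary
  · simpa using h.balance
  · simpa using h.lift
  · simpa [hc] using h.closed
  · simpa using h.boundary
  · simpa using h.balance
  · simpa using h.lift

theorem SurfaceKernel.rotate {R : Multiset LabelledCircle} {s : ℕ} {c c' : Circle}
    (hr : c.IsRotated c') (h : SurfaceKernel q ((s, c') ::ₘ R) f L) :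
    SurfaceKernel q ((s, c) ::ₘ R) f L := by
  have hA : arrowsOf ((s, c) ::ₘ R) = arrowsOf ((s, c') ::ₘ R) := by
    ext a; simp [mem_arrowsOf, hr.mem_iff]
  refine ⟨h.invol, by simpa only [hA] using h.fixed, ?_, h.inv, by simpa only [hA] using h.good,
      ?_, ?_, ?_⟩
  · simpa [closed_rotate_iff hr] using h.closed
  · simpa [hr.mem_iff] using h.boundary
  · simpa [charge_perm _ hr.perm] using h.balance
  · simpa [charge_perm _ hr.perm] using h.lift

/-- The start of the backward induction. There are no crossings, so every intersection number is an
empty sum and all flows may be admitted. -/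
theorem surfaceKernel_nil (s : ℕ) (hq : q 0) : SurfaceKernel q {(s, [])} id ⊤ := by
  have hA : arrowsOf {((s, []) : LabelledCircle)} = ∅ := by simp [arrowsOf]
  refine ⟨fun _ => rfl, fun _ _ => rfl, ?_, fun _ _ _ => rfl, ?_, ?_, ?_, ?_⟩
  · simp only [Multiset.mem_singleton]
    rintro x - k rfl
    exact ⟨0, rfl⟩
  · intro v _
    rw [hA]
    exact hq
  · intro r
    exact ⟨0, trivial, rfl, by simp⟩
  · simp
  · intro n _ _
    exact ⟨(0, n), trivial, rfl⟩

end FlatKnots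

namespace FlatKnots

variable {q : (Fin 4 → Fin 4 → ℤ) → Prop} {K : Multiset LabelledCircle} {f : ℕ → ℕ}
  {L : AddSubgroup EdgeChain}

/-! ### Invariance under the flat Reidemeister moves -/

/-- Apply a map to all circles. -/
def mapCircles (g : Circle → Circle) (K : Multiset LabelledCircle) : Multiset LabelledCircle :=
  K.map fun k => (k.1, g k.2)

theorem forall_mem_mapCircles {g : Circle → Circle} {P : LabelledCircle → Prop} :
    (∀ k ∈ mapCircles g K, P k) ↔ ∀ k ∈ K, P (k.1, g k.2) := by
  simp only [mapCircles, Multiset.mem_map, forall_exists_index, and_imp, forall_apply_eq_imp_iff₂]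

theorem sum_map_mapCircles {g : Circle → Circle} (F : LabelledCircle → ℤ) :
    ((mapCircles g K).map F).sum = (K.map fun k => F (k.1, g k.2)).sum := by
  simp [mapCircles]

/-- The common argument for the moves that keep the number of arrows, renaming and the third move:
it suffices that `Ψ` carries closed flows to closed flows, preserves the form and the growth (up to
`π`), and fixes constant flows. -/
theorem SurfaceKernel.iso (π : Equiv.Perm ℕ) (g : Circle → Circle) (Ψ : EdgeChain →+ EdgeChain)
    (hA : ∀ a, π a ∈ arrowsOf (mapCircles g K) ↔ a ∈ arrowsOf K)
    (hcl : ∀ x, (∀ k ∈ K, Closed x k.2) → ∀ k ∈ K, Closed (Ψ x) (g k.2))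
    (hform : ∀ x y, (∀ k ∈ K, Closed x k.2) → (∀ k ∈ K, Closed y k.2) →
      form (arrowsOf (mapCircles g K)) (Ψ x) (Ψ y) = form (arrowsOf K) x y)
    (hn : ∀ x a, (Ψ x).2 (π a) = x.2 a)
    (hone : ∀ x : EdgeChain, x.2 = 0 → ∀ k ∈ K, ∀ z, (∀ p ∈ k.2, x.1 p = z) →
      ∀ p ∈ g k.2, (Ψ x).1 p = z)
    (hch : ∀ n, ∀ k ∈ K, charge n (g k.2) = charge (n ∘ π) k.2)
    (h : SurfaceKernel q K f L) :
    SurfaceKernel q (mapCircles g K) (π ∘ f ∘ π.symm) (L.map Ψ) := by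
  have hn' : ∀ x a, (Ψ x).2 a = x.2 (π.symm a) := fun x a => by
    rw [← hn x, π.apply_symm_apply]
  have hinv : ∀ n : ℕ → ℤ, (∀ a, n ((π ∘ f ∘ π.symm) a) = n a) →
      ∀ a, (n ∘ π) (f a) = (n ∘ π) a := fun n h a => by simpa using h (π a)
  refine ⟨fun a => by simp [h.invol], fun a ha => ?_, ?_, ?_, ?_, fun s => ?_, fun n hn₁ s => ?_,
    fun n hn₁ hz => ?_⟩
  · have := h.fixed (π.symm a) (by rw [← hA]; simpa using ha)
    simp [this]
  · rintro _ ⟨x, hx, rfl⟩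
    exact forall_mem_mapCircles.2 (hcl x (h.closed x hx))
  · rintro _ ⟨x, hx, rfl⟩ a
    simp [hn', h.inv x hx]
  · intro v hv
    choose w hw hwv using hv
    convert h.good w hw using 3 with i j
    rw [← hwv i, ← hwv j, hform _ _ (h.closed _ (hw i)) (h.closed _ (hw j))]
  · obtain ⟨x, hx, hx2, hx1⟩ := h.boundary s
    refine ⟨Ψ x, ⟨x, hx, rfl⟩, by ext a; simp [hn', hx2], ?_⟩
    exact forall_mem_mapCircles.2 fun k hk => hone x hx2 k hk _ (hx1 k hk)
  · refine Eq.trans ?_ (h.balance _ (hinv n hn₁) s)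
    rw [sum_map_mapCircles]
    refine congrArg Multiset.sum (Multiset.map_congr rfl fun k hk => ?_)
    simp [hch n k hk]
  · obtain ⟨x, hx, hx2⟩ := h.lift _ (hinv n hn₁) fun k hk => by
      rw [← hch n k hk]; exact forall_mem_mapCircles.1 hz k hk
    refine ⟨Ψ x, ⟨x, hx, rfl⟩, ?_⟩
    ext a
    simp [hn', hx2]

theorem mem_eraseArrows {S : Finset ℕ} {c : Circle} {p : Endpoint} :
    p ∈ eraseArrows S c ↔ p ∈ c ∧ p.1 ∉ S := by simp [eraseArrows]

/-- The arrows `a` and `b` (which may be equal) can be removed by a flat Reidemeister move: flows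
with the same growth at `a` and `b` correspond to flows without `a` and `b`. -/
structure Removable (K : Multiset LabelledCircle) (a b : ℕ) : Prop where
  gauss : GaussFamily K
  left_mem : a ∈ arrowsOf K
  right_mem : b ∈ arrowsOf K
  closed : ∀ x : EdgeChain, x.2 a = x.2 b → (∀ k ∈ K, Closed x k.2) →
    ∀ k ∈ K, Closed x (eraseArrows {a, b} k.2)
  extend : ∀ x : EdgeChain, x.2 a = x.2 b → (∀ k ∈ K, Closed x (eraseArrows {a, b} k.2)) →
    ∃ i : Endpoint → ℤ, (∀ p, p.1 ≠ a → p.1 ≠ b → i p = x.1 p) ∧ ∀ k ∈ K, Closed (i, x.2) k.2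
  form_eq_zero : ∀ x y : EdgeChain, x.2 a = x.2 b → y.2 a = y.2 b → (∀ k ∈ K, Closed x k.2) →
    (∀ k ∈ K, Closed y k.2) → form {a, b} x y = 0
  charge_eq : ∀ n : ℕ → ℤ, n a = n b → ∀ k ∈ K, charge n (eraseArrows {a, b} k.2) = charge n k.2

namespace Removable
variable {a b : ℕ}

theorem arrowsOf_eq (a b : ℕ) (K : Multiset LabelledCircle) :
    arrowsOf (mapCircles (eraseArrows {a, b}) K) = arrowsOf K \ {a, b} := by
  ext c
  simp only [mem_arrowsOf, mapCircles, Multiset.mem_map, Finset.mem_sdiff]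
  constructor
  · rintro ⟨_, ⟨k, hk, rfl⟩, t, ht⟩
    rw [mem_eraseArrows] at ht
    exact ⟨⟨k, hk, t, ht.1⟩, ht.2⟩
  · rintro ⟨⟨k, hk, t, ht⟩, hc⟩
    exact ⟨_, ⟨k, hk, rfl⟩, t, mem_eraseArrows.2 ⟨ht, hc⟩⟩

theorem form_eq (h : Removable K a b) {x y : EdgeChain} (hx : x.2 a = x.2 b) (hy : y.2 a = y.2 b)
    (hx' : ∀ k ∈ K, Closed x k.2) (hy' : ∀ k ∈ K, Closed y k.2) :
    form (arrowsOf (mapCircles (eraseArrows {a, b}) K)) x y = form (arrowsOf K) x y := by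
  have hsub : ({a, b} : Finset ℕ) ⊆ arrowsOf K := by
    simp [Finset.insert_subset_iff, h.left_mem, h.right_mem]
  have h₀ := h.form_eq_zero x y hx hy hx' hy'
  rw [arrowsOf_eq]
  unfold form at h₀ ⊢
  rw [← Finset.sum_sdiff hsub, h₀, add_zero]

theorem exists_mem_of_arrowsOf (h : Removable K a b) {c : ℕ}
    (hc : c ∈ arrowsOf (mapCircles (eraseArrows {a, b}) K)) (t : Bool) :
    (c ≠ a ∧ c ≠ b) ∧ ∃ k ∈ K, (c, t) ∈ eraseArrows {a, b} k.2 := by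
  rw [arrowsOf_eq, Finset.mem_sdiff] at hc
  obtain ⟨k, hk, hkt⟩ := h.gauss.exists_mem hc.1 t
  exact ⟨by simpa using hc.2, k, hk, mem_eraseArrows.2 ⟨hkt, hc.2⟩⟩

theorem form_congr (h : Removable K a b) {x y x' y' : EdgeChain}
    (hx : ∀ k ∈ K, ∀ p ∈ eraseArrows {a, b} k.2, x.1 p = x'.1 p)
    (hx' : ∀ c, c ≠ a → c ≠ b → x.2 c = x'.2 c)
    (hy : ∀ k ∈ K, ∀ p ∈ eraseArrows {a, b} k.2, y.1 p = y'.1 p)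
    (hy' : ∀ c, c ≠ a → c ≠ b → y.2 c = y'.2 c) :
    form (arrowsOf (mapCircles (eraseArrows {a, b}) K)) x y =
      form (arrowsOf (mapCircles (eraseArrows {a, b}) K)) x' y' := by
  refine FlatKnots.form_congr (fun c hc t => ?_) (fun c hc => ?_) (fun c hc t => ?_)
    (fun c hc => ?_)
  · obtain ⟨-, k, hk, hp⟩ := h.exists_mem_of_arrowsOf hc t
    exact hx k hk _ hp
  · obtain ⟨hc, -⟩ := h.exists_mem_of_arrowsOf hc true
    exact hx' c hc.1 hc.2
  · obtain ⟨-, k, hk, hp⟩ := h.exists_mem_of_arrowsOf hc t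
    exact hy k hk _ hp
  · obtain ⟨hc, -⟩ := h.exists_mem_of_arrowsOf hc true
    exact hy' c hc.1 hc.2

/-- The flows that agree, away from `a` and `b`, with a flow in `L`. -/
def transfer (K : Multiset LabelledCircle) (a b : ℕ) (L : AddSubgroup EdgeChain) :
    AddSubgroup EdgeChain where
  carrier := {y | ∃ x ∈ L, (∀ c, c ≠ a → c ≠ b → x.2 c = y.2 c) ∧
    ∀ k ∈ K, ∀ p ∈ eraseArrows {a, b} k.2, x.1 p = y.1 p}
  add_mem' := by
    rintro y y' ⟨x, hx, h₁, h₂⟩ ⟨x', hx', h₁', h₂'⟩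
    refine ⟨x + x', L.add_mem hx hx', fun c h h' => ?_, fun k hk p hp => ?_⟩
    · simp [h₁ c h h', h₁' c h h']
    · simp [h₂ k hk p hp, h₂' k hk p hp]
  zero_mem' := ⟨0, L.zero_mem, fun _ _ _ => rfl, fun _ _ _ _ => rfl⟩
  neg_mem' := by
    rintro y ⟨x, hx, h₁, h₂⟩
    refine ⟨-x, L.neg_mem hx, fun c h h' => ?_, fun k hk p hp => ?_⟩
    · simp [h₁ c h h']
    · simp [h₂ k hk p hp]

/-- The flows that are consistent around all circles and have the same growth at `a` and `b`. -/
def balanced (K : Multiset LabelledCircle) (a b : ℕ) : AddSubgroup EdgeChain where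
  carrier := {y | y.2 a = y.2 b ∧ ∀ k ∈ K, Closed y k.2}
  add_mem' := fun h h' => ⟨by simp [h.1, h'.1], fun k hk => (h.2 k hk).add (h'.2 k hk)⟩
  zero_mem' := ⟨rfl, fun _ _ => closed_zero _⟩
  neg_mem' := fun h => ⟨by simp [h.1], fun k hk => (h.2 k hk).neg⟩

/-- When the two arrows are created they are paired with each other. Flows with equal growth there
acquire no new intersection numbers, because the contributions of `a` and `b` cancel. -/
theorem surfaceKernel_of_erase (h : Removable K a b)
    (hK : SurfaceKernel q (mapCircles (eraseArrows {a, b}) K) f L) :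
    SurfaceKernel q K (fun c => if c = a then b else if c = b then a else f c)
      (transfer K a b L ⊓ balanced K a b) := by
  have hfa : f a = a := hK.fixed a (by simp [arrowsOf_eq])
  have hfb : f b = b := hK.fixed b (by simp [arrowsOf_eq])
  have hf := hK.invol
  have hfc : ∀ c, c ≠ a → c ≠ b → f c ≠ a ∧ f c ≠ b := fun c h₁ h₂ =>
    ⟨fun h => h₁ (by rw [← hf c, h, hfa]), fun h => h₂ (by rw [← hf c, h, hfb])⟩
  have hinv : ∀ n : ℕ → ℤ, (∀ c, n (if c = a then b else if c = b then a else f c) = n c) →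
      n a = n b ∧ ∀ c, n (f c) = n c := by
    intro n hn
    refine ⟨by simpa using (hn a).symm, fun c => ?_⟩
    by_cases h₁ : c = a
    · rw [h₁, hfa]
    · by_cases h₂ : c = b
      · rw [h₂, hfb]
      · simpa [h₁, h₂] using hn c
  refine ⟨fun c => ?_, fun c hc => ?_, fun x hx => hx.2.2, ?_, ?_, fun s => ?_, fun n hn s => ?_,
    fun n hn hz => ?_⟩
  · by_cases h₁ : c = a
    · by_cases hab : b = a <;> simp [h₁, hab]
    · by_cases h₂ : c = b
      · simp [h₂]
      · simp [h₁, h₂, hfc c h₁ h₂, hf]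
  · have h₁ : c ≠ a := fun h' => hc (h' ▸ h.left_mem)
    have h₂ : c ≠ b := fun h' => hc (h' ▸ h.right_mem)
    simp only [h₁, h₂, if_false]
    exact hK.fixed c fun h' => hc (by rw [arrowsOf_eq, Finset.mem_sdiff] at h'; exact h'.1)
  · rintro y ⟨⟨x, hx, hxy, -⟩, hy, -⟩ c
    by_cases h₁ : c = a
    · simp [h₁, hy]
    · by_cases h₂ : c = b
      · subst h₂; simp [h₁, hy]
      · have h₃ := hfc c h₁ h₂
        simp only [h₁, h₂, if_false]
        rw [← hxy c h₁ h₂, ← hxy _ h₃.1 h₃.2, hK.inv x hx]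
  · intro v hv
    choose w hw hw2 hw1 using fun i => (hv i).1
    convert hK.good w hw using 3 with i j
    rw [← h.form_eq (hv i).2.1 (hv j).2.1 (hv i).2.2 (hv j).2.2]
    exact (h.form_congr (hw1 i) (hw2 i) (hw1 j) (hw2 j)).symm
  · obtain ⟨x, hx, hx2, hx1⟩ := hK.boundary s
    obtain ⟨l, hl⟩ := h.gauss.exists_label
    -- The boundary flow `x` is only prescribed away from `a` and `b`. The flow is therefore
    -- redefined at all endpoints, using the label of the circle on which an endpoint lies.
    refine ⟨(fun p => if l p = s then 1 else 0, 0), ⟨⟨x, hx, ?_, ?_⟩, rfl, ?_⟩, rfl, ?_⟩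
    · simp [hx2]
    · intro k hk p hp
      rw [forall_mem_mapCircles.1 hx1 k hk p hp]
      simp [hl k hk p (mem_eraseArrows.1 hp).1]
    · intro k hk
      exact ⟨_, flow_const (α := if k.1 = s then 1 else 0)
        (fun p hp => by simp [hl k hk p hp]) rfl⟩
    · intro k hk p hp
      simp [hl k hk p hp]
  · obtain ⟨hab, hn⟩ := hinv n hn
    refine Eq.trans ?_ (hK.balance n hn s)
    rw [sum_map_mapCircles]
    exact congrArg Multiset.sum (Multiset.map_congr rfl fun k hk => by simp [h.charge_eq n hab k hk])
  · obtain ⟨hab, hn⟩ := hinv n hn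
    obtain ⟨x, hx, rfl⟩ := hK.lift n hn (forall_mem_mapCircles.2 fun k hk => by
      rw [h.charge_eq n hab k hk, hz k hk])
    obtain ⟨i, hi, hcl⟩ := h.extend x hab (forall_mem_mapCircles.1 (hK.closed x hx))
    refine ⟨(i, x.2), ⟨⟨x, hx, fun _ _ _ => rfl, fun k _ p hp => ?_⟩, hab, hcl⟩, rfl⟩
    have := (mem_eraseArrows.1 hp).2
    simp only [Finset.mem_insert, Finset.mem_singleton, not_or] at this
    exact (hi p this.1 this.2).symm

/-- The pairing of the arrows after the removal of `a` and `b`: the partners of `a` and `b` become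
partners of each other. -/
def erasedPairing (f : ℕ → ℕ) (a b c : ℕ) : ℕ :=
  if c = a ∨ c = b then c
  else if f c = a then (if f b = b then c else f b)
  else if f c = b then (if f a = a then c else f a)
  else f c

theorem erasedPairing_invol (hf : ∀ c, f (f c) = c) (c : ℕ) :
    erasedPairing f a b (erasedPairing f a b c) = c := by
  have ha := hf a
  have hb := hf b
  have hc := hf c
  unfold erasedPairing
  grind

theorem exists_invariant_extension (hf : ∀ c, f (f c) = c) (n : ℕ → ℤ)
    (hn : ∀ c, n (erasedPairing f a b c) = n c) :
    ∃ m : ℕ → ℤ, (∀ c, c ≠ a → c ≠ b → m c = n c) ∧ m a = m b ∧ ∀ c, m (f c) = m c := by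
  -- The common value at `a` and `b` is dictated by a partner outside `{a, b}`, if there is one. If
  -- both have such a partner, `erasedPairing` has made the two partners a pair, so the choice does
  -- not matter. If neither has one, any value works and 0 is taken.
  let v : ℤ := if f a ≠ a ∧ f a ≠ b then n (f a) else if f b ≠ a ∧ f b ≠ b then n (f b) else 0
  refine ⟨fun c => if c = a ∨ c = b then v else n c, ?_, by simp, fun c => ?_⟩
  · intro c h₁ h₂; simp [h₁, h₂]
  · have ha := hf a
    have hb := hf b
    have hc := hf c
    have h₁ := hn c
    have h₂ := hn (f a)
    have h₃ := hn (f b)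
    simp only [erasedPairing] at h₁ h₂ h₃
    simp only [v]
    grind

/-- Only the flows in `L` with equal growth at `a` and `b` descend to the smaller diagram. On these
the former partners of `a` and `b` have equal growth as well, which is why they can become partners
of each other. -/
theorem surfaceKernel_erase (h : Removable K a b) (hK : SurfaceKernel q K f L) :
    SurfaceKernel q (mapCircles (eraseArrows {a, b}) K) (erasedPairing f a b)
      (transfer K a b (L ⊓ balanced K a b)) := by
  have hf := hK.invol
  have hne : ∀ k : LabelledCircle, ∀ p ∈ eraseArrows {a, b} k.2, p.1 ≠ a ∧ p.1 ≠ b :=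
    fun k p hp => by simpa using (mem_eraseArrows.1 hp).2
  refine ⟨erasedPairing_invol hf, fun c hc => ?_, ?_, ?_, ?_, fun s => ?_, fun n hn s => ?_,
    fun n hn hz => ?_⟩
  · rw [arrowsOf_eq, Finset.mem_sdiff] at hc
    unfold erasedPairing
    split_ifs with h₁
    · rfl
    · rfl
    all_goals
      have := hK.fixed c (fun h' => hc ⟨h', by simpa using h₁⟩)
      have h₂ := not_or.1 h₁
      grind
  · rintro y ⟨x, ⟨hx, hxb⟩, hxy, hxy'⟩
    refine forall_mem_mapCircles.2 fun k hk => ?_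
    refine (closed_congr (hxy' k hk) fun p hp => ?_).1 (h.closed x hxb.1 hxb.2 k hk)
    exact hxy _ (hne k p hp).1 (hne k p hp).2
  · rintro y ⟨x, ⟨hx, hxb, -⟩, hxy, -⟩ c
    have h₁ := hK.inv x hx c
    have h₂ := hK.inv x hx a
    have h₃ := hK.inv x hx b
    have ha := hf a
    have hb := hf b
    have hc := hf c
    have h₄ := hxy c
    have h₅ := hxy (f c)
    have h₆ := hxy (f a)
    have h₇ := hxy (f b)
    unfold erasedPairing
    grind
  · intro v hv
    choose w hw hw2 hw1 using hv
    convert hK.good w (fun i => (hw i).1) using 3 with i j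
    rw [← h.form_eq (hw i).2.1 (hw j).2.1 (hw i).2.2 (hw j).2.2]
    exact (h.form_congr (hw1 i) (hw2 i) (hw1 j) (hw2 j)).symm
  · obtain ⟨x, hx, hx2, hx1⟩ := hK.boundary s
    refine ⟨x, ⟨x, ⟨hx, by simp [hx2], hK.closed x hx⟩, fun _ _ _ => rfl, fun _ _ _ _ => rfl⟩,
      hx2, forall_mem_mapCircles.2 fun k hk p hp => ?_⟩
    exact hx1 k hk p (mem_eraseArrows.1 hp).1
  · obtain ⟨m, hm, hab, hm'⟩ := exists_invariant_extension hf n hn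
    refine Eq.trans ?_ (hK.balance m hm' s)
    rw [sum_map_mapCircles]
    refine congrArg Multiset.sum (Multiset.map_congr rfl fun k hk => ?_)
    rw [← h.charge_eq m hab k hk]
    simp only
    rw [charge_congr fun p hp => hm _ (hne k p hp).1 (hne k p hp).2]
  · obtain ⟨m, hm, hab, hm'⟩ := exists_invariant_extension hf n hn
    obtain ⟨x, hx, rfl⟩ := hK.lift m hm' fun k hk => by
      rw [← h.charge_eq m hab k hk,
        charge_congr fun p hp => hm _ (hne k p hp).1 (hne k p hp).2]
      exact forall_mem_mapCircles.1 hz k hk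
    exact ⟨(x.1, n), ⟨x, ⟨hx, hab, hK.closed x hx⟩, hm, fun _ _ _ _ => rfl⟩, rfl⟩

end Removable

end FlatKnots

namespace FlatKnots

variable {q : (Fin 4 → Fin 4 → ℤ) → Prop} {K : Multiset LabelledCircle}

/-! ### Loops and bigons are removable -/

theorem GaussFamily.pair {p r : Endpoint} (hK : GaussFamily K)
    (h : ∃ k ∈ K, ∃ u, k.2.IsRotated (p :: r :: u)) : ∀ k ∈ K, Pair p r k.2 := by
  obtain ⟨k, hk, u, hu⟩ := h
  have hp : p ∈ k.2 := hu.mem_iff.2 (by simp)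
  have hr : r ∈ k.2 := hu.mem_iff.2 (by simp)
  refine fun k' hk' => ⟨hK.nodup k' hk', ?_⟩
  by_cases h : k = k'
  · exact Or.inl ⟨u, h ▸ hu⟩
  · exact Or.inr ⟨fun h' => h (hK.disj k hk k' hk' p hp h'), fun h' => h (hK.disj k hk k' hk' r hr h')⟩

theorem out_eq_of_isRotated {p r : Endpoint} (h : ∃ k ∈ K, ∃ u, k.2.IsRotated (p :: r :: u))
    {x : EdgeChain} (hx : ∀ k ∈ K, Closed x k.2) : x.1 r = x.1 p + sgn p * x.2 p.1 := by
  obtain ⟨k, hk, u, hu⟩ := h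
  obtain ⟨α, h₁, h₂, -⟩ := (hx k hk).rotate hu
  rw [h₂, EdgeChain.out]

theorem eraseArrows_eq_erasePair (a : ℕ) (t : Bool) (c : Circle) :
    eraseArrows {a, a} c = erasePair (a, t) (a, !t) c := by
  refine List.filter_congr fun p _ => ?_
  obtain ⟨b, s⟩ := p
  by_cases h : b = a <;> cases s <;> cases t <;> simp [h]

/-- The tail and the head of `a` are neighbours with opposite growth. The edge between them
determines its values from those in front, and with these the term of the form at `a` vanishes
identically. -/
theorem removable_of_loop (hK : GaussFamily K) {a : ℕ} {t : Bool}
    (h : ∃ k ∈ K, ∃ u, k.2.IsRotated ((a, t) :: (a, !t) :: u)) : Removable K a a := by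
  have hp := hK.pair h
  have ha : a ∈ arrowsOf K := by
    obtain ⟨k, hk, u, hu⟩ := h
    exact mem_arrowsOf.2 ⟨k, hk, t, hu.mem_iff.2 (by simp)⟩
  have hn : ∀ n : ℕ → ℤ, sgn (a, t) * n a + sgn (a, !t) * n a = 0 := fun n => by
    rw [sgn_not]; ring
  refine ⟨hK, ha, ha, ?_, ?_, ?_, ?_⟩
  · intro x _ hx k hk
    rw [eraseArrows_eq_erasePair a t]
    exact closed_erasePair (hp k hk) (hn _) (hx k hk)
  · intro x _ hx
    simp only [eraseArrows_eq_erasePair a t] at hx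
    obtain ⟨i, hi, hcl⟩ := exists_closed_of_erasePair (S := {c | ∃ k ∈ K, k.2 = c}) (p := (a, t))
      (q := (a, !t)) (x := x) (by rintro _ ⟨k, hk, rfl⟩; exact hp k hk)
      (by rintro _ ⟨k, hk, rfl⟩ _ ⟨k', hk', rfl⟩ h₁ h₂; rw [hK.disj k hk k' hk' _ h₁ h₂]) (hn _)
      (by rintro _ ⟨k, hk, rfl⟩; exact hx k hk)
    refine ⟨i, fun p h₁ _ => hi p ?_ ?_, fun k hk => hcl _ ⟨k, hk, rfl⟩⟩
    · rintro rfl; exact h₁ rfl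
    · rintro rfl; exact h₁ rfl
  · intro x y _ _ hx hy
    have ex := out_eq_of_isRotated h hx
    have ey := out_eq_of_isRotated h hy
    simp only [form, Finset.pair_eq_singleton, Finset.sum_singleton, EdgeChain.out]
    cases t <;> simp at ex ey ⊢ <;> rw [ex, ey] <;> ring
  · intro n _ k hk
    rw [eraseArrows_eq_erasePair a t]
    exact charge_erasePair (hp k hk) (hn n)

/-- The two sides of the bigon are removed one after the other. Each side carries one tail and one
head belonging to different arrows, so their growths cancel as soon as the flow grows equally at `a`
and `b`; this is what `hn₁` and `hn₂` ask for. -/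
theorem removable_of_bigon (hK : GaussFamily K) {a b : ℕ} {p₁ q₁ p₂ q₂ : Endpoint}
    (ha : a ∈ arrowsOf K) (hb : b ∈ arrowsOf K)
    (h₁ : ∃ k ∈ K, ∃ u, k.2.IsRotated (p₁ :: q₁ :: u))
    (h₂ : ∃ k ∈ K, ∃ u, k.2.IsRotated (p₂ :: q₂ :: u))
    (hpq : ∀ r : Endpoint, r.1 ∉ ({a, b} : Finset ℕ) ↔ (r ≠ p₁ ∧ r ≠ q₁) ∧ r ≠ p₂ ∧ r ≠ q₂)
    (hp : p₂ ≠ p₁ ∧ p₂ ≠ q₁) (hq : q₂ ≠ p₁ ∧ q₂ ≠ q₁)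
    (hn₁ : ∀ n : ℕ → ℤ, n a = n b → sgn p₁ * n p₁.1 + sgn q₁ * n q₁.1 = 0)
    (hn₂ : ∀ n : ℕ → ℤ, n a = n b → sgn p₂ * n p₂.1 + sgn q₂ * n q₂.1 = 0)
    (hform : ∀ x y : EdgeChain, x.2 a = x.2 b → y.2 a = y.2 b → (∀ k ∈ K, Closed x k.2) →
      (∀ k ∈ K, Closed y k.2) → form {a, b} x y = 0) : Removable K a b := by
  have he : ∀ c, eraseArrows {a, b} c = erasePair p₂ q₂ (erasePair p₁ q₁ c) := fun c => by
    rw [eraseArrows, erasePair, erasePair, List.filter_filter]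
    refine List.filter_congr fun r _ => ?_
    rw [← Bool.decide_and, decide_eq_decide, hpq, and_comm]
  have hp₁ := hK.pair h₁
  have hp₂ : ∀ k ∈ K, Pair p₂ q₂ (erasePair p₁ q₁ k.2) := fun k hk =>
    (hK.pair h₂ k hk).erasePair hp hq
  refine ⟨hK, ha, hb, ?_, ?_, hform, ?_⟩
  · intro x hab hx k hk
    rw [he]
    exact closed_erasePair (hp₂ k hk) (hn₂ _ hab) (closed_erasePair (hp₁ k hk) (hn₁ _ hab) (hx k hk))
  · intro x hab hx
    simp only [he] at hx
    obtain ⟨i, hi, hcl⟩ := exists_closed_of_erasePair (S := {c | ∃ k ∈ K, erasePair p₁ q₁ k.2 = c})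
      (p := p₂) (q := q₂) (x := x) (by rintro _ ⟨k, hk, rfl⟩; exact hp₂ k hk)
      (by
        rintro _ ⟨k, hk, rfl⟩ _ ⟨k', hk', rfl⟩ h₁ h₂
        rw [hK.disj k hk k' hk' _ (mem_erasePair.1 h₁).1 (mem_erasePair.1 h₂).1]) (hn₂ _ hab)
      (by rintro _ ⟨k, hk, rfl⟩; exact hx k hk)
    obtain ⟨j, hj, hcl'⟩ := exists_closed_of_erasePair (S := {c | ∃ k ∈ K, k.2 = c})
      (p := p₁) (q := q₁) (x := (i, x.2)) (by rintro _ ⟨k, hk, rfl⟩; exact hp₁ k hk)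
      (by rintro _ ⟨k, hk, rfl⟩ _ ⟨k', hk', rfl⟩ h₁ h₂; rw [hK.disj k hk k' hk' _ h₁ h₂])
      (hn₁ _ hab) (by rintro _ ⟨k, hk, rfl⟩; exact hcl _ ⟨k, hk, rfl⟩)
    refine ⟨j, fun p h₁ h₂ => ?_, fun k hk => hcl' _ ⟨k, hk, rfl⟩⟩
    have := (hpq p).1 (by simp [h₁, h₂])
    exact (hj p this.1.1 this.1.2).trans (hi p this.2.1 this.2.2)
  · intro n hab k hk
    rw [he, charge_erasePair (hp₂ k hk) (hn₂ _ hab), charge_erasePair (hp₁ k hk) (hn₁ _ hab)]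

theorem removable_of_parallel_bigon (hK : GaussFamily K) {a b : ℕ} {t : Bool} (hab : a ≠ b)
    (h₁ : ∃ k ∈ K, ∃ u, k.2.IsRotated ((a, t) :: (b, !t) :: u))
    (h₂ : ∃ k ∈ K, ∃ u, k.2.IsRotated ((a, !t) :: (b, t) :: u)) : Removable K a b := by
  have hm : a ∈ arrowsOf K ∧ b ∈ arrowsOf K := by
    obtain ⟨k, hk, u, hu⟩ := h₁
    exact ⟨mem_arrowsOf.2 ⟨k, hk, t, hu.mem_iff.2 (by simp)⟩,
      mem_arrowsOf.2 ⟨k, hk, !t, hu.mem_iff.2 (by simp)⟩⟩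
  refine removable_of_bigon hK hm.1 hm.2 h₁ h₂ ?_ ?_ ?_ ?_ ?_ ?_
  · rintro ⟨c, s⟩
    by_cases h : c = a
    · cases s <;> cases t <;> simp [h]
    · cases s <;> cases t <;> simp [h]
  · simp [hab]
  · simp [hab.symm]
  · intro n h
    simp only [sgn_not, h, sgn_mk b a]; ring
  · intro n h
    simp only [sgn_not, h, sgn_mk b a]; ring
  · intro x y hx hy hx' hy'
    have ex := out_eq_of_isRotated h₁ hx'
    have ey := out_eq_of_isRotated h₁ hy'
    have ex' := out_eq_of_isRotated h₂ hx'
    have ey' := out_eq_of_isRotated h₂ hy'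
    simp only [form, Finset.sum_pair hab, EdgeChain.out]
    cases t <;> simp at ex ey ex' ey' ⊢ <;> rw [ex, ey, ex', ey', hx, hy] <;> ring

theorem removable_of_opposite_bigon (hK : GaussFamily K) {a b : ℕ} {t : Bool} (hab : a ≠ b)
    (h₁ : ∃ k ∈ K, ∃ u, k.2.IsRotated ((a, t) :: (b, !t) :: u))
    (h₂ : ∃ k ∈ K, ∃ u, k.2.IsRotated ((b, t) :: (a, !t) :: u)) : Removable K a b := by
  have hm : a ∈ arrowsOf K ∧ b ∈ arrowsOf K := by
    obtain ⟨k, hk, u, hu⟩ := h₁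
    exact ⟨mem_arrowsOf.2 ⟨k, hk, t, hu.mem_iff.2 (by simp)⟩,
      mem_arrowsOf.2 ⟨k, hk, !t, hu.mem_iff.2 (by simp)⟩⟩
  refine removable_of_bigon hK hm.1 hm.2 h₁ h₂ ?_ ?_ ?_ ?_ ?_ ?_
  · rintro ⟨c, s⟩
    by_cases h : c = a
    · cases s <;> cases t <;> simp [h]
    · cases s <;> cases t <;> simp [h]
  · simp [hab.symm]
  · simp [hab]
  · intro n h
    simp only [sgn_not, h, sgn_mk b a]; ring
  · intro n h
    simp only [sgn_not, h, sgn_mk b a]; ring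
  · intro x y hx hy hx' hy'
    have ex := out_eq_of_isRotated h₁ hx'
    have ey := out_eq_of_isRotated h₁ hy'
    have ex' := out_eq_of_isRotated h₂ hx'
    have ey' := out_eq_of_isRotated h₂ hy'
    simp only [form, Finset.sum_pair hab, EdgeChain.out]
    cases t <;> simp at ex ey ex' ey' ⊢ <;> rw [ex, ey, ex', ey', hx, hy] <;> ring

theorem Removable.surfaceKernel_iff {a b : ℕ} (h : Removable K a b) :
    (∃ f L, SurfaceKernel q (mapCircles (eraseArrows {a, b}) K) f L) ↔
      ∃ f L, SurfaceKernel q K f L :=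
  ⟨fun ⟨_, _, h'⟩ => ⟨_, _, h.surfaceKernel_of_erase h'⟩,
    fun ⟨_, _, h'⟩ => ⟨_, _, h.surfaceKernel_erase h'⟩⟩

/-! ### Renaming the arrows -/

/-- The flow that corresponds to `x` after the arrows have been renamed. -/
def renameChain (π : Equiv.Perm ℕ) : EdgeChain →+ EdgeChain where
  toFun x := (fun p => x.1 (π.symm p.1, p.2), fun a => x.2 (π.symm a))
  map_zero' := rfl
  map_add' _ _ := rfl

@[simp] theorem renameChain_fst (π : Equiv.Perm ℕ) (x : EdgeChain) (p : Endpoint) :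
    (renameChain π x).1 p = x.1 (π.symm p.1, p.2) := rfl

@[simp] theorem renameChain_snd (π : Equiv.Perm ℕ) (x : EdgeChain) (a : ℕ) :
    (renameChain π x).2 a = x.2 (π.symm a) := rfl

theorem flow_rename {π : Equiv.Perm ℕ} {x : EdgeChain} {c : Circle} {α β : ℤ}
    (h : Flow x α c β) : Flow (renameChain π x) α (c.map fun p => (π p.1, p.2)) β := by
  induction c generalizing α with
  | nil => exact h
  | cons p c ih =>
    refine ⟨by simpa using h.1, ?_⟩
    convert ih h.2 using 1
    simp [EdgeChain.out, sgn]

theorem arrowsOf_rename (π : Equiv.Perm ℕ) (K : Multiset LabelledCircle) :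
    arrowsOf (mapCircles (List.map fun p => (π p.1, p.2)) K) = (arrowsOf K).map π.toEmbedding := by
  ext a
  simp only [mem_arrowsOf, mapCircles, Multiset.mem_map, Finset.mem_map, Equiv.coe_toEmbedding]
  constructor
  · rintro ⟨_, ⟨k, hk, rfl⟩, t, ht⟩
    obtain ⟨p, hp, hpa⟩ := List.mem_map.1 ht
    simp only [Prod.mk.injEq] at hpa
    exact ⟨p.1, ⟨k, hk, p.2, hp⟩, hpa.1⟩
  · rintro ⟨b, ⟨k, hk, t, ht⟩, rfl⟩
    exact ⟨_, ⟨k, hk, rfl⟩, t, List.mem_map.2 ⟨_, ht, rfl⟩⟩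

theorem form_rename (π : Equiv.Perm ℕ) (A : Finset ℕ) (x y : EdgeChain) :
    form (A.map π.toEmbedding) (renameChain π x) (renameChain π y) = form A x y := by
  simp [form, EdgeChain.out]

theorem SurfaceKernel.rename {f : ℕ → ℕ} {L : AddSubgroup EdgeChain} (π : Equiv.Perm ℕ)
    (h : SurfaceKernel q K f L) :
    SurfaceKernel q (mapCircles (List.map fun p => (π p.1, p.2)) K) (π ∘ f ∘ π.symm)
      (L.map (renameChain π)) := by
  refine h.iso π _ (renameChain π) ?_ ?_ ?_ ?_ ?_ ?_
  · intro a; simp [arrowsOf_rename]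
  · rintro x hx k hk
    obtain ⟨α, hα⟩ := hx k hk
    exact ⟨α, flow_rename hα⟩
  · intro x y _ _
    rw [arrowsOf_rename, form_rename]
  · intro x a; simp
  · intro x _ k _ z hz p hp
    obtain ⟨r, hr, rfl⟩ := List.mem_map.1 hp
    simpa using hz r hr
  · intro n k _
    simp [charge, sgn, Function.comp_def]

theorem mapCircles_rename_rename (π : Equiv.Perm ℕ) (K : Multiset LabelledCircle) :
    mapCircles (List.map fun p => (π.symm p.1, p.2))
      (mapCircles (List.map fun p => (π p.1, p.2)) K) = K := by
  simp [mapCircles, Multiset.map_map, Function.comp_def]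

/-! ### Exchanging three pairs of endpoints -/

/-- Three disjoint pairs of endpoints such that those of each pair are consecutive on the circle
`c` or do not occur on it. -/
structure ThreePairs (p₁ q₁ p₂ q₂ p₃ q₃ : Endpoint) (c : Circle) : Prop where
  nodup : [p₁, q₁, p₂, q₂, p₃, q₃].Nodup
  pair₁ : Pair p₁ q₁ c
  pair₂ : Pair p₂ q₂ c
  pair₃ : Pair p₃ q₃ c

/-- The flow that corresponds to `x` after the exchange of three pairs of endpoints. -/
def exchangeChain (p₁ q₁ p₂ q₂ p₃ q₃ : Endpoint) : EdgeChain →+ EdgeChain :=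
  (swapChain p₁ q₁).comp ((swapChain p₂ q₂).comp (swapChain p₃ q₃))

theorem exchange_eq (p₁ q₁ p₂ q₂ p₃ q₃ : Endpoint) (c : Circle) :
    exchange p₁ q₁ p₂ q₂ p₃ q₃ c =
      ((c.map (Equiv.swap p₃ q₃)).map (Equiv.swap p₂ q₂)).map (Equiv.swap p₁ q₁) := by
  simp [exchange]

section exchange

variable {p₁ q₁ p₂ q₂ p₃ q₃ : Endpoint} {c : Circle}

theorem ThreePairs.closed_exchange (h : ThreePairs p₁ q₁ p₂ q₂ p₃ q₃ c) {x : EdgeChain}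
    (hx : Closed x c) :
    Closed (exchangeChain p₁ q₁ p₂ q₂ p₃ q₃ x) (exchange p₁ q₁ p₂ q₂ p₃ q₃ c) := by
  obtain ⟨hn, h₁, h₂, h₃⟩ := h
  simp only [List.nodup_cons, List.mem_cons, List.not_mem_nil, or_false, not_or] at hn
  rw [exchange_eq]
  refine closed_swapChain ?_ (closed_swapChain ?_ (closed_swapChain h₃ hx))
  · exact (h₁.swap_of_ne (by tauto) (by tauto)).swap_of_ne (by tauto) (by tauto)
  · exact h₂.swap_of_ne (by tauto) (by tauto)

theorem ThreePairs.exchange (h : ThreePairs p₁ q₁ p₂ q₂ p₃ q₃ c) :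
    ThreePairs q₃ p₃ q₂ p₂ q₁ p₁ (exchange p₁ q₁ p₂ q₂ p₃ q₃ c) := by
  obtain ⟨hn, h₁, h₂, h₃⟩ := h
  rw [exchange_eq]
  refine ⟨by simpa using List.nodup_reverse.2 hn, ?_, ?_, ?_⟩
  all_goals simp only [List.nodup_cons, List.mem_cons, List.not_mem_nil, or_false, not_or] at hn
  · refine (h₃.swap.swap_of_ne ?_ ?_).swap_of_ne ?_ ?_ <;> constructor <;> (intro h; simp_all)
  · refine ((h₂.swap_of_ne ?_ ?_).swap).swap_of_ne ?_ ?_ <;> constructor <;> (intro h; simp_all)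
  · refine ((h₁.swap_of_ne ?_ ?_).swap_of_ne ?_ ?_).swap <;> constructor <;> (intro h; simp_all)

theorem ThreePairs.mem_exchange (h : ThreePairs p₁ q₁ p₂ q₂ p₃ q₃ c) {r : Endpoint} :
    r ∈ FlatKnots.exchange p₁ q₁ p₂ q₂ p₃ q₃ c ↔ r ∈ c := by
  obtain ⟨hn, h₁, h₂, h₃⟩ := h
  simp only [List.nodup_cons, List.mem_cons, List.not_mem_nil, or_false, not_or] at hn
  rw [exchange_eq, mem_map_swap, mem_map_swap, mem_map_swap h₃]
  · exact h₂.swap_of_ne (by tauto) (by tauto)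
  · exact (h₁.swap_of_ne (by tauto) (by tauto)).swap_of_ne (by tauto) (by tauto)

theorem ThreePairs.exchange_perm (h : ThreePairs p₁ q₁ p₂ q₂ p₃ q₃ c) :
    (FlatKnots.exchange p₁ q₁ p₂ q₂ p₃ q₃ c).Perm c := by
  refine (List.perm_ext_iff_of_nodup h.exchange.pair₁.1 h.pair₁.1).2 fun r => h.mem_exchange

theorem exchange_exchange (c : Circle) :
    FlatKnots.exchange q₃ p₃ q₂ p₂ q₁ p₁ (FlatKnots.exchange p₁ q₁ p₂ q₂ p₃ q₃ c) = c := by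
  simp [FlatKnots.exchange, Function.comp_def, Equiv.swap_comm q₁, Equiv.swap_comm q₂,
    Equiv.swap_comm q₃]

theorem swapChain_swapChain {p r : Endpoint} (h : p ≠ r) (x : EdgeChain) :
    swapChain p r (swapChain r p x) = x := by
  refine Prod.ext (funext fun s => ?_) rfl
  simp only [swapChain_fst, swapChain_snd, if_true, h, h.symm, if_false]
  split_ifs with h₁ h₂
  · rw [h₁]; ring
  · rw [h₂]; ring
  · rfl

theorem exchangeChain_exchangeChain (hn : [p₁, q₁, p₂, q₂, p₃, q₃].Nodup) (x : EdgeChain) :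
    exchangeChain p₁ q₁ p₂ q₂ p₃ q₃ (exchangeChain q₃ p₃ q₂ p₂ q₁ p₁ x) = x := by
  simp only [List.nodup_cons, List.mem_cons, List.not_mem_nil, or_false, not_or] at hn
  simp only [exchangeChain, AddMonoidHom.comp_apply]
  rw [swapChain_swapChain, swapChain_swapChain, swapChain_swapChain] <;> tauto

theorem exchangeChain_snd (x : EdgeChain) :
    (exchangeChain p₁ q₁ p₂ q₂ p₃ q₃ x).2 = x.2 := rfl

theorem exchangeChain_fst_of_zero {x : EdgeChain} (h : x.2 = 0) (r : Endpoint) :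
    (exchangeChain p₁ q₁ p₂ q₂ p₃ q₃ x).1 r = x.1 r := by
  simp only [exchangeChain, AddMonoidHom.comp_apply, swapChain_fst, swapChain_snd, h, Pi.zero_apply,
    mul_zero, add_zero, sub_zero]
  split_ifs <;> simp_all

theorem arrowsOf_exchange (h : ∀ k ∈ K, ThreePairs p₁ q₁ p₂ q₂ p₃ q₃ k.2) :
    arrowsOf (mapCircles (FlatKnots.exchange p₁ q₁ p₂ q₂ p₃ q₃) K) = arrowsOf K := by
  ext a
  simp only [mem_arrowsOf, mapCircles, Multiset.mem_map]
  constructor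
  · rintro ⟨_, ⟨k, hk, rfl⟩, t, ht⟩
    exact ⟨k, hk, t, (h k hk).mem_exchange.1 ht⟩
  · rintro ⟨k, hk, t, ht⟩
    exact ⟨_, ⟨k, hk, rfl⟩, t, (h k hk).mem_exchange.2 ht⟩

theorem SurfaceKernel.exchange {f : ℕ → ℕ} {L : AddSubgroup EdgeChain}
    (h : ∀ k ∈ K, ThreePairs p₁ q₁ p₂ q₂ p₃ q₃ k.2)
    (hform : ∀ x y, (∀ k ∈ K, Closed x k.2) → (∀ k ∈ K, Closed y k.2) →
      form (arrowsOf K) (exchangeChain p₁ q₁ p₂ q₂ p₃ q₃ x) (exchangeChain p₁ q₁ p₂ q₂ p₃ q₃ y) =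
        form (arrowsOf K) x y)
    (hK : SurfaceKernel q K f L) :
    SurfaceKernel q (mapCircles (FlatKnots.exchange p₁ q₁ p₂ q₂ p₃ q₃) K) f
      (L.map (exchangeChain p₁ q₁ p₂ q₂ p₃ q₃)) := by
  refine hK.iso (Equiv.refl ℕ) _ (exchangeChain p₁ q₁ p₂ q₂ p₃ q₃) ?_ ?_ ?_ ?_ ?_ ?_
  · intro a; simp [arrowsOf_exchange h]
  · exact fun x hx k hk => (h k hk).closed_exchange (hx k hk)
  · simpa only [arrowsOf_exchange h] using hform
  · intro x a; rfl
  · intro x hx k hk z hz p hp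
    rw [exchangeChain_fst_of_zero hx, hz p ((h k hk).mem_exchange.1 hp)]
  · intro n k hk
    exact charge_perm _ (h k hk).exchange_perm

/-- The exchange of the reversed pairs undoes the move, on circles and on flows. So the form
identity for the move already implies the one for its inverse, and a single hypothesis gives both
directions. -/
theorem surfaceKernel_exchange_iff (hn : [p₁, q₁, p₂, q₂, p₃, q₃].Nodup)
    (h : ∀ k ∈ K, ThreePairs p₁ q₁ p₂ q₂ p₃ q₃ k.2)
    (hform : ∀ x y, (∀ k ∈ K, Closed x k.2) → (∀ k ∈ K, Closed y k.2) →
      form (arrowsOf K) (exchangeChain p₁ q₁ p₂ q₂ p₃ q₃ x) (exchangeChain p₁ q₁ p₂ q₂ p₃ q₃ y) =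
        form (arrowsOf K) x y) :
    (∃ f L, SurfaceKernel q (mapCircles (FlatKnots.exchange p₁ q₁ p₂ q₂ p₃ q₃) K) f L) ↔
      ∃ f L, SurfaceKernel q K f L := by
  constructor
  · rintro ⟨f, L, hK⟩
    have h' : ∀ k ∈ mapCircles (FlatKnots.exchange p₁ q₁ p₂ q₂ p₃ q₃) K,
        ThreePairs q₃ p₃ q₂ p₂ q₁ p₁ k.2 := forall_mem_mapCircles.2 fun k hk => (h k hk).exchange
    have hback : mapCircles (FlatKnots.exchange q₃ p₃ q₂ p₂ q₁ p₁)
        (mapCircles (FlatKnots.exchange p₁ q₁ p₂ q₂ p₃ q₃) K) = K := by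
      simp [mapCircles, Multiset.map_map, exchange_exchange]
    have := SurfaceKernel.exchange h' (fun x y hx hy => ?_) hK
    · rw [hback] at this
      exact ⟨_, _, this⟩
    · have hcl : ∀ z : EdgeChain,
          (∀ k ∈ mapCircles (FlatKnots.exchange p₁ q₁ p₂ q₂ p₃ q₃) K, Closed z k.2) →
          ∀ k ∈ K, Closed (exchangeChain q₃ p₃ q₂ p₂ q₁ p₁ z) k.2 := by
        intro z hz k hk
        have := (h k hk).exchange.closed_exchange (forall_mem_mapCircles.1 hz k hk)
        rwa [exchange_exchange] at this
      rw [arrowsOf_exchange h, ← hform _ _ (hcl x hx) (hcl y hy),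
        exchangeChain_exchangeChain hn, exchangeChain_exchangeChain hn]
  · rintro ⟨f, L, hK⟩
    exact ⟨_, _, hK.exchange h hform⟩

end exchange

/-- The exchange alters flow values only at the endpoints involved, so the invariance of the form
needs to be checked only at the crossings of the triangle. -/
theorem form_exchangeChain {p₁ q₁ p₂ q₂ p₃ q₃ : Endpoint} {S A : Finset ℕ} (hS : S ⊆ A)
    (hpq : ∀ r ∈ [p₁, q₁, p₂, q₂, p₃, q₃], r.1 ∈ S) {x y : EdgeChain}
    (h : form S (exchangeChain p₁ q₁ p₂ q₂ p₃ q₃ x) (exchangeChain p₁ q₁ p₂ q₂ p₃ q₃ y) =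
      form S x y) :
    form A (exchangeChain p₁ q₁ p₂ q₂ p₃ q₃ x) (exchangeChain p₁ q₁ p₂ q₂ p₃ q₃ y) =
      form A x y := by
  have hfst : ∀ (z : EdgeChain) (a : ℕ) (t : Bool), a ∉ S →
      (exchangeChain p₁ q₁ p₂ q₂ p₃ q₃ z).1 (a, t) = z.1 (a, t) := by
    intro z a t ha
    have hr : ∀ r ∈ [p₁, q₁, p₂, q₂, p₃, q₃], (a, t) ≠ r := by
      rintro r hr rfl
      exact ha (hpq _ hr)
    simp only [List.forall_mem_cons] at hr
    simp [exchangeChain, swapChain_fst, hr]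
  rw [form, form] at *
  rw [← Finset.sum_sdiff hS, h, ← Finset.sum_sdiff hS (f := fun c => x.out (c, true) * _ - _)]
  congr 1
  refine Finset.sum_congr rfl fun a ha => ?_
  have ha := (Finset.mem_sdiff.1 ha).2
  simp only [EdgeChain.out, hfst _ _ _ ha, exchangeChain_snd]

theorem mem_arrowsOf_of_isRotated {p r : Endpoint}
    (h : ∃ k ∈ K, ∃ u, k.2.IsRotated (p :: r :: u)) : p.1 ∈ arrowsOf K ∧ r.1 ∈ arrowsOf K := by
  obtain ⟨k, hk, u, hu⟩ := h
  exact ⟨mem_arrowsOf.2 ⟨k, hk, p.2, hu.mem_iff.2 (by simp)⟩,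
    mem_arrowsOf.2 ⟨k, hk, r.2, hu.mem_iff.2 (by simp)⟩⟩

/-- Closedness expresses the flow on the three edges of the triangle through the values entering it
and the growths. After this substitution the claim is a polynomial identity. -/
theorem form_exchange_transitive {a b c : ℕ} (hab : a ≠ b) (hac : a ≠ c) (hbc : b ≠ c)
    (h₁ : ∃ k ∈ K, ∃ u, k.2.IsRotated ((a, true) :: (b, true) :: u))
    (h₂ : ∃ k ∈ K, ∃ u, k.2.IsRotated ((a, false) :: (c, true) :: u))
    (h₃ : ∃ k ∈ K, ∃ u, k.2.IsRotated ((b, false) :: (c, false) :: u))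
    {x y : EdgeChain} (hx : ∀ k ∈ K, Closed x k.2) (hy : ∀ k ∈ K, Closed y k.2) :
    form (arrowsOf K)
        (exchangeChain (a, true) (b, true) (a, false) (c, true) (b, false) (c, false) x)
        (exchangeChain (a, true) (b, true) (a, false) (c, true) (b, false) (c, false) y) =
      form (arrowsOf K) x y := by
  refine form_exchangeChain (S := {a, b, c}) ?_ (by simp) ?_
  · simp [Finset.insert_subset_iff, mem_arrowsOf_of_isRotated h₁, mem_arrowsOf_of_isRotated h₂]
  · have e₁ := out_eq_of_isRotated h₁ hx
    have e₂ := out_eq_of_isRotated h₂ hx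
    have e₃ := out_eq_of_isRotated h₃ hx
    have d₁ := out_eq_of_isRotated h₁ hy
    have d₂ := out_eq_of_isRotated h₂ hy
    have d₃ := out_eq_of_isRotated h₃ hy
    simp only [form, Finset.sum_insert, Finset.mem_insert, Finset.mem_singleton, hab, hac, hbc,
      or_self, not_false_eq_true, Finset.sum_singleton, EdgeChain.out, exchangeChain,
      AddMonoidHom.comp_apply, swapChain_fst, swapChain_snd, sgn_true, sgn_false, Prod.mk.injEq,
      hab.symm, hac.symm, hbc.symm, and_true, and_false, if_true, if_false,
      reduceCtorEq] at e₁ e₂ e₃ d₁ d₂ d₃ ⊢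
    rw [e₁, e₂, e₃, d₁, d₂, d₃]
    ring

theorem form_exchange_cyclic {a b c : ℕ} (hab : a ≠ b) (hac : a ≠ c) (hbc : b ≠ c)
    (h₁ : ∃ k ∈ K, ∃ u, k.2.IsRotated ((b, false) :: (a, true) :: u))
    (h₂ : ∃ k ∈ K, ∃ u, k.2.IsRotated ((a, false) :: (c, true) :: u))
    (h₃ : ∃ k ∈ K, ∃ u, k.2.IsRotated ((c, false) :: (b, true) :: u))
    {x y : EdgeChain} (hx : ∀ k ∈ K, Closed x k.2) (hy : ∀ k ∈ K, Closed y k.2) :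
    form (arrowsOf K)
        (exchangeChain (b, false) (a, true) (a, false) (c, true) (c, false) (b, true) x)
        (exchangeChain (b, false) (a, true) (a, false) (c, true) (c, false) (b, true) y) =
      form (arrowsOf K) x y := by
  refine form_exchangeChain (S := {a, b, c}) ?_ (by simp) ?_
  · simp [Finset.insert_subset_iff, mem_arrowsOf_of_isRotated h₁, mem_arrowsOf_of_isRotated h₂]
  · have e₁ := out_eq_of_isRotated h₁ hx
    have e₂ := out_eq_of_isRotated h₂ hx
    have e₃ := out_eq_of_isRotated h₃ hx
    have d₁ := out_eq_of_isRotated h₁ hy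
    have d₂ := out_eq_of_isRotated h₂ hy
    have d₃ := out_eq_of_isRotated h₃ hy
    simp only [form, Finset.sum_insert, Finset.mem_insert, Finset.mem_singleton, hab, hac, hbc,
      or_self, not_false_eq_true, Finset.sum_singleton, EdgeChain.out, exchangeChain,
      AddMonoidHom.comp_apply, swapChain_fst, swapChain_snd, sgn_true, sgn_false, Prod.mk.injEq,
      hab.symm, hac.symm, hbc.symm, and_true, and_false, if_true, if_false,
      reduceCtorEq] at e₁ e₂ e₃ d₁ d₂ d₃ ⊢
    rw [e₁, e₂, e₃, d₁, d₂, d₃]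
    ring

/-! ### Invariance under every flat move -/

theorem surfaceKernel_move_iff {C : List Circle} {g : Circle → Circle} (hK : GaussFamily K)
    (hC : K.map Prod.snd = (C : Multiset Circle)) (h : FlatMove C g) :
    (∃ f L, SurfaceKernel q (mapCircles g K) f L) ↔ ∃ f L, SurfaceKernel q K f L := by
  have hF : ∀ {p r : Endpoint}, Follows C p r →
      ∃ k ∈ K, ∃ u, k.2.IsRotated (p :: r :: u) := by
    rintro p r ⟨c, hc, u, hu⟩
    have : c ∈ K.map Prod.snd := by rw [hC]; exact hc
    obtain ⟨k, hk, rfl⟩ := Multiset.mem_map.1 this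
    exact ⟨k, hk, u, hu⟩
  cases h with
  | rename π =>
    refine ⟨fun ⟨f, L, h⟩ => ?_, fun ⟨f, L, h⟩ => ⟨_, _, h.rename π⟩⟩
    have := h.rename π.symm
    rw [mapCircles_rename_rename] at this
    exact ⟨_, _, this⟩
  | fr1 a t h =>
    have := (removable_of_loop hK (hF h)).surfaceKernel_iff (q := q)
    simpa using this
  | fr2_parallel a b t hab h₁ h₂ =>
    exact (removable_of_parallel_bigon hK hab (hF h₁) (hF h₂)).surfaceKernel_iff
  | fr2_opposite a b t hab h₁ h₂ =>
    exact (removable_of_opposite_bigon hK hab (hF h₁) (hF h₂)).surfaceKernel_iff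
  | fr3_transitive a b c hab hac hbc h₁ h₂ h₃ =>
    have hn : [(a, true), (b, true), (a, false), (c, true), (b, false), (c, false)].Nodup := by
      simp [hab, hac, hbc, hab.symm, hbc.symm]
    exact surfaceKernel_exchange_iff hn (fun k hk => ⟨hn, hK.pair (hF h₁) k hk,
      hK.pair (hF h₂) k hk, hK.pair (hF h₃) k hk⟩) fun x y hx hy =>
        form_exchange_transitive hab hac hbc (hF h₁) (hF h₂) (hF h₃) hx hy
  | fr3_cyclic a b c hab hac hbc h₁ h₂ h₃ =>
    have hn : [(b, false), (a, true), (a, false), (c, true), (c, false), (b, true)].Nodup := by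
      simp [hab, hac, hbc, hab.symm, hbc.symm]
    exact surfaceKernel_exchange_iff hn (fun k hk => ⟨hn, hK.pair (hF h₁) k hk,
      hK.pair (hF h₂) k hk, hK.pair (hF h₃) k hk⟩) fun x y hx hy =>
        form_exchange_cyclic hab hac hbc (hF h₁) (hF h₂) (hF h₃) hx hy

end FlatKnots

namespace FlatKnots

variable {q : (Fin 4 → Fin 4 → ℤ) → Prop}

/-! ### Movies -/

/-- The incidence graph of the given edges, between the components of the surface swept out so far
and those of the surface still to be swept out, is a forest: integral weights of the edges that are
balanced at all vertices vanish. -/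
def IsForest (P : Multiset (ℕ × ℕ)) : Prop :=
  ∀ W : Multiset (ℤ × ℕ × ℕ), W.map Prod.snd = P →
    (∀ s, (W.map fun w => if w.2.1 = s then w.1 else 0).sum = 0) →
    (∀ t, (W.map fun w => if w.2.2 = t then w.1 else 0).sum = 0) → ∀ w ∈ W, w.1 = 0

section forest

variable {P : Multiset (ℕ × ℕ)} {s s' t t' : ℕ}

theorem isForest_singleton (s t : ℕ) : IsForest {(s, t)} := by
  intro W hW hs _ w hw
  obtain ⟨w', rfl, hw'⟩ := Multiset.map_eq_singleton.1 hW
  obtain rfl := Multiset.mem_singleton.1 hw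
  have := hs s
  simpa [hw'] using this

theorem IsForest.of_cons {e : ℕ × ℕ} (h : IsForest (e ::ₘ P)) : IsForest P := by
  intro W hW hs ht w hw
  refine h ((0, e) ::ₘ W) (by simp [hW]) (fun r => ?_) (fun r => ?_) w (by simp [hw])
  · simp [hs]
  · simp [ht]

/-- The vertex `s` is new, so the added edge is a pendant edge: balance at `s` kills its weight.
This serves a death read backward, where a new disc is glued in. -/
theorem IsForest.cons (h : IsForest P) (hs : ∀ e ∈ P, e.1 ≠ s) : IsForest ((s, t) ::ₘ P) := by
  intro W hW h₁ h₂
  obtain ⟨w, W, rfl, hWP⟩ := exists_cons_of_map_snd_eq hW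
  have hw : w = 0 := by
    have : (W.map fun w => if w.2.1 = s then w.1 else 0) = W.map fun _ => 0 :=
      Multiset.map_congr rfl fun w hw => if_neg (hs w.2 (by
        rw [← hWP]; exact Multiset.mem_map_of_mem _ hw))
    simpa [this] using h₁ s
  subst hw
  have := h W hWP (fun r => by simpa using h₁ r) (fun r => by simpa using h₂ r)
  simpa using this

/-- Two parallel edges form a cycle, and the weights 1 and -1 on them are balanced. -/
theorem IsForest.ne (h : IsForest ((s, t) ::ₘ (s', t) ::ₘ P)) : s ≠ s' := by
  rintro rfl
  have := h ((1, s, t) ::ₘ (-1, s, t) ::ₘ P.map fun e => (0, e)) (by simp)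
    (fun r => by simp only [Multiset.map_cons, Multiset.map_map, Function.comp_def]; split_ifs <;> simp)
    (fun r => by simp only [Multiset.map_cons, Multiset.map_map, Function.comp_def]; split_ifs <;> simp)
    (1, s, t) (by simp)
  simp at this

theorem sum_map_ite_relabel {α : Type*} (W : Multiset α) (l : α → ℕ) (z : α → ℤ) (h : s ≠ s')
    (r : ℕ) : (W.map fun w => if (if l w = s' then s else l w) = r then z w else 0).sum =
      if r = s then (W.map fun w => if l w = s then z w else 0).sum +
        (W.map fun w => if l w = s' then z w else 0).sum
      else if r = s' then 0 else (W.map fun w => if l w = r then z w else 0).sum := by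
  split_ifs with h₁ h₂
  · subst h₁
    rw [← Multiset.sum_map_add]
    refine congrArg _ (Multiset.map_congr rfl fun w _ => ?_)
    by_cases hw : l w = s'
    · simp [hw, h.symm]
    · simp [hw]
  · subst h₂
    have : (W.map fun w => if (if l w = r then s else l w) = r then z w else 0) =
        W.map fun _ => 0 :=
      Multiset.map_congr rfl fun w _ => by
        by_cases hw : l w = r <;> simp [hw, h]
    simp [this]
  · refine congrArg _ (Multiset.map_congr rfl fun w _ => ?_)
    by_cases hw : l w = s'
    · simp [hw, Ne.symm h₁, Ne.symm h₂]
    · simp [hw]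

/-- Two edges at `t` are contracted to one. A balanced weighting of the new graph lifts to the old
one: the weight of the contracted edge is divided between the two edges so that `s` and `s'` are
balanced separately. -/
theorem IsForest.merge_left (h : IsForest ((s, t) ::ₘ (s', t) ::ₘ P)) :
    IsForest ((s, t) ::ₘ P.map fun e => (if e.1 = s' then s else e.1, e.2)) := by
  have hss := h.ne
  intro W hW h₁ h₂
  obtain ⟨w, W₁, rfl, hW₁⟩ := exists_cons_of_map_snd_eq hW
  obtain ⟨W, hWP, rfl⟩ := exists_map_eq_of_map_snd_eq _ _ _ hW₁
  simp only [Multiset.map_cons, Multiset.sum_cons, Multiset.map_map, Function.comp_def,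
    sum_map_ite_relabel _ _ _ hss] at h₁ h₂
  set a : ℤ := -(W.map fun w => if w.2.1 = s then w.1 else 0).sum with ha
  have key := h ((a, s, t) ::ₘ (w - a, s', t) ::ₘ W) (by simp [hWP]) (fun r => ?_) (fun r => ?_)
  · simp only [Multiset.mem_cons, forall_eq_or_imp] at key
    obtain ⟨ka, kb, kW⟩ := key
    simp only [Multiset.mem_cons, forall_eq_or_imp, Multiset.mem_map, forall_exists_index, and_imp,
      forall_apply_eq_imp_iff₂]
    exact ⟨by linarith, kW⟩
  · have h₃ := h₁ r
    have h₄ := h₁ s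
    simp only [Multiset.map_cons, Multiset.sum_cons]
    by_cases hr : r = s
    · subst hr
      simp [hss.symm, ha]
    · by_cases hr' : r = s'
      · subst hr'
        simp only [hss, if_false, if_true] at h₄ ⊢
        linarith
      · simpa [hr, hr', Ne.symm hr, Ne.symm hr'] using h₃
  · have h₃ := h₂ r
    simp only [Multiset.map_cons, Multiset.sum_cons] at h₃ ⊢
    refine Eq.trans ?_ h₃
    split_ifs <;> ring

/-- Identifying `t'` with `t` and adding the weights of the two edges turns a balanced weighting
into one of the given forest. So all other weights vanish, and then balance at `t` and at `t'` kills
the two remaining ones. -/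
theorem IsForest.split_right (htt : t ≠ t')
    (h : IsForest ((s, t) ::ₘ P.map fun e => (e.1, if e.2 = t' then t else e.2))) :
    IsForest ((s, t) ::ₘ (s, t') ::ₘ P) := by
  intro W hW h₁ h₂
  obtain ⟨a, W₁, rfl, hW₁⟩ := exists_cons_of_map_snd_eq hW
  obtain ⟨b, W, rfl, hWP⟩ := exists_cons_of_map_snd_eq hW₁
  simp only [Multiset.map_cons, Multiset.sum_cons] at h₁ h₂
  have key := h ((a + b, s, t) ::ₘ W.map fun w => (w.1, w.2.1, if w.2.2 = t' then t else w.2.2))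
    (by simp [← hWP, Multiset.map_map]) (fun r => ?_) (fun r => ?_)
  · simp only [Multiset.mem_cons, forall_eq_or_imp, Multiset.mem_map, forall_exists_index, and_imp,
      forall_apply_eq_imp_iff₂] at key ⊢
    have hz : ∀ r, (W.map fun w => if w.2.2 = r then w.1 else 0) = W.map fun _ => 0 := fun r =>
      Multiset.map_congr rfl fun w hw => by simp [key.2 w hw]
    have ha := h₂ t
    have hb := h₂ t'
    simp only [hz, htt, htt.symm, if_true, if_false, Multiset.map_const', Multiset.sum_replicate,
      smul_zero] at ha hb
    exact ⟨by linarith, by linarith, key.2⟩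
  · have := h₁ r
    simp only [Multiset.map_cons, Multiset.sum_cons, Multiset.map_map, Function.comp_def] at this ⊢
    refine Eq.trans ?_ this
    split_ifs <;> ring
  · simp only [Multiset.map_cons, Multiset.sum_cons, Multiset.map_map, Function.comp_def,
      sum_map_ite_relabel _ _ _ htt]
    have h₃ := h₂ r
    have h₄ := h₂ t'
    by_cases hr : r = t
    · subst hr
      simp only [htt, htt.symm, if_true, if_false] at h₃ h₄ ⊢
      linarith
    · by_cases hr' : r = t'
      · simp [hr', htt, htt.symm]
      · simpa [hr, hr', Ne.symm hr, Ne.symm hr'] using h₃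

end forest

/-! ### The Gauss condition along a movie -/

theorem isGauss_perm {C C' : List Circle} (h : C.flatten.Perm C'.flatten) (hC : IsGauss C) :
    IsGauss C' :=
  ⟨h.nodup_iff.1 hC.1, fun p hp => h.mem_iff.1 (hC.2 p (h.mem_iff.2 hp))⟩

theorem isGauss_map_erase {C : List Circle} (S : Finset ℕ) (hC : IsGauss C) :
    IsGauss (C.map (eraseArrows S)) := by
  have : (C.map (eraseArrows S)).flatten = C.flatten.filter fun p => p.1 ∉ S := by
    rw [List.filter_flatten]; rfl
  rw [IsGauss, this]
  refine ⟨hC.1.filter _, fun p hp => ?_⟩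
  rw [List.mem_filter] at hp ⊢
  exact ⟨hC.2 p hp.1, hp.2⟩

theorem swap_mem_iff {l : List Endpoint} {p r s : Endpoint} (hp : p ∈ l) (hr : r ∈ l) :
    Equiv.swap p r s ∈ l ↔ s ∈ l := by
  by_cases h₁ : s = p
  · subst h₁; simp [hp, hr]
  · by_cases h₂ : s = r
    · subst h₂; simp [hp, hr]
    · rw [Equiv.swap_apply_of_ne_of_ne h₁ h₂]

theorem mem_map_iff_of_mem_iff {α : Type*} {l : List α} {φ : Equiv.Perm α}
    (h : ∀ s, φ s ∈ l ↔ s ∈ l) (r : α) : r ∈ l.map φ ↔ r ∈ l := by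
  rw [List.mem_map]
  constructor
  · rintro ⟨s, hs, rfl⟩; exact (h s).2 hs
  · exact fun hr => ⟨φ.symm r, (h _).1 (by simpa using hr), by simp⟩

theorem isGauss_map_exchange {C : List Circle} {p₁ q₁ p₂ q₂ p₃ q₃ : Endpoint}
    (h : ∀ r ∈ [p₁, q₁, p₂, q₂, p₃, q₃], r ∈ C.flatten) (hC : IsGauss C) :
    IsGauss (C.map (exchange p₁ q₁ p₂ q₂ p₃ q₃)) := by
  have : (C.map (exchange p₁ q₁ p₂ q₂ p₃ q₃)).flatten =
      C.flatten.map (Equiv.swap p₃ q₃ |>.trans (Equiv.swap p₂ q₂) |>.trans (Equiv.swap p₁ q₁)) := by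
    rw [List.map_flatten]; rfl
  simp only [List.forall_mem_cons] at h
  have hm : ∀ r, r ∈ C.flatten.map
      (Equiv.swap p₃ q₃ |>.trans (Equiv.swap p₂ q₂) |>.trans (Equiv.swap p₁ q₁)) ↔
      r ∈ C.flatten := by
    refine mem_map_iff_of_mem_iff fun r => ?_
    simp only [Equiv.trans_apply]
    rw [swap_mem_iff, swap_mem_iff, swap_mem_iff] <;> tauto
  rw [IsGauss, this]
  refine ⟨hC.1.map (Equiv.injective _), fun p hp => ?_⟩
  rw [hm] at hp ⊢
  exact hC.2 p hp

theorem Follows.mem {C : List Circle} {p r : Endpoint} (h : Follows C p r) :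
    p ∈ C.flatten ∧ r ∈ C.flatten := by
  obtain ⟨c, hc, u, hu⟩ := h
  exact ⟨List.mem_flatten.2 ⟨c, hc, hu.mem_iff.2 (by simp)⟩,
    List.mem_flatten.2 ⟨c, hc, hu.mem_iff.2 (by simp)⟩⟩

theorem FlatMove.isGauss {C : List Circle} {g : Circle → Circle} (h : FlatMove C g)
    (hC : IsGauss C) : IsGauss (C.map g) := by
  cases h with
  | rename π =>
    have : (C.map (List.map fun p : Endpoint => (π p.1, p.2))).flatten =
        C.flatten.map fun p => (π p.1, p.2) := by
      rw [List.map_flatten]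
    rw [IsGauss, this]
    refine ⟨hC.1.map fun p r h => ?_, fun p hp => ?_⟩
    · simpa [Prod.ext_iff] using h
    · obtain ⟨r, hr, rfl⟩ := List.mem_map.1 hp
      exact List.mem_map.2 ⟨_, hC.2 r hr, rfl⟩
  | fr1 | fr2_parallel | fr2_opposite => exact isGauss_map_erase _ hC
  | fr3_transitive a b c _ _ _ h₁ h₂ h₃ =>
    exact isGauss_map_exchange (by simpa only [List.forall_mem_cons] using
      ⟨h₁.mem.1, h₁.mem.2, h₂.mem.1, h₂.mem.2, h₃.mem.1, h₃.mem.2, by simp⟩) hC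
  | fr3_cyclic a b c _ _ _ h₁ h₂ h₃ =>
    exact isGauss_map_exchange (by simpa only [List.forall_mem_cons] using
      ⟨h₁.mem.1, h₁.mem.2, h₂.mem.1, h₂.mem.2, h₃.mem.1, h₃.mem.2, by simp⟩) hC

theorem Frame.Step.isGauss {F F' : Frame} (h : Frame.Step F F')
    (hF : IsGauss (F.circles.map Prod.snd)) : IsGauss (F'.circles.map Prod.snd) := by
  cases h with
  | reorder h => exact isGauss_perm (h.map _).flatten hF
  | rotate h => exact isGauss_perm (by simpa using h.perm.append_right _) hF
  | move h => simpa [Function.comp_def] using h.isGauss hF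
  | move_back hL h => exact hL
  | birth => simpa [IsGauss] using hF
  | death => simpa [IsGauss] using hF
  | split => simpa [IsGauss] using hF
  | join_same => simpa [IsGauss] using hF
  | join_different => simpa [IsGauss, Function.comp_def] using hF

/-! ### Fillings carried backward along a movie -/

/-- The frame with the given circles bounds a planar filling whose flows have the property `q`, and
which together with the surface swept out so far has genus zero. -/
def HasFilling (q : (Fin 4 → Fin 4 → ℤ) → Prop) (C : List (ℕ × Circle)) : Prop :=
  ∃ K : Multiset (ℕ × ℕ × Circle), K.map Prod.snd = C ∧
    IsForest (K.map fun k => (k.1, k.2.1)) ∧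
    ∃ f L, SurfaceKernel q (K.map fun k => (k.1, k.2.2)) f L

theorem hasFilling_nil (hq : q 0) (t : ℕ) : HasFilling q [(t, [])] :=
  ⟨{(0, t, [])}, rfl, isForest_singleton 0 t, id, ⊤, surfaceKernel_nil 0 hq⟩

theorem gaussFamily_of_map_snd {K : Multiset (ℕ × ℕ × Circle)} {C : List (ℕ × Circle)}
    (hC : IsGauss (C.map Prod.snd)) (hK : K.map Prod.snd = C) :
    GaussFamily (K.map fun k => (k.1, k.2.2)) :=
  gaussFamily_of_isGauss hC (by
    rw [← Multiset.map_coe, ← hK, Multiset.map_map]; rfl)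

/-- Twice the genus of the surface swept out so far, plus one. -/
def Frame.genusCount (F : Frame) : ℤ :=
  2 * F.components - F.circles.length - F.extrema + F.saddles

/-- Every step preserves the count except a saddle joining two circles of the same component, which
adds a handle and raises it by 2. -/
theorem Frame.Step.genusCount_le {F F' : Frame} (h : Frame.Step F F') :
    F.genusCount ≤ F'.genusCount := by
  cases h with
  | reorder h => simp [Frame.genusCount, h.length_eq]
  | _ => simp [Frame.genusCount] <;> linarith

/-- The elementary step of the backward induction. The forest condition has to be carried along
because it guarantees that a reversed split meets two different planar components. -/
theorem Frame.Step.hasFilling {F F' : Frame} (h : Frame.Step F F')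
    (hF : IsGauss (F.circles.map Prod.snd)) (hg : F.genusCount = F'.genusCount)
    (h' : HasFilling q F'.circles) : HasFilling q F.circles := by
  obtain ⟨K', hK', hP, f, H, hH⟩ := h'
  cases h with
  | reorder h => exact ⟨K', hK'.trans (Multiset.coe_eq_coe.2 h.symm), hP, f, H, hH⟩
  | @rotate L s e k t c c' h =>
    simp only [← Multiset.cons_coe] at hK'
    obtain ⟨l, K, rfl, hK⟩ := exists_cons_of_map_snd_eq hK'
    refine ⟨(l, t, c) ::ₘ K, by simp [hK], by simpa using hP, f, H, ?_⟩
    simp only [Multiset.map_cons] at hH ⊢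
    exact hH.rotate h
  | @move L s e k g h =>
    obtain ⟨K, hK, rfl⟩ := exists_map_eq_of_map_snd_eq K' (L : Multiset (ℕ × Circle))
      (fun c => (c.1, g c.2)) (by rw [hK']; rfl)
    refine ⟨K, hK, by simpa [Multiset.map_map] using hP, ?_⟩
    refine (surfaceKernel_move_iff (gaussFamily_of_map_snd hF hK) ?_ h).1 ⟨f, H, ?_⟩
    · rw [← Multiset.map_coe, ← hK, Multiset.map_map, Multiset.map_map]; rfl
    · simpa [mapCircles, Multiset.map_map] using hH
  | @move_back L s e k g hL h =>
    refine ⟨K'.map fun k => (k.1, k.2.1, g k.2.2), ?_, ?_, ?_⟩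
    · rw [← Multiset.map_coe, ← hK', Multiset.map_map, Multiset.map_map]; rfl
    · simpa [Multiset.map_map] using hP
    · have := (surfaceKernel_move_iff (q := q) (gaussFamily_of_map_snd hL hK') ?_ h).2 ⟨f, H, hH⟩
      · simpa [mapCircles, Multiset.map_map] using this
      · rw [← Multiset.map_coe, ← hK', Multiset.map_map, Multiset.map_map]; rfl
  | birth ht =>
    simp only [← Multiset.cons_coe] at hK'
    obtain ⟨l, K, rfl, hK⟩ := exists_cons_of_map_snd_eq hK'
    refine ⟨K, hK, ?_, f, H, ?_⟩
    · rw [Multiset.map_cons] at hP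
      exact hP.of_cons
    · simp only [Multiset.map_cons] at hH
      exact surfaceKernel_cons_nil.1 hH
  | @death L s e k t =>
    -- Before a death there is one more circle. It is filled by a disc, a new component with an
    -- unused label.
    obtain ⟨l, hl⟩ := Infinite.exists_notMem_finset (K'.map Prod.fst).toFinset
    refine ⟨(l, t, []) ::ₘ K', by simp [hK'], ?_, f, H, ?_⟩
    · rw [Multiset.map_cons]
      refine hP.cons fun e he hel => hl ?_
      obtain ⟨k, hk, rfl⟩ := Multiset.mem_map.1 he
      exact Multiset.mem_toFinset.2 (Multiset.mem_map.2 ⟨k, hk, hel⟩)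
    · simp only [Multiset.map_cons]
      exact surfaceKernel_cons_nil.2 hH
  | @split L s e k t u v =>
    simp only [← Multiset.cons_coe] at hK'
    obtain ⟨l, K₁, rfl, hK₁⟩ := exists_cons_of_map_snd_eq hK'
    obtain ⟨l', K, rfl, hK⟩ := exists_cons_of_map_snd_eq hK₁
    simp only [Multiset.map_cons] at hP hH
    refine ⟨(l, t, u ++ v) ::ₘ K.map fun k => (if k.1 = l' then l else k.1, k.2), ?_, ?_,
      f, H ⊓ closedOn (u ++ v), ?_⟩
    · rw [← Multiset.cons_coe, ← hK, Multiset.map_cons, Multiset.map_map]; rfl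
    · simpa [Multiset.map_map, Function.comp_def] using hP.merge_left
    · simpa [Multiset.map_map, Function.comp_def] using hH.split hP.ne
  -- This saddle would raise the genus count, against `hg`.
  | join_same => simp [Frame.genusCount] at hg; linarith
  | @join_different L s e k t t' u v h =>
    simp only [← Multiset.cons_coe] at hK'
    obtain ⟨l, K₁, rfl, hK₁⟩ := exists_cons_of_map_snd_eq hK'
    obtain ⟨K, hK, rfl⟩ := exists_map_eq_of_map_snd_eq K₁ (L : Multiset (ℕ × Circle))
      (fun c => (if c.1 = t' then t else c.1, c.2)) (by rw [hK₁]; rfl)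
    refine ⟨(l, t, u) ::ₘ (l, t', v) ::ₘ K, by simp [hK], ?_, f,
      H ⊓ (closedOn u ⊓ closedOn v), ?_⟩
    · simp only [Multiset.map_cons, Multiset.map_map, Function.comp_def] at hP ⊢
      refine IsForest.split_right h ?_
      simpa [Multiset.map_map, Function.comp_def] using hP
    · simp only [Multiset.map_cons, Multiset.map_map, Function.comp_def] at hH ⊢
      exact hH.join

theorem hasFilling_of_movie {F F' : Frame} (h : Relation.ReflTransGen Frame.Step F F') :
    F.genusCount ≤ F'.genusCount ∧ (IsGauss (F.circles.map Prod.snd) →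
      F.genusCount = F'.genusCount → HasFilling q F'.circles → HasFilling q F.circles) := by
  induction h using Relation.ReflTransGen.head_induction_on with
  | refl => exact ⟨le_rfl, fun _ _ h => h⟩
  | head hs _ ih =>
    refine ⟨hs.genusCount_le.trans ih.1, fun hG hg h => ?_⟩
    have h₁ := hs.genusCount_le
    exact hs.hasFilling hG (by linarith [ih.1]) (ih.2 (hs.isGauss hG) (by linarith [ih.1]) h)

/-- The circle of the knot diagram `D` has a filling by a planar surface whose flows have the
property `q`. -/
def KnotDiagram.HasDiscFilling (q : (Fin 4 → Fin 4 → ℤ) → Prop) (D : KnotDiagram) : Prop :=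
  ∃ s f L, SurfaceKernel q {(s, D.word)} f L

theorem KnotDiagram.hasDiscFilling_of_movie {D : KnotDiagram} {t n : ℕ} (hq : q 0)
    (h : Relation.ReflTransGen Frame.Step ⟨[(0, D.word)], 0, 0, 1⟩ ⟨[(t, [])], n, n, 1⟩) :
    D.HasDiscFilling q := by
  -- The genus count is 1 for both end frames: one component, one circle, and as many saddles as
  -- extrema.
  obtain ⟨K, hK, -, f, L, hL⟩ := (hasFilling_of_movie (q := q) h).2 (by simpa using D.isGauss)
    (by simp [Frame.genusCount]) (hasFilling_nil hq t)
  obtain ⟨k, rfl, hk⟩ := Multiset.map_eq_singleton.1 (hK.trans (Multiset.coe_singleton _))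
  refine ⟨k.1, f, L, ?_⟩
  simpa [hk] using hL

theorem KnotDiagram.gaussFamily (D : KnotDiagram) (s : ℕ) : GaussFamily {(s, D.word)} :=
  gaussFamily_of_isGauss (K := {(s, (), D.word)}) D.isGauss rfl

theorem KnotDiagram.Step.hasDiscFilling_iff {D E : KnotDiagram} (h : D.Step E) :
    D.HasDiscFilling q ↔ E.HasDiscFilling q := by
  rcases h with h | ⟨g, hg, hE⟩
  · exact ⟨fun ⟨s, f, L, h'⟩ => ⟨s, f, L, SurfaceKernel.rotate (R := 0) h.symm h'⟩,
      fun ⟨s, f, L, h'⟩ => ⟨s, f, L, SurfaceKernel.rotate (R := 0) h h'⟩⟩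
  · refine exists_congr fun s => ?_
    rw [← surfaceKernel_move_iff (D.gaussFamily s) rfl hg, hE]
    simp [mapCircles]

/-- Used for both choices of `q`: it transfers the obstruction as well as the existence of a filling
of small rank to all diagrams of the flat knot. -/
theorem KnotDiagram.hasDiscFilling_congr {D E : KnotDiagram} (h : D.toFlatKnot = E.toFlatKnot) :
    D.HasDiscFilling q ↔ E.HasDiscFilling q := by
  have h' := Quot.eqvGen_exact h
  clear h
  induction h' with
  | rel _ _ h => exact KnotDiagram.Step.hasDiscFilling_iff h
  | refl => rfl
  | symm _ _ _ ih => exact ih.symm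
  | trans _ _ _ _ _ ih₁ ih₂ => exact ih₁.trans ih₂

end FlatKnots

namespace FlatKnots

/-! ### The loops of a knot diagram -/

/-- The increments of the product of two flows telescope. Around a closed circle they add up to
zero, which is the source of the antisymmetry of the form. -/
theorem Flow.sum_mul {x y : EdgeChain} {c : Circle} {α β α' β' : ℤ} (hx : Flow x α c β)
    (hy : Flow y α' c β') :
    (c.map fun p => x.out p * y.out p - x.1 p * y.1 p).sum = β * β' - α * α' := by
  induction c generalizing α α' with
  | nil => rw [show β = α from Eq.symm hx, show β' = α' from Eq.symm hy]; simp
  | cons p c ih =>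
    rw [List.map_cons, List.sum_cons, ih hx.2 hy.2, hx.1, hy.1]; ring

namespace KnotDiagram

variable (D : KnotDiagram)

theorem word_nodup : D.word.Nodup := by simpa using D.isGauss.1

theorem mem_word_not {a : ℕ} {t : Bool} (h : (a, t) ∈ D.word) : (a, !t) ∈ D.word := by
  simpa using D.isGauss.2 (a, t) (by simpa using h)

variable {D}

theorem mem_arrows_iff {a : ℕ} : a ∈ D.arrows ↔ ∃ t, (a, t) ∈ D.word := by
  simp [arrows]

theorem mem_word_iff {p : Endpoint} : p ∈ D.word ↔ p.1 ∈ D.arrows := by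
  rw [mem_arrows_iff]
  refine ⟨fun h => ⟨p.2, h⟩, fun ⟨t, h⟩ => ?_⟩
  by_cases ht : t = p.2
  · rwa [ht] at h
  · have := D.mem_word_not h
    rwa [show (!t) = p.2 by cases t <;> cases h' : p.2 <;> simp_all] at this

theorem arrowsOf_word (s : ℕ) : arrowsOf {(s, D.word)} = D.arrows := by
  ext a; simp [mem_arrowsOf, mem_arrows_iff]

theorem sum_word (F : Endpoint → ℤ) :
    (D.word.map F).sum = ∑ a ∈ D.arrows, (F (a, true) + F (a, false)) := by
  have h : D.word.toFinset = D.arrows ×ˢ (Finset.univ : Finset Bool) := by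
    ext p; simp [mem_word_iff]
  rw [← List.sum_toFinset _ D.word_nodup, h, Finset.sum_product]
  simp

theorem charge_word (n : ℕ → ℤ) : charge n D.word = 0 := by
  rw [charge, sum_word]
  simp

/-- At each arrow, the terms of `form x y` and `form y x` add up to minus the increments of the
product of the flows at its two endpoints, and these increments sum to zero around the circle. -/
theorem form_swap {x y : EdgeChain} (hx : Closed x D.word) (hy : Closed y D.word) :
    form D.arrows y x = -form D.arrows x y := by
  obtain ⟨α, hα⟩ := hx
  obtain ⟨β, hβ⟩ := hy
  have h := hα.sum_mul hβ
  rw [sum_word, sub_self] at h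
  rw [eq_neg_iff_add_eq_zero, ← neg_eq_zero, ← h, form, form, ← Finset.sum_add_distrib,
    ← Finset.sum_neg_distrib]
  refine Finset.sum_congr rfl fun a _ => ?_
  simp only [EdgeChain.out, sgn_true, sgn_false]
  ring

theorem exists_isRotated_arc {a : ℕ} (ha : a ∈ D.arrows) :
    ∃ v, D.word.IsRotated ((a, true) :: (D.arc a ++ (a, false) :: v)) := by
  have hT : (a, true) ∈ D.word := mem_word_iff.2 ha
  have hF : (a, false) ∈ D.word := mem_word_iff.2 ha
  obtain ⟨w, hw⟩ : ∃ w, D.word.rotate (D.word.idxOf (a, true)) = (a, true) :: w := by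
    have hlt := List.idxOf_lt_length_iff.2 hT
    rw [List.rotate_eq_drop_append_take hlt.le, List.drop_eq_getElem_cons hlt, List.getElem_idxOf]
    exact ⟨_, rfl⟩
  have hr : D.word.IsRotated ((a, true) :: w) := ⟨_, hw⟩
  have harc : D.arc a = w.takeWhile fun p => p ≠ (a, false) := by rw [arc, hw]; rfl
  have hFw : (a, false) ∈ w := by simpa using hr.mem_iff.1 hF
  have hd : ∃ v, w.dropWhile (fun p => decide (p ≠ (a, false))) = (a, false) :: v := by
    cases h : w.dropWhile (fun p => decide (p ≠ (a, false))) with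
    | nil =>
      rw [List.dropWhile_eq_nil_iff] at h
      simpa using h _ hFw
    | cons p v =>
      have := List.head_dropWhile_not (fun p => decide (p ≠ (a, false))) (l := w)
        (by rw [h]; simp)
      simp only [h, List.head_cons] at this
      exact ⟨v, by simpa using this⟩
  obtain ⟨v, hv⟩ := hd
  refine ⟨v, ?_⟩
  rw [harc, ← hv, List.takeWhile_append_dropWhile]
  exact hr

variable (D)

/-- The classes of the whole curve, `none`, and of the loop `a⁺`, `some a`, as flows. -/
def loop : Option ℕ → EdgeChain
  | none => (1, 0)
  | some a => (fun p => if p = (a, false) ∨ p ∈ D.arc a then 1 else 0, Pi.single a 1)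

variable {D}

theorem nodup_arc {a : ℕ} (ha : a ∈ D.arrows) :
    ((a, true) ∉ D.arc a ∧ (a, false) ∉ D.arc a) ∧ ∀ p ∈ D.arc a, p.1 ≠ a := by
  obtain ⟨v, hv⟩ := exists_isRotated_arc ha
  have hn := hv.nodup_iff.1 D.word_nodup
  have h : (a, true) ∉ D.arc a ∧ (a, false) ∉ D.arc a := by
    rw [List.nodup_cons, List.mem_append, List.nodup_append] at hn
    exact ⟨fun h => hn.1 (Or.inl h), fun h => hn.2.2.2 _ h (a, false) (by simp) rfl⟩
  refine ⟨h, fun p hp hpa => ?_⟩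
  obtain ⟨b, t⟩ := p
  obtain rfl : b = a := hpa
  cases t
  · exact h.2 hp
  · exact h.1 hp

theorem closed_loop_none : Closed (D.loop none) D.word := ⟨1, flow_const (fun _ _ => rfl) rfl⟩

theorem loop_fst_tail {a : ℕ} (ha : a ∈ D.arrows) : (D.loop (some a)).1 (a, true) = 0 := by
  simp [loop, (nodup_arc ha).1.1]

theorem closed_loop_some {a : ℕ} (ha : a ∈ D.arrows) : Closed (D.loop (some a)) D.word := by
  obtain ⟨v, hv⟩ := exists_isRotated_arc ha
  refine Closed.rotate ?_ hv.symm
  have hn := hv.nodup_iff.1 D.word_nodup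
  rw [List.nodup_cons, List.mem_append, List.nodup_append, List.nodup_cons, List.mem_cons] at hn
  obtain ⟨hn₁, hn₂, ⟨hn₃, hn₄⟩, hn₅⟩ := hn
  have hva : ∀ p ∈ v, p.1 ≠ a := by
    rintro ⟨b, t⟩ hp hpa
    obtain rfl : b = a := hpa
    cases t
    · exact hn₃ hp
    · exact hn₁ (by simp [hp])
  have h₁ : (D.loop (some a)).out (a, true) = 1 := by
    rw [EdgeChain.out, loop_fst_tail ha]; simp [loop]
  have h₂ : (D.loop (some a)).out (a, false) = 0 := by
    simp [EdgeChain.out, loop]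
  refine ⟨0, loop_fst_tail ha, flow_append.2 ⟨1, ?_, by simp [loop], ?_⟩⟩
  · rw [h₁]
    refine flow_of_forall_eq (fun p hp => by simp [loop, hp]) fun p hp => ?_
    simp [loop, (nodup_arc ha).2 p hp]
  · rw [h₂]
    refine flow_of_forall_eq (fun p hp => ?_) fun p hp => ?_
    · have h₁ : p ≠ (a, false) := fun h => hva p hp (by rw [h])
      have h₂ : p ∉ D.arc a := fun h => hn₅ p h p (by simp [hp]) rfl
      simp [loop, h₁, h₂]
    · simp [loop, hva p hp]

theorem closed_loop (x : Option D.Arrow) : Closed (D.loop (x.map Subtype.val)) D.word := by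
  cases x with
  | none => exact closed_loop_none
  | some a => exact closed_loop_some a.2

theorem incoming_eq (x : Option D.Arrow) (p : Endpoint) :
    D.incoming x p = (D.loop (x.map Subtype.val)).1 p := by
  cases x <;> rfl

theorem outgoing_eq (x : Option D.Arrow) (p : Endpoint) :
    D.outgoing x p = (D.loop (x.map Subtype.val)).out p := by
  cases x with
  | none => simp [outgoing, loop, EdgeChain.out]
  | some a =>
    obtain ⟨a, ha⟩ := a
    obtain ⟨⟨h₁, h₂⟩, h₃⟩ := nodup_arc ha
    obtain ⟨b, t⟩ := p
    by_cases hb : b = a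
    · subst hb
      cases t
      · simp [outgoing, loop, EdgeChain.out, h₂]
      · simp [outgoing, loop, EdgeChain.out, h₁]
    · simp [outgoing, loop, EdgeChain.out, hb]

theorem basedMatrix_eq_form (x y : Option D.Arrow) :
    D.basedMatrix x y = form D.arrows (D.loop (x.map Subtype.val)) (D.loop (y.map Subtype.val)) := by
  simp only [basedMatrix, form, outgoing_eq, incoming_eq]

/-- Two flows agree on the edges of the diagram. -/
def Agree (D : KnotDiagram) (x y : EdgeChain) : Prop :=
  (∀ p ∈ D.word, x.1 p = y.1 p) ∧ ∀ a ∈ D.arrows, x.2 a = y.2 a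

theorem Agree.form {x x' y y' : EdgeChain} (hx : D.Agree x x') (hy : D.Agree y y') :
    form D.arrows x y = form D.arrows x' y' :=
  form_congr (fun _ ha _ => hx.1 _ (mem_word_iff.2 ha)) hx.2
    (fun _ ha _ => hy.1 _ (mem_word_iff.2 ha)) hy.2

/-- The difference of the two flows never grows, hence is constant along the circle. -/
theorem exists_agree_of_snd_eq {x y : EdgeChain} (hx : Closed x D.word) (hy : Closed y D.word)
    (h : ∀ a ∈ D.arrows, x.2 a = y.2 a) : ∃ k : ℤ, D.Agree x (k • D.loop none + y) := by
  obtain ⟨k, hk⟩ := hx.add hy.neg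
  refine ⟨k, fun p hp => ?_, fun a ha => by simp [h a ha, loop]⟩
  have := hk.eq_const (fun p hp => by simp [h p.1 (mem_word_iff.1 hp)]) p hp
  simp only [loop, Prod.fst_add, Pi.add_apply, Prod.fst_neg, Pi.neg_apply, Prod.smul_fst,
    Pi.smul_apply, Pi.one_apply, smul_eq_mul, mul_one] at this ⊢
  linarith

theorem closed_sum {ι : Type*} {S : Finset ι} {z : ι → EdgeChain} {c : Circle}
    (h : ∀ i ∈ S, Closed (z i) c) (m : ι → ℤ) : Closed (∑ i ∈ S, m i • z i) c :=
  (closedOn c).sum_mem fun i hi => (closedOn c).zsmul_mem (h i hi) (m i)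

/-- A closed flow is determined by its growth at the arrows up to a multiple of the whole curve. -/
theorem exists_agree_sum {x : EdgeChain} (hx : Closed x D.word) :
    ∃ k : ℤ, D.Agree x (k • D.loop none + ∑ a : D.Arrow, x.2 a • D.loop (some a)) := by
  refine exists_agree_of_snd_eq hx (closed_sum (fun a _ => closed_loop_some a.2) _) fun a ha => ?_
  rw [Prod.snd_sum, Finset.sum_apply, Finset.sum_eq_single ⟨a, ha⟩]
  · simp [loop]
  · intro b _ hb
    have : a ≠ b.1 := fun h => hb (Subtype.ext h.symm)
    simp [loop, this]
  · simp

/-- The growth fixes the flow up to a multiple of the whole curve, and the vanishing on the edge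
that arrives at the tail of `a` fixes the multiple. -/
theorem agree_loop {x : EdgeChain} {a : ℕ} (ha : a ∈ D.arrows) (hx : Closed x D.word)
    (hn : ∀ c ∈ D.arrows, x.2 c = if c = a then 1 else 0) (hx0 : x.1 (a, true) = 0) :
    D.Agree x (D.loop (some a)) := by
  obtain ⟨k, hk⟩ := exists_agree_of_snd_eq hx (closed_loop_some ha) fun c hc => by
    simp [hn c hc, loop, Pi.single_apply]
  have hk0 : k = 0 := by
    have := hk.1 (a, true) (mem_word_iff.2 ha)
    rw [hx0, Prod.fst_add, Pi.add_apply, loop_fst_tail ha] at this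
    simpa [loop] using this.symm
  simpa [hk0] using hk

/-- The matrix of the diagram, indexed by all labels. -/
def labelMatrix (D : KnotDiagram) (x y : Option ℕ) : ℤ := form D.arrows (D.loop x) (D.loop y)

/-- Pairing with s counts the tails on `a⁺` minus the heads. The endpoints of `a` itself are counted
too, once as a tail and once as a head, and cancel. -/
theorem index_eq_basedMatrix (a : D.Arrow) : D.index a = D.basedMatrix (some a) none := by
  obtain ⟨a, ha⟩ := a
  have hsub : ∀ p ∈ D.arc a, p ∈ D.word := by
    obtain ⟨v, hv⟩ := exists_isRotated_arc ha
    intro p hp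
    rw [hv.mem_iff]; simp [hp]
  have hnd : (D.arc a).Nodup := by
    obtain ⟨v, hv⟩ := exists_isRotated_arc ha
    have hn := hv.nodup_iff.1 D.word_nodup
    rw [List.nodup_cons, List.nodup_append] at hn
    exact hn.2.1
  have hcount : ∀ t : Bool, ((D.arc a).countP fun p => p.2 = t : ℕ) =
      (D.arrows.filter fun c => (c, t) ∈ D.arc a).card := by
    intro t
    rw [List.countP_eq_length_filter, ← List.toFinset_card_of_nodup (hnd.filter _)]
    symm
    refine Finset.card_bij (fun c _ => (c, t)) ?_ ?_ ?_
    · intro c hc; simpa using (Finset.mem_filter.1 hc).2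
    · intro c _ c' _ h; exact (Prod.ext_iff.1 h).1
    · rintro ⟨c, s⟩ h
      simp only [List.mem_toFinset, List.mem_filter, decide_eq_true_eq] at h
      obtain ⟨h, rfl⟩ := h
      exact ⟨c, Finset.mem_filter.2 ⟨mem_word_iff.1 (hsub _ h), h⟩, rfl⟩
  have key : ∀ (t : Bool), ∑ c ∈ D.arrows, (if (c, t) = (a, t) ∨ (c, t) ∈ D.arc a then 1 else 0) =
      (1 : ℤ) + (D.arrows.filter fun c => (c, t) ∈ D.arc a).card := by
    intro t
    have hat : (a, t) ∉ D.arc a := by cases t; exacts [(nodup_arc ha).1.2, (nodup_arc ha).1.1]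
    have : ∀ c ∈ D.arrows, (if (c, t) = (a, t) ∨ (c, t) ∈ D.arc a then (1 : ℤ) else 0) =
        (if c = a then 1 else 0) + if (c, t) ∈ D.arc a then 1 else 0 := by
      intro c _
      by_cases hc : c = a
      · subst hc; simp [hat]
      · simp [hc]
    rw [Finset.sum_congr rfl this, Finset.sum_add_distrib, Finset.sum_ite_eq', if_pos ha,
      Finset.sum_boole]
  rw [index, hcount, hcount, basedMatrix]
  simp only [outgoing, incoming, mul_one, Finset.sum_sub_distrib]
  rw [key true, key false]
  ring

end KnotDiagram

end FlatKnots

namespace FlatKnots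

/-! ### Ranks of alternating integer matrices -/

section rank

variable {ι : Type*} [Fintype ι] {N : Matrix ι ι ℤ}

/-- The diagonal vanishes, so a nonzero entry at `(i, j)` makes the columns `i` and `j` linearly
independent. -/
theorem eq_zero_of_rank_le_one (hN : ∀ i j, N j i = -N i j) (hr : N.rank ≤ 1) : N = 0 := by
  by_contra h
  obtain ⟨i, j, hij⟩ : ∃ i j, N i j ≠ 0 := by
    by_contra! h'
    exact h (Matrix.ext h')
  have hd : ∀ k, N k k = 0 := fun k => by linarith [hN k k]
  have hli : LinearIndependent ℤ ![N.col i, N.col j] := by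
    rw [LinearIndependent.pair_iff]
    intro s t hst
    have h₁ := congrFun hst i
    have h₂ := congrFun hst j
    simp only [Pi.add_apply, Pi.smul_apply, Matrix.col_apply, smul_eq_mul, hd, Pi.zero_apply,
      mul_zero, zero_add, add_zero, mul_eq_zero, hij, or_false] at h₁ h₂
    have hji : N j i ≠ 0 := by rw [hN]; exact neg_ne_zero.2 hij
    exact ⟨h₂.resolve_right hji, h₁⟩
  have h₁ := finrank_span_eq_card hli
  have h₂ : Submodule.span ℤ (Set.range ![N.col i, N.col j]) ≤
      Submodule.span ℤ (Set.range N.col) := by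
    refine Submodule.span_mono ?_
    rintro _ ⟨k, rfl⟩
    fin_cases k
    exacts [⟨i, rfl⟩, ⟨j, rfl⟩]
  have h₃ := Submodule.finrank_mono h₂
  rw [h₁, ← Matrix.rank_eq_finrank_span_cols, Fintype.card_fin] at h₃
  omega

theorem rank_smul_of_ne_zero {d : ℤ} (hd : d ≠ 0) (N : Matrix ι ι ℤ) : (d • N).rank = N.rank := by
  have h : (d • N).mulVecLin = (LinearMap.lsmul ℤ (ι → ℤ) d).comp N.mulVecLin := by
    ext; simp
  rw [Matrix.rank, h, LinearMap.range_comp]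
  refine (LinearEquiv.finrank_eq (Submodule.equivMapOfInjective _ ?_ _)).symm
  intro x y hxy
  exact smul_right_injective _ hd hxy

/-- With a nonzero entry `N i j`, the Pfaffian relation writes each `N i j * N k l` through the rows
`i` and `j`. Thus a nonzero multiple of `N` factors through a rank two module. -/
theorem rank_le_two
    (hp : ∀ i j k l, N i j * N k l - N i k * N j l + N i l * N j k = 0) : N.rank ≤ 2 := by
  by_cases h : N = 0
  · simp [h]
  obtain ⟨i, j, hij⟩ : ∃ i j, N i j ≠ 0 := by
    by_contra! h'
    exact h (Matrix.ext h')
  rw [← rank_smul_of_ne_zero hij N]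
  have : N i j • N = (Matrix.of fun k => ![N i k, -N j k]) * Matrix.of ![N j, N i] := by
    ext k l
    simp only [Matrix.smul_apply, smul_eq_mul, Matrix.mul_apply, Fin.sum_univ_two, Matrix.of_apply,
      Matrix.cons_val_zero, Matrix.cons_val_one]
    linarith [hp i j k l]
  rw [this]
  exact (Matrix.rank_mul_le_left _ _).trans ((Matrix.rank_le_card_width _).trans (by simp))

end rank

/-! ### Fillings and involutions -/

section filling

variable {G : Type} [Fintype G] [DecidableEq G]

theorem exists_filling_of_involutive {f : G → G} (hf : ∀ a, f (f a) = a) :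
    ∃ P : Finpartition (Finset.univ : Finset G), IsFilling P ∧ ∀ X ∈ P.parts, ∃ a, X = {a, f a} := by
  let s : Setoid G := ⟨fun a b => b = a ∨ b = f a, fun a => Or.inl rfl, by
      rintro a b (rfl | rfl)
      exacts [Or.inl rfl, Or.inr (hf _).symm], by
      rintro a b c (rfl | rfl) (rfl | rfl)
      exacts [Or.inl rfl, Or.inr rfl, Or.inr rfl, Or.inl (hf _)]⟩
  have : DecidableRel s.r := fun a b => inferInstanceAs (Decidable (b = a ∨ b = f a))
  have key : ∀ X ∈ (Finpartition.ofSetoid s).parts, ∃ a, X = {a, f a} := by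
    intro X hX
    obtain ⟨a, ha⟩ := Finpartition.nonempty_of_mem_parts _ hX
    refine ⟨a, ?_⟩
    rw [← (Finpartition.ofSetoid s).part_eq_of_mem hX ha]
    ext b
    rw [Finpartition.mem_part_ofSetoid_iff_rel, Finset.mem_insert, Finset.mem_singleton]
    rfl
  refine ⟨Finpartition.ofSetoid s, fun X hX => ?_, key⟩
  obtain ⟨a, rfl⟩ := key X hX
  by_cases h : a = f a
  · left; rw [← h]; simp
  · right; exact Finset.card_pair h

theorem exists_involutive_of_filling {P : Finpartition (Finset.univ : Finset G)}
    (hP : IsFilling P) :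
    ∃ f : G → G, (∀ a, f (f a) = a) ∧ ∀ X ∈ P.parts, ∀ a ∈ X, ∀ b ∈ X, b = a ∨ b = f a := by
  classical
  let f : G → G := fun a => if h : ∃ b ∈ P.part a, b ≠ a then h.choose else a
  have hcard : ∀ X ∈ P.parts, ∀ a ∈ X, ∀ b ∈ X, ∀ c ∈ X, b ≠ a → c ≠ a → b = c := by
    intro X hX a ha b hb c hc hba hca
    by_contra hbc
    have h₁ : ({a, b, c} : Finset G) ⊆ X := by
      simp [Finset.insert_subset_iff, ha, hb, hc]
    have h₂ := Finset.card_le_card h₁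
    rw [Finset.card_eq_three.2 ⟨a, b, c, hba.symm, hca.symm, hbc, rfl⟩] at h₂
    rcases hP X hX with h | h <;> omega
  have hf : ∀ X ∈ P.parts, ∀ a ∈ X, f a ∈ X ∧ ∀ b ∈ X, b = a ∨ b = f a := by
    intro X hX a ha
    have hpart := P.part_eq_of_mem hX ha
    by_cases h : ∃ b ∈ P.part a, b ≠ a
    · have h₁ : f a = h.choose := dif_pos h
      have h₂ := h.choose_spec
      rw [← h₁, hpart] at h₂
      refine ⟨h₂.1, fun b hb => ?_⟩
      by_cases hba : b = a
      · exact Or.inl hba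
      · exact Or.inr (hcard X hX a ha b hb _ h₂.1 hba h₂.2)
    · have h₁ : f a = a := dif_neg h
      refine ⟨h₁.symm ▸ ha, fun b hb => Or.inl ?_⟩
      by_contra hba
      exact h ⟨b, hpart ▸ hb, hba⟩
  refine ⟨f, fun a => ?_, fun X hX a ha => (hf X hX a ha).2⟩
  obtain ⟨X, hX, ha⟩ := P.exists_mem (Finset.mem_univ a)
  obtain ⟨h₁, h₂⟩ := hf X hX a ha
  obtain ⟨h₃, h₄⟩ := hf X hX _ h₁
  rcases h₄ a ha with h | h
  · exact (congrArg f h.symm).trans h.symm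
  · exact h.symm

end filling

/-! ### Fillings of the matrix of a diagram -/

/-- All intersection numbers vanish. -/
def IsotropicForm (m : Fin 4 → Fin 4 → ℤ) : Prop := m 0 1 = 0

/-- The Pfaffian vanishes. -/
def PfaffianZero (m : Fin 4 → Fin 4 → ℤ) : Prop :=
  m 0 1 * m 2 3 - m 0 2 * m 1 3 + m 0 3 * m 1 2 = 0

namespace KnotDiagram

variable {D : KnotDiagram} {q : (Fin 4 → Fin 4 → ℤ) → Prop}

/-- The closed flows whose growth at the arrows is invariant under `f`. -/
def invariantFlows (D : KnotDiagram) (f : ℕ → ℕ) : AddSubgroup EdgeChain where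
  carrier := {x | Closed x D.word ∧ ∀ a, x.2 (f a) = x.2 a}
  add_mem' := fun h h' => ⟨h.1.add h'.1, fun a => by simp [h.2, h'.2]⟩
  zero_mem' := ⟨closed_zero _, fun _ => rfl⟩
  neg_mem' := fun h => ⟨h.1.neg, fun a => by simp [h.2]⟩

theorem exists_closed (n : ℕ → ℤ) : ∃ x : EdgeChain, Closed x D.word ∧ x.2 = n := by
  have hc := closed_sum (S := Finset.univ) (fun (a : D.Arrow) _ => closed_loop_some a.2)
    fun a => n a
  set y := ∑ a : D.Arrow, n a • D.loop (some a) with hy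
  refine ⟨(y.1, n), (closed_congr (x := y) (y := (y.1, n)) (fun _ _ => rfl) fun p hp => ?_).1 hc, rfl⟩
  have ha := mem_word_iff.1 hp
  rw [hy, Prod.snd_sum, Finset.sum_apply, Finset.sum_eq_single ⟨p.1, ha⟩]
  · simp [loop]
  · intro b _ hb
    have : p.1 ≠ b.1 := fun h => hb (Subtype.ext h.symm)
    simp [loop, this]
  · simp

/-- For one circle the group of flows is no longer a choice. Every charge vanishes, so `lift`
realizes every invariant growth, and `boundary` supplies the whole curve. Up to agreement on the
diagram, `L` therefore contains all closed flows with `f`-invariant growth. -/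
theorem hasDiscFilling_iff : D.HasDiscFilling q ↔ ∃ f : ℕ → ℕ, (∀ a, f (f a) = a) ∧
    (∀ a, a ∉ D.arrows → f a = a) ∧ ∀ v : Fin 4 → EdgeChain, (∀ i, v i ∈ D.invariantFlows f) →
      q fun i j => form D.arrows (v i) (v j) := by
  constructor
  · rintro ⟨s, f, L, h⟩
    have hfix := h.fixed
    have hgood := h.good
    rw [arrowsOf_word] at hfix hgood
    refine ⟨f, h.invol, hfix, fun v hv => ?_⟩
    have key : ∀ x ∈ D.invariantFlows f, ∃ y ∈ L, D.Agree x y := by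
      intro x hx
      obtain ⟨y, hy, hyx⟩ := h.lift x.2 hx.2 (by simp [charge_word])
      obtain ⟨z, hz, hz2, hz1⟩ := h.boundary s
      obtain ⟨k, hk⟩ := exists_agree_of_snd_eq hx.1 (h.closed y hy (s, D.word) (by simp))
        fun a _ => by rw [hyx]
      refine ⟨k • z + y, L.add_mem (L.zsmul_mem hz k) hy, fun p hp => ?_, fun a ha => ?_⟩
      · rw [hk.1 p hp]
        simp [loop, hz1 (s, D.word) (by simp) p hp]
      · rw [hk.2 a ha]
        simp [loop, hz2]
    choose w hw hwv using fun i => key (v i) (hv i)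
    convert hgood w hw using 3 with i j
    exact (hwv i).form (hwv j)
  · rintro ⟨f, hf, hfix, hgood⟩
    refine ⟨0, f, D.invariantFlows f, hf, by rwa [arrowsOf_word], ?_, fun x hx => hx.2,
      by rwa [arrowsOf_word], fun s => ?_, ?_, fun n hn _ => ?_⟩
    · simp only [Multiset.mem_singleton]
      rintro x hx k rfl
      exact hx.1
    · refine ⟨(fun _ => if s = 0 then 1 else 0, 0), ⟨⟨_, flow_const (fun _ _ => rfl) rfl⟩,
        fun _ => rfl⟩, rfl, ?_⟩
      simp [eq_comm]
    · intro n _ s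
      simp [charge_word]
    · obtain ⟨x, hx, rfl⟩ := D.exists_closed n
      exact ⟨x, ⟨hx, hn⟩, rfl⟩

/-- The flow of a generator of a filling. -/
def blockFlow (P : Finpartition (Finset.univ : Finset D.Arrow)) (u : Option {X // X ∈ P.parts}) :
    EdgeChain :=
  ∑ z ∈ fillingBlock P u, D.loop (z.map Subtype.val)

theorem fillingMatrix_eq_form (P : Finpartition (Finset.univ : Finset D.Arrow))
    (u v : Option {X // X ∈ P.parts}) :
    fillingMatrix D.basedMatrix P u v = form D.arrows (blockFlow P u) (blockFlow P v) := by
  change ∑ x ∈ fillingBlock P u, ∑ y ∈ fillingBlock P v, D.basedMatrix x y = _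
  rw [← formHom_apply, show blockFlow P u = _ from rfl, blockFlow, map_sum,
    AddMonoidHom.finsetSum_apply]
  refine Finset.sum_congr rfl fun x _ => ?_
  rw [blockFlow, map_sum]
  exact Finset.sum_congr rfl fun y _ => basedMatrix_eq_form x y

theorem blockFlow_some (P : Finpartition (Finset.univ : Finset D.Arrow)) (X : {X // X ∈ P.parts}) :
    blockFlow P (some X) = ∑ a ∈ X.1, D.loop (some a.1) := by
  simp [blockFlow, fillingBlock]

theorem blockFlow_none (P : Finpartition (Finset.univ : Finset D.Arrow)) :
    blockFlow P none = D.loop none := by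
  simp [blockFlow, fillingBlock]

theorem closed_blockFlow (P : Finpartition (Finset.univ : Finset D.Arrow))
    (u : Option {X // X ∈ P.parts}) : Closed (blockFlow P u) D.word :=
  (closedOn D.word).sum_mem fun z _ => closed_loop z

theorem fillingMatrix_swap (P : Finpartition (Finset.univ : Finset D.Arrow))
    (u v : Option {X // X ∈ P.parts}) :
    fillingMatrix D.basedMatrix P v u = -fillingMatrix D.basedMatrix P u v := by
  rw [fillingMatrix_eq_form, fillingMatrix_eq_form,
    form_swap (closed_blockFlow P u) (closed_blockFlow P v)]

/-- A combination of loops whose coefficients are constant on the blocks is an integral combination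
of the block flows. -/
theorem hom_eq_zero_of_blockFlow {P : Finpartition (Finset.univ : Finset D.Arrow)}
    {φ : EdgeChain →+ ℤ} (hφ : ∀ u, φ (blockFlow P u) = 0) (k : ℤ) {n : ℕ → ℤ}
    (hn : ∀ X ∈ P.parts, ∀ a ∈ X, ∀ b ∈ X, n b.1 = n a.1) :
    φ (k • D.loop none + ∑ a : D.Arrow, n a • D.loop (some a)) = 0 := by
  have h₀ : φ (D.loop none) = 0 := by rw [← blockFlow_none P]; exact hφ none
  rw [map_add, map_zsmul, h₀, smul_zero, zero_add, ← P.biUnion_parts,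
    Finset.sum_biUnion (fun X hX Y hY h => P.disjoint hX hY h), map_sum]
  refine Finset.sum_eq_zero fun X hX => ?_
  obtain ⟨a, ha⟩ := P.nonempty_of_mem_parts hX
  have : ∑ b ∈ id X, n b.1 • D.loop (some b.1) = n a.1 • blockFlow P (some ⟨X, hX⟩) := by
    rw [blockFlow_some, Finset.smul_sum]
    exact Finset.sum_congr rfl fun b hb => by rw [hn X hX a ha b hb]
  rw [this, map_zsmul, hφ, smul_zero]

theorem hasDiscFilling_isotropic {P : Finpartition (Finset.univ : Finset D.Arrow)}
    (hP : IsFilling P) (h : fillingMatrix D.basedMatrix P = 0) : D.HasDiscFilling IsotropicForm := by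
  obtain ⟨f, hf, hfP⟩ := exists_involutive_of_filling hP
  let F : ℕ → ℕ := fun n => if h : n ∈ D.arrows then (f ⟨n, h⟩).1 else n
  have hF : ∀ a : D.Arrow, F a = f a := fun a => by simp [F, a.2]
  have hF' : ∀ a, a ∉ D.arrows → F a = a := fun a ha => dif_neg ha
  refine hasDiscFilling_iff.2 ⟨F, fun a => ?_, hF', fun v hv => ?_⟩
  · by_cases ha : a ∈ D.arrows
    · have := hF ⟨a, ha⟩
      simp only at this
      rw [this, hF, hf]
    · rw [hF' a ha, hF' a ha]
  · have hn : ∀ x ∈ D.invariantFlows F, ∀ X ∈ P.parts, ∀ a ∈ X, ∀ b ∈ X, x.2 b.1 = x.2 a.1 := by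
      intro x hx X hX a ha b hb
      rcases hfP X hX a ha b hb with rfl | rfl
      · rfl
      · rw [← hF, hx.2]
    have h₁ : ∀ x ∈ D.invariantFlows F, ∀ u, form D.arrows x (blockFlow P u) = 0 := by
      intro x hx u
      obtain ⟨k, hk⟩ := exists_agree_sum hx.1
      rw [hk.form ⟨fun _ _ => rfl, fun _ _ => rfl⟩]
      refine hom_eq_zero_of_blockFlow (φ := (formHom D.arrows).flip (blockFlow P u)) (fun u' => ?_) k
        (hn x hx)
      rw [AddMonoidHom.flip_apply, formHom_apply, ← fillingMatrix_eq_form, h]; rfl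
    obtain ⟨k, hk⟩ := exists_agree_sum (hv 1).1
    rw [IsotropicForm, Agree.form (x := v 0) (x' := v 0) ⟨fun _ _ => rfl, fun _ _ => rfl⟩ hk]
    exact hom_eq_zero_of_blockFlow (φ := formHom D.arrows (v 0)) (h₁ _ (hv 0)) k (hn _ (hv 1))

/-- The blocks are the orbits of the involution. The growth of a block flow is the indicator
function of its orbit, hence invariant, so the Pfaffian hypothesis applies to any four block flows.
-/
theorem exists_filling_pfaffianZero (h : D.HasDiscFilling PfaffianZero) :
    ∃ P : Finpartition (Finset.univ : Finset D.Arrow), IsFilling P ∧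
      (fillingMatrix D.basedMatrix P).rank ≤ 2 := by
  obtain ⟨F, hF, hfix, hgood⟩ := hasDiscFilling_iff.1 h
  have hmem : ∀ a ∈ D.arrows, F a ∈ D.arrows := fun a ha => by
    by_contra h'
    have := hfix _ h'
    rw [hF] at this
    exact h' (this ▸ ha)
  let f : D.Arrow → D.Arrow := fun a => ⟨F a, hmem a a.2⟩
  obtain ⟨P, hP, hPf⟩ := exists_filling_of_involutive (f := f) fun a => Subtype.ext (hF a)
  refine ⟨P, hP, rank_le_two fun i j k l => ?_⟩
  have hinv : ∀ u, blockFlow P u ∈ D.invariantFlows F := by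
    intro u
    refine ⟨closed_blockFlow P u, fun c => ?_⟩
    cases u with
    | none => simp [blockFlow_none, loop]
    | some X =>
      obtain ⟨a, ha⟩ := hPf X.1 X.2
      have hX : ∀ c, (blockFlow P (some X)).2 c = if c = a.1 ∨ c = F a.1 then 1 else 0 := by
        intro c
        rw [blockFlow_some, ha, Prod.snd_sum, Finset.sum_apply]
        by_cases haf : a = f a
        · have : F a.1 = a.1 := congrArg Subtype.val haf.symm
          rw [← haf, Finset.insert_eq_of_mem (Finset.mem_singleton_self a), Finset.sum_singleton]
          simp [loop, this, Pi.single_apply]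
        · have hne : a.1 ≠ F a.1 := fun h => haf (Subtype.ext h)
          rw [Finset.sum_pair haf]
          by_cases h₁ : c = a.1
          · simp [loop, h₁, f, hne]
          · simp [loop, Pi.single_apply, h₁, f]
      rw [hX, hX]
      have : (F c = a.1 ∨ F c = F a.1) ↔ (c = a.1 ∨ c = F a.1) := by
        constructor
        · rintro (h | h)
          · exact Or.inr (by rw [← h, hF])
          · exact Or.inl (by rw [← hF c, h, hF])
        · rintro (h | h)
          · exact Or.inr (by rw [h])
          · exact Or.inl (by rw [h, hF])
      simp only [this]
  have := hgood ![blockFlow P i, blockFlow P j, blockFlow P k, blockFlow P l] (by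
    intro r; fin_cases r <;> simp [hinv])
  simpa [PfaffianZero, fillingMatrix_eq_form] using this

end KnotDiagram

end FlatKnots

namespace FlatKnots

/-! ### Reductions of based matrices -/

/-- An elementary reduction of the based matrix `T` on `s` and the elements of `H` removes from `H`
the set `X`: an element whose row is zero or the row of `s`, or two elements whose rows add up to
the row of `s`. -/
inductive IsReduction (T : Option ℕ → Option ℕ → ℤ) (H : Finset ℕ) : Finset ℕ → Prop
  | zero {g : ℕ} (hg : g ∈ H) (h : ∀ y ∈ H.insertNone, T (some g) y = 0) : IsReduction T H {g}
  | core {g : ℕ} (hg : g ∈ H) (h : ∀ y ∈ H.insertNone, T (some g) y = T none y) :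
      IsReduction T H {g}
  | pair {g g' : ℕ} (hg : g ∈ H) (hg' : g' ∈ H) (hgg : g ≠ g')
      (h : ∀ y ∈ H.insertNone, T (some g) y + T (some g') y = T none y) : IsReduction T H {g, g'}

/-- The based matrix `T` on `s` and the elements of `H` can be reduced to the matrix `M`. -/
inductive ReducesTo {n : ℕ} (M : Matrix (Fin (n + 1)) (Fin (n + 1)) ℤ)
    (T : Option ℕ → Option ℕ → ℤ) : Finset ℕ → Prop
  | base {H : Finset ℕ} (σ : H ≃ Fin n)
      (h : ∀ x y : Option H, T (x.map Subtype.val) (y.map Subtype.val) =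
        M (x.elim 0 fun a => (σ a).succ) (y.elim 0 fun a => (σ a).succ)) : ReducesTo M T H
  | step {H X : Finset ℕ} (h : IsReduction T H X) (h' : ReducesTo M T (H \ X)) : ReducesTo M T H

section reduction

variable {n : ℕ} {M : Matrix (Fin (n + 1)) (Fin (n + 1)) ℤ} {T T' : Option ℕ → Option ℕ → ℤ}
  {H X Y : Finset ℕ}

theorem IsReduction.subset (h : IsReduction T H X) : X ⊆ H := by
  cases h <;> simp_all [Finset.insert_subset_iff]

theorem IsReduction.mono {H' : Finset ℕ} (h : IsReduction T H X) (hH : H' ⊆ H) (hX : X ⊆ H') :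
    IsReduction T H' X := by
  have hs : ∀ y ∈ H'.insertNone, y ∈ H.insertNone := fun y hy => by
    rw [Finset.mem_insertNone] at hy ⊢
    exact fun a ha => hH (hy a ha)
  cases h with
  | zero hg h => exact .zero (hX (by simp)) fun y hy => h y (hs y hy)
  | core hg h => exact .core (hX (by simp)) fun y hy => h y (hs y hy)
  | pair hg hg' hgg h => exact .pair (hX (by simp)) (hX (by simp)) hgg fun y hy => h y (hs y hy)

theorem ReducesTo.le_card (h : ReducesTo M T H) : n ≤ H.card := by
  induction h with
  | base σ _ => simpa using (Fintype.card_congr σ).ge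
  | step _ _ ih => exact ih.trans (Finset.card_le_card Finset.sdiff_subset)

theorem IsReduction.map (π : Equiv.Perm ℕ) (hT : ∀ x ∈ H.insertNone, ∀ y ∈ H.insertNone,
      T' (x.map π) (y.map π) = T x y) (h : IsReduction T H X) :
    IsReduction T' (H.map π.toEmbedding) (X.map π.toEmbedding) := by
  have hs : ∀ y ∈ (H.map π.toEmbedding).insertNone, ∃ z ∈ H.insertNone, y = z.map π := by
    intro y hy
    cases y with
    | none => exact ⟨none, by simp, rfl⟩
    | some a =>
      rw [Finset.some_mem_insertNone, Finset.mem_map] at hy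
      obtain ⟨b, hb, rfl⟩ := hy
      exact ⟨some b, by simpa using hb, rfl⟩
  have h₀ : ∀ z ∈ H.insertNone, T' none (z.map π) = T none z := fun z hz => hT none (by simp) z hz
  have h₁ : ∀ g ∈ H, ∀ z ∈ H.insertNone, T' (some (π g)) (z.map π) = T (some g) z :=
    fun g hg z hz => hT (some g) (by simpa using hg) z hz
  cases h with
  | @zero g hg h =>
    rw [Finset.map_singleton]
    refine .zero (by simpa using hg) fun y hy => ?_
    obtain ⟨z, hz, rfl⟩ := hs y hy
    exact (h₁ g hg z hz).trans (h z hz)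
  | @core g hg h =>
    rw [Finset.map_singleton]
    refine .core (by simpa using hg) fun y hy => ?_
    obtain ⟨z, hz, rfl⟩ := hs y hy
    exact (h₁ g hg z hz).trans ((h z hz).trans (h₀ z hz).symm)
  | @pair g g' hg hg' hgg h =>
    rw [Finset.map_insert, Finset.map_singleton]
    refine .pair (by simpa using hg) (by simpa using hg') (by simpa using hgg) fun y hy => ?_
    obtain ⟨z, hz, rfl⟩ := hs y hy
    rw [h₀ z hz, ← h z hz, ← h₁ g hg z hz, ← h₁ g' hg' z hz]
    rfl

theorem ReducesTo.map (h : ReducesTo M T H) (π : Equiv.Perm ℕ) :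
    (∀ x ∈ H.insertNone, ∀ y ∈ H.insertNone, T' (x.map π) (y.map π) = T x y) →
    ReducesTo M T' (H.map π.toEmbedding) := by
  induction h with
  | @base H σ h =>
    intro hT
    let e : {a // a ∈ H.map π.toEmbedding} ≃ H := (π.subtypeEquiv fun a => by simp).symm
    refine .base (e.trans σ) fun x y => ?_
    have he : ∀ a, π (e a).1 = a.1 := fun a => π.apply_symm_apply _
    have hx : ∀ x : Option {a // a ∈ H.map π.toEmbedding},
        x.map Subtype.val = ((x.map e).map Subtype.val).map π := by
      intro x; cases x <;> simp [he]
    have hm : ∀ x : Option H, x.map Subtype.val ∈ H.insertNone := by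
      intro x; cases x <;> simp
    rw [hx x, hx y, hT _ (hm _) _ (hm _), h]
    cases x <;> cases y <;> rfl
  | @step H X hX _ ih =>
    intro hT
    refine .step (hX.map π hT) ?_
    rw [← Finset.map_sdiff]
    have hs : ∀ y ∈ (H \ X).insertNone, y ∈ H.insertNone := fun y hy => by
      rw [Finset.mem_insertNone] at hy ⊢
      exact fun a ha => (Finset.mem_sdiff.1 (hy a ha)).1
    exact ih fun x hx y hy => hT x (hs x hx) y (hs y hy)

theorem ReducesTo.congr (h : ReducesTo M T H)
    (hT : ∀ x ∈ H.insertNone, ∀ y ∈ H.insertNone, T' x y = T x y) : ReducesTo M T' H := by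
  have := h.map (T' := T') (Equiv.refl ℕ) fun x hx y hy => by simpa using hT x hx y hy
  simpa using this

/-- Elements of `H` with the same rows may be replaced by each other. -/
theorem ReducesTo.replace {g k k' : ℕ}
    (hT : ∀ x ∈ H.insertNone, ∀ y ∈ H.insertNone, T y x = -T x y) (hk : k ∈ H) (hk' : k' ∈ H)
    (hgk : g ≠ k) (hgk' : g ≠ k')
    (hrow : ∀ y ∈ H.insertNone, T (some k) y = T (some k') y)
    (h : ReducesTo M T (H \ {g, k})) : ReducesTo M T (H \ {g, k'}) := by
  by_cases hkk : k = k'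
  · rwa [← hkk]
  -- Interchanging `k` and `k'` carries one remainder to the other. Equal rows, and by antisymmetry
  -- equal columns, make this interchange invisible to `T`.
  have hmap : (H \ {g, k}).map (Equiv.swap k' k).toEmbedding = H \ {g, k'} := by
    ext a
    rw [Finset.mem_map_equiv, Equiv.symm_swap]
    by_cases h₁ : a = k
    · subst h₁; simp [hk, hk', Ne.symm hgk, Ne.symm hgk', hkk, Ne.symm hkk]
    · by_cases h₂ : a = k'
      · subst h₂; simp
      · rw [Equiv.swap_apply_of_ne_of_ne h₂ h₁]; simp [h₁, h₂]
  rw [← hmap]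
  refine h.map _ ?_
  have hcol : ∀ y ∈ H.insertNone, T y (some k) = T y (some k') := fun y hy => by
    rw [hT (some k) (by simpa using hk) y hy, hT (some k') (by simpa using hk') y hy, hrow y hy]
  have hval : ∀ x ∈ (H \ {g, k}).insertNone, (x.map (Equiv.swap k' k)) ∈ H.insertNone ∧
      x ∈ H.insertNone ∧ (x.map (Equiv.swap k' k) = x ∨
        x = some k' ∧ x.map (Equiv.swap k' k) = some k) := by
    intro x hx
    cases x with
    | none => simp
    | some a =>
      simp only [Finset.some_mem_insertNone, Finset.mem_sdiff, Finset.mem_insert,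
        Finset.mem_singleton, not_or, Option.map_some, Option.some.injEq] at hx ⊢
      by_cases h₂ : a = k'
      · subst h₂; simp [hk, hk']
      · rw [Equiv.swap_apply_of_ne_of_ne h₂ hx.2.2]; simp [hx.1]
  intro x hx y hy
  obtain ⟨hx₁, hx₂, hx₃⟩ := hval x hx
  obtain ⟨hy₁, hy₂, hy₃⟩ := hval y hy
  have e₁ : T (x.map (Equiv.swap k' k)) (y.map (Equiv.swap k' k)) =
      T x (y.map (Equiv.swap k' k)) := by
    rcases hx₃ with h | ⟨h, h'⟩
    · rw [h]
    · rw [h', hrow _ hy₁, h]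
  rw [e₁]
  rcases hy₃ with h | ⟨h, h'⟩
  · rw [h]
  · rw [h', hcol _ hx₂, h]

/-- No elementary reduction applies to the based matrix `M`. -/
def IsPrimitiveMatrix (M : Matrix (Fin (n + 1)) (Fin (n + 1)) ℤ) : Prop :=
  ∀ i : Fin n, (∃ y, M i.succ y ≠ 0) ∧ (∃ y, M i.succ y ≠ M 0 y) ∧
    ∀ j, i ≠ j → ∃ y, M i.succ y + M j.succ y ≠ M 0 y

theorem IsPrimitiveMatrix.not_isReduction (hM : IsPrimitiveMatrix M) (σ : H ≃ Fin n)
    (h : ∀ x y : Option H, T (x.map Subtype.val) (y.map Subtype.val) =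
      M (x.elim 0 fun a => (σ a).succ) (y.elim 0 fun a => (σ a).succ)) : ¬ IsReduction T H X := by
  have hy : ∀ y : Fin (n + 1), ∃ z ∈ H.insertNone, (∀ a : H,
      T (some a.1) z = M (σ a).succ y) ∧ T none z = M 0 y := by
    intro y
    have hmem : ∀ z : Option H, z.map Subtype.val ∈ H.insertNone := by
      intro x; cases x <;> simp
    have key : ∀ z : Option H, z.elim 0 (fun a => (σ a).succ) = y →
        ∃ z ∈ H.insertNone, (∀ a : H, T (some a.1) z = M (σ a).succ y) ∧ T none z = M 0 y :=
      fun z hz => ⟨z.map Subtype.val, hmem z, fun a => by rw [← hz]; exact h (some a) z,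
        by rw [← hz]; exact h none z⟩
    cases y using Fin.cases with
    | zero => exact key none rfl
    | succ i => exact key (some (σ.symm i)) (by simp)
  intro hX
  cases hX with
  | @zero g hg h' =>
    obtain ⟨y, hne⟩ := (hM (σ ⟨g, hg⟩)).1
    obtain ⟨z, hz, h₁, -⟩ := hy y
    exact hne (by rw [← h₁]; exact h' z hz)
  | @core g hg h' =>
    obtain ⟨y, hne⟩ := (hM (σ ⟨g, hg⟩)).2.1
    obtain ⟨z, hz, h₁, h₂⟩ := hy y
    exact hne (by rw [← h₁, ← h₂]; exact h' z hz)
  | @pair g g' hg hg' hgg h' =>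
    obtain ⟨y, hne⟩ := (hM (σ ⟨g, hg⟩)).2.2 (σ ⟨g', hg'⟩) (by simpa using hgg)
    obtain ⟨z, hz, h₁, h₂⟩ := hy y
    exact hne (by rw [← h₁, ← h₁, ← h₂]; exact h' z hz)

/-- Two elementary reductions of a matrix can be completed to reductions with the same result. -/
theorem ReducesTo.sdiff (hM : IsPrimitiveMatrix M)
    (hT : ∀ x ∈ H.insertNone, ∀ y ∈ H.insertNone, T y x = -T x y)
    (h : ReducesTo M T H) : ∀ Y, IsReduction T H Y → ReducesTo M T (H \ Y) := by
  have hsub : ∀ {H X : Finset ℕ}, ∀ y ∈ (H \ X).insertNone, y ∈ H.insertNone := fun y hy => by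
    rw [Finset.mem_insertNone] at hy ⊢
    exact fun a ha => (Finset.mem_sdiff.1 (hy a ha)).1
  -- Disjoint reductions commute.
  have hdisj : ∀ {H X Y : Finset ℕ}, IsReduction T H X → IsReduction T H Y → Disjoint X Y →
      (∀ Z, IsReduction T (H \ X) Z → ReducesTo M T ((H \ X) \ Z)) → ReducesTo M T (H \ Y) := by
    intro H X Y hX hY hXY ih
    refine .step (X := X) (hX.mono Finset.sdiff_subset (Finset.subset_sdiff.2 ⟨hX.subset, hXY⟩)) ?_
    rw [sdiff_right_comm]
    exact ih Y (hY.mono Finset.sdiff_subset (Finset.subset_sdiff.2 ⟨hY.subset, hXY.symm⟩))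
  -- If `g` is removable alone and also together with `k`, then `k` is removable once `g` is gone: a
  -- zero row of `g` gives `k` the row of s, and the row of s gives `k` a zero row.
  have hone : ∀ {H : Finset ℕ} {g k : ℕ}, k ∈ H → g ≠ k →
      ((∀ y ∈ H.insertNone, T (some g) y = 0) ∨ ∀ y ∈ H.insertNone, T (some g) y = T none y) →
      (∀ y ∈ H.insertNone, T (some g) y + T (some k) y = T none y) →
      IsReduction T (H \ {g}) {k} := by
    intro H g k hk hgk h₁ h₂
    have hkm : k ∈ H \ {g} := by simp [hk, Ne.symm hgk]
    rcases h₁ with h₁ | h₁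
    · exact .core hkm fun y hy => by linarith [h₁ y (hsub y hy), h₂ y (hsub y hy)]
    · exact .zero hkm fun y hy => by linarith [h₁ y (hsub y hy), h₂ y (hsub y hy)]
  have hins : ∀ {H : Finset ℕ} {g k : ℕ}, (H \ {g}) \ {k} = H \ {g, k} := by
    intro H g k; ext; simp [and_assoc]
  have hcases : ∀ {H X : Finset ℕ}, IsReduction T H X →
      (∃ g, X = {g} ∧ ((∀ y ∈ H.insertNone, T (some g) y = 0) ∨
        ∀ y ∈ H.insertNone, T (some g) y = T none y)) ∨
      ∃ g g', g ≠ g' ∧ g ∈ H ∧ g' ∈ H ∧ X = {g, g'} ∧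
        ∀ y ∈ H.insertNone, T (some g) y + T (some g') y = T none y := by
    intro H X hX
    cases hX with
    | @zero g hg h => exact .inl ⟨g, rfl, .inl h⟩
    | @core g hg h => exact .inl ⟨g, rfl, .inr h⟩
    | @pair g g' hg hg' hgg h => exact .inr ⟨g, g', hgg, hg, hg', rfl, h⟩
  induction h with
  | base σ h => exact fun Y hY => absurd hY (hM.not_isReduction σ h)
  | @step H X hX hred ih =>
    intro Y hY
    replace ih := ih fun x hx y hy => hT x (hsub x hx) y (hsub y hy)
    by_cases hXY : Disjoint X Y
    · exact hdisj hX hY hXY ih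
    rcases hcases hX with ⟨g, rfl, hg⟩ | ⟨g, g', hgg, hg₁, hg₂, rfl, hg⟩ <;>
      rcases hcases hY with ⟨k, rfl, hk⟩ | ⟨k, k', hkk, hk₁, hk₂, rfl, hk⟩
    · rwa [show k = g by simpa [eq_comm] using hXY]
    · have h : g = k ∨ g = k' := by
        simpa only [Finset.disjoint_singleton_left, Finset.mem_insert, Finset.mem_singleton,
          not_not] using hXY
      rcases h with rfl | rfl
      · rw [← hins]
        exact ih {k'} (hone hk₂ hkk hg hk)
      · rw [Finset.pair_comm, ← hins]
        exact ih {k} (hone hk₁ hkk.symm hg fun y hy => by rw [add_comm]; exact hk y hy)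
    · have h : k = g ∨ k = g' := by
        simpa only [Finset.disjoint_singleton_right, Finset.mem_insert, Finset.mem_singleton,
          not_not] using hXY
      rcases h with rfl | rfl
      · exact .step (hone hg₂ hgg hk hg) (by rwa [hins])
      · refine .step (hone hg₁ hgg.symm hk fun y hy => by rw [add_comm]; exact hg y hy) ?_
        rwa [hins, Finset.pair_comm]
    · have h : (g = k ∨ g = k') ∨ g' = k ∨ g' = k' := by
        simpa only [Finset.disjoint_insert_left, Finset.disjoint_singleton_left, Finset.mem_insert,
          Finset.mem_singleton, not_and_or, not_not] using hXY
      -- Two pairs with the common element `g`: the other two elements have the same row, so either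
      -- of them may be left over.
      have key : ∀ {g h k : ℕ}, h ∈ H → k ∈ H → g ≠ h → g ≠ k →
          (∀ y ∈ H.insertNone, T (some g) y + T (some h) y = T none y) →
          (∀ y ∈ H.insertNone, T (some g) y + T (some k) y = T none y) →
          ReducesTo M T (H \ {g, h}) → ReducesTo M T (H \ {g, k}) :=
        fun hh hk hgh hgk h₁ h₂ hred => hred.replace hT hh hk hgh hgk
          fun y hy => by linarith [h₁ y hy, h₂ y hy]
      have hg' : ∀ y ∈ H.insertNone, T (some g') y + T (some g) y = T none y := fun y hy => by
        rw [add_comm]; exact hg y hy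
      have hk' : ∀ y ∈ H.insertNone, T (some k') y + T (some k) y = T none y := fun y hy => by
        rw [add_comm]; exact hk y hy
      rcases h with (rfl | rfl) | rfl | rfl
      · exact key hg₂ hk₂ hgg hkk hg hk hred
      · rw [Finset.pair_comm]
        exact key hg₂ hk₁ hgg hkk.symm hg hk' hred
      · rw [Finset.pair_comm] at hred
        exact key hg₁ hk₂ hgg.symm hkk hg' hk hred
      · rw [Finset.pair_comm] at hred ⊢
        exact key hg₁ hk₁ hgg.symm hkk.symm hg' hk' hred

end reduction

end FlatKnots

namespace FlatKnots

/-! ### Invariance of reductions of the based matrix -/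

theorem eq_of_isRotated_cons {α : Type*} {a : α} {l l' : List α} (h : (a :: l).IsRotated (a :: l'))
    (hn : (a :: l).Nodup) : l = l' := by
  obtain ⟨n, hn'⟩ := h
  set m := n % (a :: l).length with hm
  have hlt : m < (a :: l).length := Nat.mod_lt _ (by simp)
  rw [← List.rotate_mod, ← hm] at hn'
  have h₀ : ((a :: l).rotate m)[0]'(by simp) = a := by simp [hn']
  rw [List.getElem_rotate] at h₀
  have h₁ : (0 + m) % (a :: l).length = 0 := by
    refine (hn.getElem_inj_iff (hi := Nat.mod_lt _ (by simp)) (hj := by simp)).1 ?_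
    rw [h₀]; rfl
  rw [zero_add, Nat.mod_eq_of_lt hlt] at h₁
  rw [h₁, List.rotate_zero] at hn'
  exact (List.cons.inj hn').2

theorem exists_append_of_isRotated {c u w : Circle} {p₁ q₁ p₂ q₂ : Endpoint} (hc : c.Nodup)
    (h₁ : c.IsRotated (p₁ :: q₁ :: u)) (h₂ : c.IsRotated (p₂ :: q₂ :: w))
    (hp : p₂ ≠ p₁ ∧ p₂ ≠ q₁) (hq : q₂ ≠ p₁) : ∃ v v', u = v ++ p₂ :: q₂ :: v' := by
  have hmem : p₂ ∈ u := by
    have : p₂ ∈ p₁ :: q₁ :: u := h₁.mem_iff.1 (h₂.mem_iff.2 (by simp))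
    simpa [hp.1, hp.2] using this
  obtain ⟨v, v', rfl⟩ := List.append_of_mem hmem
  have hr : (p₁ :: q₁ :: (v ++ p₂ :: v')).IsRotated (p₂ :: (v' ++ p₁ :: q₁ :: v)) := by
    have := List.isRotated_append (l := p₁ :: q₁ :: v) (l' := p₂ :: v')
    simpa using this
  have hr' := h₂.symm.trans (h₁.trans hr)
  have he := eq_of_isRotated_cons hr' (h₂.nodup_iff.1 hc)
  cases v' with
  | nil => exact absurd (List.cons.inj he).1 hq
  | cons r v' =>
    obtain rfl := (List.cons.inj he).1
    exact ⟨v, v', rfl⟩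

theorem Flow.eq_of_forall {x : EdgeChain} {c : Circle} {α β : ℤ} (h : Flow x α c β)
    (h₂ : ∀ p ∈ c, x.2 p.1 = 0) : β = α := by
  rw [h.charge_eq, charge_congr (m := 0) h₂]
  simp [charge]

namespace KnotDiagram

variable {n : ℕ} {M : Matrix (Fin (n + 1)) (Fin (n + 1)) ℤ} {D E : KnotDiagram}

theorem closed_loop_of_mem {x : Option ℕ} (hx : x ∈ D.arrows.insertNone) :
    Closed (D.loop x) D.word := by
  cases x with
  | none => exact closed_loop_none
  | some a => exact closed_loop_some (by simpa using hx)

theorem labelMatrix_swap {x y : Option ℕ} (hx : x ∈ D.arrows.insertNone)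
    (hy : y ∈ D.arrows.insertNone) : D.labelMatrix y x = -D.labelMatrix x y :=
  form_swap (closed_loop_of_mem hx) (closed_loop_of_mem hy)

theorem loop_snd_of_ne {a c : ℕ} (h : a ≠ c) : (D.loop (some c)).2 a = 0 := by
  simp [loop, h]

theorem loop_snd_apply (a c : ℕ) : (D.loop (some a)).2 c = if c = a then 1 else 0 := by
  simp [loop, Pi.single_apply]

theorem loop_fst_head (a : ℕ) : (D.loop (some a)).1 (a, false) = 1 := by simp [loop]

/-- The diagrams `D` and `E` have isomorphic flows. -/
theorem labelMatrix_map (π : Equiv.Perm ℕ) (Ψ : EdgeChain → EdgeChain)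
    (hA : E.arrows = D.arrows.map π.toEmbedding)
    (hcl : ∀ x, Closed x D.word → Closed (Ψ x) E.word)
    (hform : ∀ x y, Closed x D.word → Closed y D.word →
      form E.arrows (Ψ x) (Ψ y) = form D.arrows x y)
    (hn : ∀ x c, (Ψ x).2 (π c) = x.2 c) (h₀ : Ψ (D.loop none) = E.loop none)
    (htail : ∀ c ∈ D.arrows, (Ψ (D.loop (some c))).1 (π c, true) = 0) :
    ∀ x ∈ D.arrows.insertNone, ∀ y ∈ D.arrows.insertNone,
      E.labelMatrix (x.map π) (y.map π) = D.labelMatrix x y := by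
  have key : ∀ x ∈ D.arrows.insertNone, E.Agree (Ψ (D.loop x)) (E.loop (x.map π)) := by
    intro x hx
    cases x with
    | none => rw [h₀]; exact ⟨fun _ _ => rfl, fun _ _ => rfl⟩
    | some c =>
      have hc : c ∈ D.arrows := by simpa using hx
      refine agree_loop (by simpa [hA] using hc) (hcl _ (closed_loop_of_mem hx)) ?_ (htail c hc)
      intro d _
      obtain ⟨d, rfl⟩ := π.surjective d
      simp [hn, loop_snd_apply]
  intro x hx y hy
  rw [labelMatrix, ← (key x hx).form (key y hy),
    hform _ _ (closed_loop_of_mem hx) (closed_loop_of_mem hy), labelMatrix]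

theorem reducesTo_map_iff (π : Equiv.Perm ℕ) (hA : E.arrows = D.arrows.map π.toEmbedding)
    (h : ∀ x ∈ D.arrows.insertNone, ∀ y ∈ D.arrows.insertNone,
      E.labelMatrix (x.map π) (y.map π) = D.labelMatrix x y) :
    ReducesTo M D.labelMatrix D.arrows ↔ ReducesTo M E.labelMatrix E.arrows := by
  refine ⟨fun hD => by rw [hA]; exact hD.map π h, fun hE => ?_⟩
  have := hE.map (T' := D.labelMatrix) π.symm fun x hx y hy => ?_
  · rw [hA] at this
    convert this
    ext a; simp
  · have hm : ∀ z ∈ E.arrows.insertNone, z.map π.symm ∈ D.arrows.insertNone ∧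
        (z.map π.symm).map π = z := by
      intro z hz
      cases z with
      | none => simp
      | some a =>
        rw [hA] at hz
        refine ⟨?_, by simp⟩
        simpa using hz
    rw [← h _ (hm x hx).1 _ (hm y hy).1, (hm x hx).2, (hm y hy).2]

theorem arrows_of_erase {a b : ℕ} (hE : E.word = eraseArrows {a, b} D.word) :
    E.arrows = D.arrows \ {a, b} := by
  have := Removable.arrowsOf_eq a b {(0, D.word)}
  rw [arrowsOf_word, mapCircles, Multiset.map_singleton, ← hE, arrowsOf_word] at this
  exact this

/-- The loops of the remaining arrows have no growth at `a` and `b`, so they stay closed after the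
erasure and become the loops of the new diagram. The crossings `a` and `b` contribute nothing to
their intersection numbers. -/
theorem labelMatrix_erase {a b : ℕ} (hE : E.word = eraseArrows {a, b} D.word)
    (h : Removable {(0, D.word)} a b) : ∀ x ∈ E.arrows.insertNone, ∀ y ∈ E.arrows.insertNone,
      E.labelMatrix x y = D.labelMatrix x y := by
  have hA := arrows_of_erase hE
  have hK : mapCircles (eraseArrows {a, b}) {(0, D.word)} = {(0, E.word)} := by
    rw [mapCircles, Multiset.map_singleton, hE]
  have hab : ∀ x ∈ E.arrows.insertNone,
      (D.loop x).2 a = (D.loop x).2 b ∧ x ∈ D.arrows.insertNone := by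
    intro x hx
    cases x with
    | none => exact ⟨rfl, by simp⟩
    | some c =>
      simp only [hA, Finset.some_mem_insertNone, Finset.mem_sdiff, Finset.mem_insert,
        Finset.mem_singleton, not_or] at hx ⊢
      rw [loop_snd_of_ne (Ne.symm hx.2.1), loop_snd_of_ne (Ne.symm hx.2.2)]
      exact ⟨rfl, hx.1⟩
  have hclD : ∀ x ∈ E.arrows.insertNone, ∀ k ∈ ({(0, D.word)} : Multiset LabelledCircle),
      Closed (D.loop x) k.2 := fun x hx k hk => by
    rw [Multiset.mem_singleton.1 hk]
    exact closed_loop_of_mem (hab x hx).2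
  have key : ∀ x ∈ E.arrows.insertNone, E.Agree (D.loop x) (E.loop x) := by
    intro x hx
    have hcl : Closed (D.loop x) E.word := by
      rw [hE]
      exact h.closed _ (hab x hx).1 (hclD x hx) (0, D.word) (by simp)
    cases x with
    | none => exact ⟨fun _ _ => rfl, fun _ _ => rfl⟩
    | some c =>
      refine agree_loop (by simpa using hx) hcl (fun d _ => loop_snd_apply c d) ?_
      exact loop_fst_tail (by simpa using (hab _ hx).2)
  intro x hx y hy
  have := h.form_eq (hab x hx).1 (hab y hy).1 (hclD x hx) (hclD y hy)
  rw [hK, arrowsOf_word, arrowsOf_word] at this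
  rw [labelMatrix, ← (key x hx).form (key y hy), this, labelMatrix]

/-- Adding the arrows prepends one reduction step. Removing them needs confluence, because a given
reduction to `M` may begin differently. -/
theorem reducesTo_erase_iff (hM : IsPrimitiveMatrix M) {a b : ℕ}
    (hE : E.word = eraseArrows {a, b} D.word) (h : Removable {(0, D.word)} a b)
    (hab : IsReduction D.labelMatrix D.arrows {a, b}) :
    ReducesTo M D.labelMatrix D.arrows ↔ ReducesTo M E.labelMatrix E.arrows := by
  have hA := arrows_of_erase hE
  have hT := labelMatrix_erase hE h
  constructor
  · intro hD
    refine ReducesTo.congr (T := D.labelMatrix) ?_ hT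
    rw [hA]
    exact hD.sdiff hM (fun x hx y hy => labelMatrix_swap hx hy) _ hab
  · intro hE'
    refine .step hab ?_
    rw [← hA]
    exact hE'.congr fun x hx y hy => (hT x hx y hy).symm

/-- If the tail comes first, `a⁺` is the short edge of the loop. If the head comes first, `a⁺` minus
the whole curve is supported on that edge. A closed flow supported there has intersection number
zero with every closed flow, so the row is zero or the row of s. -/
theorem isReduction_loop {a : ℕ} {t : Bool} {u : Circle}
    (hu : D.word.IsRotated ((a, t) :: (a, !t) :: u)) : IsReduction D.labelMatrix D.arrows {a} := by
  have ha : a ∈ D.arrows := mem_word_iff.1 (hu.mem_iff.2 (by simp) : (a, t) ∈ D.word)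
  have hnd := hu.nodup_iff.1 D.word_nodup
  simp only [List.nodup_cons, List.mem_cons, not_or] at hnd
  have hua : ∀ p ∈ u, p.1 ≠ a := by
    rintro ⟨b, s⟩ hp rfl
    by_cases h : s = t
    · exact hnd.1.2 (h ▸ hp)
    · exact hnd.2.1 (by rwa [show (!t) = s by cases s <;> cases t <;> simp_all])
  have hform : ∀ z : EdgeChain, Closed z D.word → z.1 (a, t) = 0 →
      (∀ c, z.2 c = if c = a then 1 else 0) → ∀ y, Closed y D.word → form D.arrows z y = 0 := by
    intro z hz hz₀ hn y hy
    obtain ⟨α, h₁, h₂, h₃⟩ := hz.rotate hu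
    obtain ⟨β, d₁, d₂, -⟩ := hy.rotate hu
    rw [hz₀] at h₁
    subst h₁
    have hout : z.out (a, !t) = 0 := by
      rw [EdgeChain.out, h₂, EdgeChain.out, hz₀, sgn_not]; ring
    rw [hout] at h₃
    have hzero := h₃.eq_const fun p hp => by simp [hn, hua p hp]
    have hc : ∀ c ∈ D.arrows, c ≠ a → ∀ s, z.1 (c, s) = 0 := by
      intro c hc hca s
      refine hzero _ ?_
      have : (c, s) ∈ (a, t) :: (a, !t) :: u := hu.mem_iff.1 (mem_word_iff.2 hc)
      simpa [hca] using this
    rw [form, Finset.sum_eq_single a]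
    · simp only [EdgeChain.out] at h₂ d₂ hout ⊢
      cases t <;> simp [hn] at hz₀ h₂ d₂ hout ⊢ <;> rw [h₂, hz₀, d₂] <;> ring
    · intro c hcA hca
      simp [EdgeChain.out, hc c hcA hca, hn, hca]
    · exact fun h => absurd ha h
  cases t
  · refine .core ha fun y hy => ?_
    rw [← sub_eq_zero, labelMatrix, labelMatrix, ← formHom_apply, ← formHom_apply,
      ← AddMonoidHom.sub_apply, ← map_sub, formHom_apply]
    refine hform _ ?_ ?_ ?_ _ (closed_loop_of_mem hy)
    · rw [sub_eq_add_neg]; exact (closed_loop_some ha).add closed_loop_none.neg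
    · rw [Prod.fst_sub, Pi.sub_apply, loop_fst_head]; simp [loop]
    · intro c; simp [loop, Pi.single_apply]
  · exact .zero ha fun y hy => hform _ (closed_loop_some ha) (loop_fst_tail ha)
      (fun c => loop_snd_apply a c) _ (closed_loop_of_mem hy)

/-- The flow `a⁺ + b⁺ - s` is supported on the two sides of the bigon, and its intersection numbers
at the crossings `a` and `b` cancel. -/
theorem isReduction_bigon {a b : ℕ} (hab : a ≠ b) {t : Bool} {p q : Endpoint} {u w : Circle}
    (h₁ : D.word.IsRotated ((a, t) :: (b, !t) :: u)) (h₂ : D.word.IsRotated (p :: q :: w))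
    (hpq : p = (a, !t) ∧ q = (b, t) ∨ p = (b, t) ∧ q = (a, !t)) :
    IsReduction D.labelMatrix D.arrows {a, b} := by
  have ha : a ∈ D.arrows := mem_word_iff.1 (h₁.mem_iff.2 (by simp) : (a, t) ∈ D.word)
  have hb : b ∈ D.arrows := mem_word_iff.1 (h₁.mem_iff.2 (by simp) : (b, !t) ∈ D.word)
  refine .pair ha hb hab fun y hy => ?_
  have hy' := closed_loop_of_mem hy
  set z := D.loop (some a) + D.loop (some b) - D.loop none with hz
  have hcl : Closed z D.word := by
    rw [hz, sub_eq_add_neg]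
    exact ((closed_loop_some ha).add (closed_loop_some hb)).add closed_loop_none.neg
  have hn : ∀ c, z.2 c = (if c = a then 1 else 0) + if c = b then 1 else 0 := by
    intro c; simp [hz, loop, Pi.single_apply]
  have hna : z.2 a = 1 := by simp [hn, hab]
  have hnb : z.2 b = 1 := by simp [hn, hab.symm]
  -- The loop `b⁺` does not grow at `a`, so its value in front of `(a, t)` is its value at `(b,
  -- !t)`. One of the two loops is 1 here and the other 0, and the whole curve takes away the 1.
  have hz₀ : z.1 (a, t) = 0 := by
    obtain ⟨_, -, d₂, -⟩ := (closed_loop_some hb).rotate h₁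
    rw [EdgeChain.out, loop_snd_of_ne hab, mul_zero, add_zero] at d₂
    have h₀ : (D.loop none).1 (a, t) = 1 := rfl
    rw [hz, Prod.fst_sub, Prod.fst_add, Pi.sub_apply, Pi.add_apply, ← d₂, h₀]
    cases t
    · rw [loop_fst_head]; simp [loop_fst_tail hb]
    · simp [loop_fst_tail ha, loop_fst_head]
  have hsum : D.labelMatrix (some a) y + D.labelMatrix (some b) y - D.labelMatrix none y =
      form D.arrows z (D.loop y) := by
    simp only [labelMatrix, ← formHom_apply, hz, map_sub, map_add, AddMonoidHom.sub_apply,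
      AddMonoidHom.add_apply]
  rw [← sub_eq_zero, hsum]
  obtain ⟨v, v', rfl⟩ := exists_append_of_isRotated D.word_nodup h₁ h₂
    (by rcases hpq with ⟨rfl, rfl⟩ | ⟨rfl, rfl⟩ <;> simp [hab, hab.symm])
    (by rcases hpq with ⟨rfl, rfl⟩ | ⟨rfl, rfl⟩ <;> simp [hab.symm])
  have hnd := h₁.nodup_iff.1 D.word_nodup
  have hv : ∀ r, r ∈ v ∨ r ∈ v' → r.1 ≠ a ∧ r.1 ≠ b := by
    rintro ⟨c, s⟩ hr
    have hr' : (c, s) ≠ (a, t) ∧ (c, s) ≠ (b, !t) ∧ (c, s) ≠ p ∧ (c, s) ≠ q := by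
      simp only [List.nodup_cons, List.mem_cons, List.mem_append, List.nodup_append, not_or] at hnd
      refine ⟨?_, ?_, ?_, ?_⟩ <;> rintro h <;> rw [h] at hr
      · tauto
      · tauto
      · rcases hr with hr | hr
        · exact hnd.2.2.2.2 _ hr p (by simp) rfl
        · tauto
      · rcases hr with hr | hr
        · exact hnd.2.2.2.2 _ hr q (by simp) rfl
        · tauto
    rcases hpq with ⟨rfl, rfl⟩ | ⟨rfl, rfl⟩ <;>
    · simp only [ne_eq, Prod.mk.injEq] at hr' ⊢
      cases s <;> cases t <;> simp at hr' ⊢ <;> tauto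
  have hv₀ : ∀ r, r ∈ v ∨ r ∈ v' → z.2 r.1 = 0 := fun r hr => by simp [hn, hv r hr]
  obtain ⟨α, e₁, e₂, h₃⟩ := hcl.rotate h₁
  rw [hz₀] at e₁
  subst e₁
  have hout : z.out (b, !t) = 0 := by
    rw [EdgeChain.out, e₂, EdgeChain.out, hz₀, sgn_not, hna, hnb, sgn_mk b a]; ring
  rw [hout] at h₃
  obtain ⟨γ, h₄, e₃, e₄, h₅⟩ := flow_append.1 h₃
  have hγ := h₄.eq_of_forall fun r hr => hv₀ r (.inl hr)
  rw [hγ] at e₃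
  have hout' : z.out q = 0 := by
    rw [EdgeChain.out, e₄, EdgeChain.out, e₃]
    rcases hpq with ⟨rfl, rfl⟩ | ⟨rfl, rfl⟩ <;> simp [hna, hnb, sgn_not, sgn_mk b a]
  rw [hout'] at h₅
  have hzero : ∀ r, r ∈ v ∨ r ∈ v' → z.1 r = 0 := by
    rintro r (hr | hr)
    · exact h₄.eq_const (fun r hr => hv₀ r (.inl hr)) r hr
    · exact h₅.eq_const (fun r hr => hv₀ r (.inr hr)) r hr
  have hc : ∀ c ∈ D.arrows, c ≠ a → c ≠ b → ∀ s, z.1 (c, s) = 0 := by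
    intro c hc hca hcb s
    refine hzero _ ?_
    have : (c, s) ∈ (a, t) :: (b, !t) :: (v ++ p :: q :: v') := h₁.mem_iff.1 (mem_word_iff.2 hc)
    rcases hpq with ⟨rfl, rfl⟩ | ⟨rfl, rfl⟩ <;> simpa [hca, hcb] using this
  have hsub : ({a, b} : Finset ℕ) ⊆ D.arrows := by
    simp [Finset.insert_subset_iff, ha, hb]
  obtain ⟨_, -, d₂, -⟩ := hy'.rotate h₁
  obtain ⟨_, -, d₄, -⟩ := hy'.rotate h₂
  rw [form, ← Finset.sum_subset hsub, Finset.sum_pair hab]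
  · simp only [EdgeChain.out] at e₂ e₄ d₂ d₄ ⊢
    rcases hpq with ⟨rfl, rfl⟩ | ⟨rfl, rfl⟩ <;> cases t <;>
      simp [hna, hnb] at hz₀ e₂ e₃ e₄ d₂ d₄ ⊢ <;> rw [e₂, e₄, d₂, d₄, hz₀, e₃] <;> ring
  · intro c hcA hcab
    simp only [Finset.mem_insert, Finset.mem_singleton, not_or] at hcab
    simp [EdgeChain.out, hc c hcA hcab.1 hcab.2, hn, hcab]

/-- The third move respects flows and form. It also carries loops to loops: the value at the tail of
`c` could only change by the growth at the other arrow of its pair, which is zero for the loop of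
`c`. -/
theorem reducesTo_exchange_iff {p₁ q₁ p₂ q₂ p₃ q₃ : Endpoint}
    (hE : E.word = exchange p₁ q₁ p₂ q₂ p₃ q₃ D.word)
    (h : ThreePairs p₁ q₁ p₂ q₂ p₃ q₃ D.word) (h₁ : p₁.1 ≠ q₁.1) (h₂ : p₂.1 ≠ q₂.1)
    (h₃ : p₃.1 ≠ q₃.1)
    (hform : ∀ x y, Closed x D.word → Closed y D.word →
      form D.arrows (exchangeChain p₁ q₁ p₂ q₂ p₃ q₃ x) (exchangeChain p₁ q₁ p₂ q₂ p₃ q₃ y) =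
        form D.arrows x y) :
    ReducesTo M D.labelMatrix D.arrows ↔ ReducesTo M E.labelMatrix E.arrows := by
  have hA : E.arrows = D.arrows := by
    ext a
    simp only [mem_arrows_iff, hE, h.mem_exchange]
  refine reducesTo_map_iff (Equiv.refl ℕ) (by simp [hA])
    (labelMatrix_map (Equiv.refl ℕ) (exchangeChain p₁ q₁ p₂ q₂ p₃ q₃) (by simp [hA]) ?_ ?_
      (fun _ _ => rfl) ?_ ?_)
  · intro x hx
    rw [hE]
    exact h.closed_exchange hx
  · rwa [hA]
  · exact Prod.ext (funext fun r => exchangeChain_fst_of_zero rfl r) rfl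
  · intro c hc
    have key : ∀ {p q : Endpoint} {x : EdgeChain}, p.1 ≠ q.1 → x.2 = Pi.single c 1 →
        (swapChain p q x).1 (c, true) = x.1 (c, true) := by
      intro p q x hpq hx
      rw [swapChain_fst, hx]
      split_ifs with hp hq
      · subst hp; simp [Ne.symm hpq]
      · subst hq; simp [hpq]
      · rfl
    simp only [exchangeChain, AddMonoidHom.comp_apply, Equiv.refl_apply]
    rw [key h₁ rfl, key h₂ rfl, key h₃ rfl, loop_fst_tail hc]

theorem Step.reducesTo_iff (hM : IsPrimitiveMatrix M) (h : D.Step E) :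
    ReducesTo M D.labelMatrix D.arrows ↔ ReducesTo M E.labelMatrix E.arrows := by
  have hK := D.gaussFamily 0
  rcases h with h | ⟨g, hg, hE⟩
  · have hA : E.arrows = D.arrows := by
      ext a; simp only [mem_arrows_iff, h.mem_iff]
    exact reducesTo_map_iff (Equiv.refl ℕ) (by simp [hA])
      (labelMatrix_map (Equiv.refl ℕ) id (by simp [hA]) (fun x hx => hx.rotate h)
        (fun x y _ _ => by rw [hA]; rfl) (fun _ _ => rfl) rfl fun c hc => loop_fst_tail hc)
  have hF : ∀ {p r : Endpoint}, Follows [D.word] p r → ∃ u, D.word.IsRotated (p :: r :: u) := by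
    rintro p r ⟨c, hc, u, hu⟩
    rw [List.mem_singleton.1 hc] at hu
    exact ⟨u, hu⟩
  have hF' : ∀ {p r : Endpoint}, Follows [D.word] p r →
      ∃ k ∈ ({(0, D.word)} : Multiset LabelledCircle), ∃ u, k.2.IsRotated (p :: r :: u) :=
    fun h => ⟨_, Multiset.mem_singleton_self _, hF h⟩
  have hcl : ∀ {x : EdgeChain}, Closed x D.word →
      ∀ k ∈ ({(0, D.word)} : Multiset LabelledCircle), Closed x k.2 :=
    fun h k hk => by rwa [Multiset.mem_singleton.1 hk]
  cases hg with
  | rename π =>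
    have hA : E.arrows = D.arrows.map π.toEmbedding := by
      have := arrowsOf_rename π {(0, D.word)}
      rwa [mapCircles, Multiset.map_singleton, ← hE, arrowsOf_word, arrowsOf_word] at this
    refine reducesTo_map_iff π hA (labelMatrix_map π (renameChain π) hA ?_ ?_ ?_ rfl ?_)
    · rintro x ⟨α, hα⟩
      rw [hE]
      exact ⟨α, flow_rename hα⟩
    · intro x y _ _
      rw [hA, form_rename]
    · simp
    · intro c hc
      simpa using loop_fst_tail hc
  | fr1 a t h =>
    obtain ⟨u, hu⟩ := hF h
    refine reducesTo_erase_iff hM (a := a) (b := a) (by simpa using hE)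
      (removable_of_loop hK (hF' h)) (by simpa using isReduction_loop hu)
  | fr2_parallel a b t hab h₁ h₂ =>
    obtain ⟨u, hu⟩ := hF h₁
    obtain ⟨w, hw⟩ := hF h₂
    exact reducesTo_erase_iff hM hE (removable_of_parallel_bigon hK hab (hF' h₁) (hF' h₂))
      (isReduction_bigon hab hu hw (.inl ⟨rfl, rfl⟩))
  | fr2_opposite a b t hab h₁ h₂ =>
    obtain ⟨u, hu⟩ := hF h₁
    obtain ⟨w, hw⟩ := hF h₂
    exact reducesTo_erase_iff hM hE (removable_of_opposite_bigon hK hab (hF' h₁) (hF' h₂))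
      (isReduction_bigon hab hu hw (.inr ⟨rfl, rfl⟩))
  | fr3_transitive a b c hab hac hbc h₁ h₂ h₃ =>
    have hn : [(a, true), (b, true), (a, false), (c, true), (b, false), (c, false)].Nodup := by
      simp [hab, hac, hbc, hab.symm, hbc.symm]
    refine reducesTo_exchange_iff hE ⟨hn, hK.pair (hF' h₁) (0, D.word) (by simp),
      hK.pair (hF' h₂) (0, D.word) (by simp), hK.pair (hF' h₃) (0, D.word) (by simp)⟩
      hab hac hbc fun x y hx hy => ?_
    rw [← arrowsOf_word 0]
    exact form_exchange_transitive hab hac hbc (hF' h₁) (hF' h₂) (hF' h₃) (hcl hx) (hcl hy)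
  | fr3_cyclic a b c hab hac hbc h₁ h₂ h₃ =>
    have hn : [(b, false), (a, true), (a, false), (c, true), (c, false), (b, true)].Nodup := by
      simp [hab, hac, hbc, hab.symm, hbc.symm]
    refine reducesTo_exchange_iff hE ⟨hn, hK.pair (hF' h₁) (0, D.word) (by simp),
      hK.pair (hF' h₂) (0, D.word) (by simp), hK.pair (hF' h₃) (0, D.word) (by simp)⟩
      hab.symm hac hbc.symm fun x y hx hy => ?_
    rw [← arrowsOf_word 0]
    exact form_exchange_cyclic hab hac hbc (hF' h₁) (hF' h₂) (hF' h₃) (hcl hx) (hcl hy)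

theorem reducesTo_congr (hM : IsPrimitiveMatrix M) (h : D.toFlatKnot = E.toFlatKnot) :
    ReducesTo M D.labelMatrix D.arrows ↔ ReducesTo M E.labelMatrix E.arrows := by
  have h' := Quot.eqvGen_exact h
  clear h
  induction h' with
  | rel _ _ h => exact h.reducesTo_iff hM
  | refl => rfl
  | symm _ _ _ ih => exact ih.symm
  | trans _ _ _ _ _ ih₁ ih₂ => exact ih₁.trans ih₂

theorem HasBasedMatrix.reducesTo (h : D.HasBasedMatrix M) :
    ReducesTo M D.labelMatrix D.arrows := by
  obtain ⟨σ, hσ⟩ := h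
  exact .base σ fun x y => by rw [← hσ, basedMatrix_eq_form]; rfl

/-- A diagram whose based matrix admits no reduction has the minimal number of crossings. -/
theorem HasBasedMatrix.crossingNumber_eq (h : D.HasBasedMatrix M) (hM : IsPrimitiveMatrix M) :
    D.toFlatKnot.crossingNumber = n := by
  obtain ⟨σ, -⟩ := id h
  have hn : D.arrows.card = n := by simpa using Fintype.card_congr σ
  refine le_antisymm (Nat.sInf_le ⟨D, rfl, hn⟩) (le_csInf ⟨n, D, rfl, hn⟩ ?_)
  rintro m ⟨E, hE, rfl⟩
  exact ((reducesTo_congr hM hE).2 h.reducesTo).le_card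

end KnotDiagram
end FlatKnots

namespace FlatKnots

/-! ### Forms with a given based matrix -/

namespace KnotDiagram

variable {n : ℕ} {M : Matrix (Fin (n + 1)) (Fin (n + 1)) ℤ} {D : KnotDiagram}

/-- The loops of the diagram in the order given by `σ`, with `s` first. -/
def orderedLoop (σ : D.Arrow ≃ Fin n) : Fin (n + 1) → EdgeChain :=
  Fin.cases (D.loop none) fun i => D.loop (some (σ.symm i))

theorem orderedLoop_succ (σ : D.Arrow ≃ Fin n) (i : Fin n) :
    orderedLoop σ i.succ = D.loop (some (σ.symm i)) := rfl

theorem form_orderedLoop {σ : D.Arrow ≃ Fin n}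
    (hσ : ∀ x y, D.basedMatrix x y =
      M (x.elim 0 fun a => (σ a).succ) (y.elim 0 fun a => (σ a).succ)) (i j : Fin (n + 1)) :
    form D.arrows (orderedLoop σ i) (orderedLoop σ j) = M i j := by
  have key : ∀ i : Fin (n + 1), ∃ x : Option D.Arrow, x.elim 0 (fun a => (σ a).succ) = i ∧
      D.loop (x.map Subtype.val) = orderedLoop σ i := by
    intro i
    cases i using Fin.cases with
    | zero => exact ⟨none, rfl, rfl⟩
    | succ i => exact ⟨some (σ.symm i), by simp, rfl⟩
  obtain ⟨x, rfl, hx⟩ := key i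
  obtain ⟨y, rfl, hy⟩ := key j
  rw [← hx, ← hy, ← basedMatrix_eq_form, hσ]

theorem exists_agree_orderedLoop (σ : D.Arrow ≃ Fin n) {x : EdgeChain} (hx : Closed x D.word) :
    ∃ c : Fin (n + 1) → ℤ, (∀ i, c i.succ = x.2 (σ.symm i)) ∧
      D.Agree x (∑ i, c i • orderedLoop σ i) := by
  obtain ⟨k, hk⟩ := exists_agree_sum hx
  refine ⟨Fin.cases k fun i => x.2 (σ.symm i), fun i => rfl, ?_⟩
  have hs : ∑ i, x.2 (σ.symm i) • D.loop (some (σ.symm i)) =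
      ∑ a : D.Arrow, x.2 a • D.loop (some a) := Fintype.sum_equiv σ.symm _ _ fun _ => rfl
  rw [← hs] at hk
  rw [Fin.sum_univ_succ]
  exact hk

theorem form_eq_sum {σ : D.Arrow ≃ Fin n}
    (hσ : ∀ x y, D.basedMatrix x y =
      M (x.elim 0 fun a => (σ a).succ) (y.elim 0 fun a => (σ a).succ)) {x y : EdgeChain}
    {c d : Fin (n + 1) → ℤ} (hx : D.Agree x (∑ i, c i • orderedLoop σ i))
    (hy : D.Agree y (∑ i, d i • orderedLoop σ i)) :
    form D.arrows x y = ∑ i, ∑ j, c i * d j * M i j := by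
  rw [hx.form hy, ← formHom_apply, map_sum (formHom D.arrows), AddMonoidHom.finsetSum_apply]
  refine Finset.sum_congr rfl fun i _ => ?_
  rw [map_sum]
  refine Finset.sum_congr rfl fun j _ => ?_
  rw [map_zsmul, map_zsmul, AddMonoidHom.zsmul_apply, formHom_apply, form_orderedLoop hσ,
    smul_eq_mul, smul_eq_mul]
  ring

/-- A filling with an isotropic form gives an involution of the arrows. -/
theorem HasBasedMatrix.exists_involution (h : D.HasBasedMatrix M)
    (hD : D.HasDiscFilling IsotropicForm) : ∃ g : Fin n → Fin n, (∀ i, g (g i) = i) ∧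
      ∀ i j, M i.succ j.succ + M i.succ (g j).succ + M (g i).succ j.succ +
        M (g i).succ (g j).succ = 0 := by
  obtain ⟨σ, hσ⟩ := h
  obtain ⟨f, hf, hfix, hq⟩ := hasDiscFilling_iff.1 hD
  have hmem : ∀ a : D.Arrow, f a ∈ D.arrows := fun a => by
    by_contra h'
    have := hfix _ h'
    rw [hf] at this
    exact h' (this ▸ a.2)
  let g : Fin n → Fin n := fun i => σ ⟨f (σ.symm i), hmem _⟩
  have hg : ∀ i, ((σ.symm (g i) : D.Arrow) : ℕ) = f (σ.symm i) := fun i => by simp [g]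
  have hgg : ∀ i, g (g i) = i := fun i =>
    σ.symm.injective (Subtype.ext (by rw [hg, hg, hf]))
  refine ⟨g, hgg, fun i j => ?_⟩
  -- For a fixed point of `g` this is twice the loop. The growth is still invariant, and the factor
  -- 2 does not affect the vanishing.
  let u : Fin n → EdgeChain := fun i => orderedLoop σ i.succ + orderedLoop σ (g i).succ
  have hu : ∀ i, u i ∈ D.invariantFlows f := by
    intro i
    refine ⟨(closed_loop_some (σ.symm i).2).add (closed_loop_some (σ.symm (g i)).2), fun a => ?_⟩
    have h₁ : ∀ b, f a = b ↔ a = f b :=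
      fun b => ⟨fun h => by rw [← h, hf], fun h => by rw [h, hf]⟩
    simp only [u, orderedLoop_succ, Prod.snd_add, Pi.add_apply, loop_snd_apply, hg, h₁, hf]
    exact add_comm (G := ℤ) _ _
  have := hq ![u i, u j, 0, 0] fun k => by
    fin_cases k
    · exact hu i
    · exact hu j
    · exact zero_mem _
    · exact zero_mem _
  simp only [IsotropicForm, Matrix.cons_val_zero, Matrix.cons_val_one, u, form_add_left,
    form_add_right, form_orderedLoop hσ] at this
  linarith

/-- An involution of the arrows gives a filling. -/
theorem HasBasedMatrix.hasDiscFilling {q : (Fin 4 → Fin 4 → ℤ) → Prop} (h : D.HasBasedMatrix M)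
    {g : Fin n → Fin n} (hg : ∀ i, g (g i) = i)
    (hq : ∀ c : Fin 4 → Fin (n + 1) → ℤ, (∀ k i, c k (g i).succ = c k i.succ) →
      q fun k l => ∑ i, ∑ j, c k i * c l j * M i j) : D.HasDiscFilling q := by
  obtain ⟨σ, hσ⟩ := h
  let f : ℕ → ℕ := fun a => if ha : a ∈ D.arrows then σ.symm (g (σ ⟨a, ha⟩)) else a
  have hf : ∀ a : D.Arrow, f a = σ.symm (g (σ a)) := fun a => dif_pos a.2
  refine hasDiscFilling_iff.2 ⟨f, fun a => ?_, fun a ha => dif_neg ha, fun v hv => ?_⟩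
  · by_cases ha : a ∈ D.arrows
    · rw [hf ⟨a, ha⟩, hf]
      simp [hg]
    · have : f a = a := dif_neg ha
      rw [this, this]
  · choose c hc hcv using fun k => exists_agree_orderedLoop σ (hv k).1
    simp only [form_eq_sum hσ (hcv _) (hcv _)]
    refine hq c fun k i => ?_
    rw [hc, hc, ← (hv k).2 (σ.symm i), hf, Equiv.apply_symm_apply]

/-! ### Genus and the slice obstruction from disc fillings -/

theorem isLeast_fillingRanks (h₁ : ¬ D.HasDiscFilling IsotropicForm)
    (h₂ : D.HasDiscFilling PfaffianZero) : IsLeast (fillingRanks D.basedMatrix) 2 := by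
  have hlow : ∀ r ∈ fillingRanks D.basedMatrix, 2 ≤ r := by
    rintro r ⟨P, hP, rfl⟩
    by_contra hr
    exact h₁ (hasDiscFilling_isotropic hP
      (eq_zero_of_rank_le_one (fillingMatrix_swap P) (by omega)))
  obtain ⟨P, hP, hr⟩ := exists_filling_pfaffianZero h₂
  exact ⟨⟨P, hP, le_antisymm hr (hlow _ ⟨P, hP, rfl⟩)⟩, hlow⟩

/-- Both conditions pass to every diagram `E` of the flat knot, so the minimal rank is 2 for each of
them. -/
theorem hasAlgebraicGenus_one (h₁ : ¬ D.HasDiscFilling IsotropicForm)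
    (h₂ : D.HasDiscFilling PfaffianZero) : D.toFlatKnot.HasAlgebraicGenus 1 := by
  intro E hE
  rw [← hasDiscFilling_congr hE] at h₁ h₂
  rw [matrixGenus, (isLeast_fillingRanks h₁ h₂).csInf_eq]
  norm_num

theorem not_isSlice (h : ¬ D.HasDiscFilling IsotropicForm) : ¬ D.toFlatKnot.IsSlice := by
  rintro ⟨E, hE, t, m, hmovie⟩
  exact h ((hasDiscFilling_congr hE).1 (hasDiscFilling_of_movie rfl hmovie))

end KnotDiagram

theorem FlatKnot.HasAlgebraicGenus.unique {α : FlatKnot} {g g' : ℚ} (h : α.HasAlgebraicGenus g)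
    (h' : α.HasAlgebraicGenus g') : g = g' := by
  obtain ⟨D, rfl⟩ := Quot.exists_rep α
  exact (h D rfl).symm.trans (h' D rfl)

theorem KnotDiagram.HasBasedMatrix.isAlmostClassical {n : ℕ}
    {M : Matrix (Fin (n + 1)) (Fin (n + 1)) ℤ} {D : KnotDiagram} (h : D.HasBasedMatrix M)
    (hM : ∀ i : Fin n, M i.succ 0 = 0) : D.IsAlmostClassical := by
  obtain ⟨σ, hσ⟩ := h
  intro a ha
  rw [index_eq_basedMatrix ⟨a, ha⟩, hσ]
  exact hM _

/-! ### The example -/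

theorem isPrimitiveMatrix_ac11_7183 : IsPrimitiveMatrix ac11_7183_matrix := by
  unfold IsPrimitiveMatrix
  decide +kernel

/-- The search over all involutions is cut down to a few partners. The index `i` stands for the
arrow `i + 1`, and `Q i x j y` says that the blocks of `i` with `x` and of `j` with `y` have
intersection number zero. -/
theorem ac11_7183_no_involution (g : Fin 11 → Fin 11) (hg : ∀ i, g (g i) = i) :
    ¬ ∀ i j : Fin 11, ac11_7183_matrix i.succ j.succ + ac11_7183_matrix i.succ (g j).succ +
      ac11_7183_matrix (g i).succ j.succ + ac11_7183_matrix (g i).succ (g j).succ = 0 := by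
  let Q (i x j y : Fin 11) : Prop := ac11_7183_matrix i.succ j.succ +
    ac11_7183_matrix i.succ y.succ + ac11_7183_matrix x.succ j.succ +
      ac11_7183_matrix x.succ y.succ = 0
  -- Here `x`, `y`, `z` are the partners of the arrows 4, 11 and 8. Isotropy among these three
  -- blocks, with two consequences of `g` being an involution, leaves three possibilities.
  have key : ∀ x y z : Fin 11, Q 3 x 10 y → Q 3 x 7 z → Q 10 y 7 z → y ≠ z → (x = 7 → z = 3) →
      x = 2 ∧ y = 1 ∧ z = 5 ∨ x = 7 ∧ y = 8 ∧ z = 3 ∨ x = 10 ∧ y = 3 ∧ z = 7 := by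
    decide +kernel
  -- Each possibility is refuted by one further block, that of the arrow 10 in the first case and
  -- that of the arrow 2 in the other two: no partner `w` is orthogonal to both blocks used.
  have h₁ : ∀ w, ¬ (Q 9 w 3 2 ∧ Q 9 w 10 1) := by decide +kernel
  have h₂ : ∀ w, ¬ (Q 1 w 10 8 ∧ Q 1 w 7 3) := by decide +kernel
  have h₃ : ∀ w, ¬ (Q 1 w 3 10 ∧ Q 1 w 7 7) := by decide +kernel
  intro h
  have hQ : ∀ i j, Q i (g i) j (g j) := h
  have hinj : Function.Injective g := fun i j hij => by rw [← hg i, hij, hg]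
  rcases key (g 3) (g 10) (g 7) (hQ _ _) (hQ _ _) (hQ _ _) (hinj.ne (by decide))
    (fun h => by rw [← h, hg]) with ⟨hx, hy, hz⟩ | ⟨hx, hy, hz⟩ | ⟨hx, hy, hz⟩
  · have e₁ := hQ 9 3
    have e₂ := hQ 9 10
    rw [hx] at e₁
    rw [hy] at e₂
    exact h₁ _ ⟨e₁, e₂⟩
  · have e₁ := hQ 1 10
    have e₂ := hQ 1 7
    rw [hy] at e₁
    rw [hz] at e₂
    exact h₂ _ ⟨e₁, e₂⟩
  · have e₁ := hQ 1 3
    have e₂ := hQ 1 7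
    rw [hx] at e₁
    rw [hz] at e₂
    exact h₃ _ ⟨e₁, e₂⟩

/-- The hypotheses are invariance under the pairing 3–4, 5–10, 7–8, 9–11. On such coefficients the
form is the wedge of two linear functionals, so its Pfaffians vanish. -/
theorem ac11_7183_form (c d : Fin 12 → ℤ) (hc : c 4 = c 3 ∧ c 10 = c 5 ∧ c 8 = c 7 ∧ c 11 = c 9)
    (hd : d 4 = d 3 ∧ d 10 = d 5 ∧ d 8 = d 7 ∧ d 11 = d 9) :
    ∑ i, ∑ j, c i * d j * ac11_7183_matrix i j =
      (c 1 + 2 * c 2 - c 5 - c 6 - c 7) * (d 3 - d 2) -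
        (c 3 - c 2) * (d 1 + 2 * d 2 - d 5 - d 6 - d 7) := by
  obtain ⟨h₁, h₂, h₃, h₄⟩ := hc
  obtain ⟨e₁, e₂, e₃, e₄⟩ := hd
  simp only [Fin.sum_univ_succ, Fin.sum_univ_zero]
  simp [ac11_7183_matrix]
  rw [h₁, h₂, h₃, h₄, e₁, e₂, e₃, e₄]
  ring

theorem ac11_7183_hasDiscFilling_pfaffianZero {D : KnotDiagram}
    (h : D.HasBasedMatrix ac11_7183_matrix) : D.HasDiscFilling PfaffianZero := by
  -- The pairing above with indices lowered by one; the arrows 1, 2 and 6 form blocks of their own.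
  refine h.hasDiscFilling (g := ![0, 1, 3, 2, 9, 5, 7, 6, 10, 4, 8]) (by decide) fun c hc => ?_
  have h' : ∀ k, c k 4 = c k 3 ∧ c k 10 = c k 5 ∧ c k 8 = c k 7 ∧ c k 11 = c k 9 :=
    fun k => ⟨hc k 2, hc k 4, hc k 6, hc k 8⟩
  simp only [PfaffianZero, ac11_7183_form _ _ (h' _) (h' _)]
  ring

/-- The properties of a flat knot with the based matrix of ac11.7183. -/
theorem properties_of_ac11_7183_matrix {D : KnotDiagram}
    (h : D.HasBasedMatrix ac11_7183_matrix) :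
    IsLeast (fillingRanks D.basedMatrix) 2 ∧ D.toFlatKnot.crossingNumber = 11 ∧
      D.toFlatKnot.IsAlmostClassical ∧ D.toFlatKnot.HasAlgebraicGenus 1 ∧
      ¬ D.toFlatKnot.IsAlgebraicallySlice ∧ ¬ D.toFlatKnot.IsSlice := by
  have h₁ : ¬ D.HasDiscFilling IsotropicForm := fun h' => by
    obtain ⟨g, hg, hM⟩ := h.exists_involution h'
    exact ac11_7183_no_involution g hg hM
  have h₂ := ac11_7183_hasDiscFilling_pfaffianZero h
  have hgenus := KnotDiagram.hasAlgebraicGenus_one h₁ h₂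
  exact ⟨KnotDiagram.isLeast_fillingRanks h₁ h₂, h.crossingNumber_eq isPrimitiveMatrix_ac11_7183,
    ⟨D, rfl, h.isAlmostClassical (by decide)⟩, hgenus,
    fun h' => one_ne_zero (hgenus.unique h'), KnotDiagram.not_isSlice h₁⟩

theorem basedMatrix_ac11_7183 (x y : Option ac11_7183_diagram.Arrow) :
    ac11_7183_diagram.basedMatrix x y =
      ac11_7183_matrix (x.elim 0 fun a => Fin.ofNat 12 a.1) (y.elim 0 fun a => Fin.ofNat 12 a.1) := by
  have key : ∀ z : Option ac11_7183_diagram.Arrow × Option ac11_7183_diagram.Arrow,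
      ac11_7183_diagram.basedMatrix z.1 z.2 =
        ac11_7183_matrix (z.1.elim 0 fun a => Fin.ofNat 12 a.1)
          (z.2.elim 0 fun a => Fin.ofNat 12 a.1) := by
    decide +kernel
  exact key (x, y)

theorem hasBasedMatrix_ac11_7183 : ac11_7183_diagram.HasBasedMatrix ac11_7183_matrix := by
  have hmem : ∀ i : Fin 11, i.1 + 1 ∈ ac11_7183_diagram.arrows := by decide
  have hle : ∀ a ∈ ac11_7183_diagram.arrows, 1 ≤ a ∧ a ≤ 11 := by decide
  refine ⟨⟨fun a => ⟨a.1 - 1, by have := hle a a.2; omega⟩, fun i => ⟨i.1 + 1, hmem i⟩,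
    fun a => ?_, fun i => ?_⟩, fun x y => ?_⟩
  · have := hle a a.2
    exact Subtype.ext (by simp only; omega)
  · exact Fin.ext (by simp)
  · rw [basedMatrix_ac11_7183]
    have key : ∀ z : Option ac11_7183_diagram.Arrow, (z.elim 0 fun a => Fin.ofNat 12 a.1) =
        z.elim (0 : Fin 12) fun a => Fin.succ ⟨a.1 - 1, by have := hle a a.2; omega⟩ := by
      rintro (_ | a)
      · rfl
      · have := hle a a.2
        refine Fin.ext ?_
        simp only [Option.elim_some, Fin.ofNat, Fin.succ_mk]
        omega
    rw [key, key]
    rfl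

end FlatKnots

theorem mainTheorem3 :
    -- the based matrix of the diagram, with the arrows in the order 1, ..., 11
    (∀ x y : Option FlatKnots.ac11_7183_diagram.Arrow,
      FlatKnots.ac11_7183_diagram.basedMatrix x y =
        FlatKnots.ac11_7183_matrix (x.elim 0 fun a => Fin.ofNat 12 a.1)
          (y.elim 0 fun a => Fin.ofNat 12 a.1)) ∧
    FlatKnots.ac11_7183_diagram.HasBasedMatrix FlatKnots.ac11_7183_matrix ∧
    -- the flat knot ac11.7183
    (FlatKnots.ac11_7183.crossingNumber = 11 ∧
      FlatKnots.ac11_7183.IsAlmostClassical ∧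
      FlatKnots.ac11_7183.HasAlgebraicGenus 1 ∧
      ¬ FlatKnots.ac11_7183.IsAlgebraicallySlice ∧
      ¬ FlatKnots.ac11_7183.IsSlice) ∧
    -- the same for every flat knot that has a diagram with this based matrix
    (∀ D : FlatKnots.KnotDiagram, D.HasBasedMatrix FlatKnots.ac11_7183_matrix →
      IsLeast (FlatKnots.fillingRanks D.basedMatrix) 2 ∧
      D.toFlatKnot.crossingNumber = 11 ∧
      D.toFlatKnot.IsAlmostClassical ∧
      D.toFlatKnot.HasAlgebraicGenus 1 ∧
      ¬ D.toFlatKnot.IsAlgebraicallySlice ∧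
      ¬ D.toFlatKnot.IsSlice) ∧
    -- almost classical flat knots need be neither algebraically slice nor slice
    (¬ ∀ α : FlatKnots.FlatKnot, α.IsAlmostClassical → α.IsAlgebraicallySlice) ∧
    (¬ ∀ α : FlatKnots.FlatKnot, α.IsAlmostClassical → α.IsSlice) := by
  have h := FlatKnots.hasBasedMatrix_ac11_7183
  have hp := (FlatKnots.properties_of_ac11_7183_matrix h).2
  exact ⟨FlatKnots.basedMatrix_ac11_7183, h, hp,
    fun _ => FlatKnots.properties_of_ac11_7183_matrix,
    fun h' => hp.2.2.2.1 (h' _ hp.2.1), fun h' => hp.2.2.2.2 (h' _ hp.2.1)⟩
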